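/- **Setting.** Let $G=(V,E,F)$ be a finite oriented triangulated disk, and consider a circle packing in the plane with the combinatorics of $G$: circles $C_u$ ($u\in V$) with centers $c_u$ and radii $R_u>0$, externally tangent along every edge of $G$, such that each face is mapped to a positively oriented triangle of centers. For an edge $\{uv\}$ of $G$ let $z_{uv}$ be the tangency point of $C_u$ and $C_v$. Let $TMG$ be a triangulation of the medial graph of $G$ without additional vertices. That is, the vertices of $TMG$ are the edges of $G$, and its faces are (i) for every face $uvw$ of $G$ the triangle $\{uv\},\{vw\},\{wu\}$, and (ii) for every vertex $u$ of $G$ (interior or boundary) the triangles of a triangulation, without additional vertices, of the polygon whose vertices are the edges of $G$ at $u$ in cyclic order (a 2-gon contributes no triangle). Via (i), $F(G)\subset F(TMG)$. Assume $z_i\ne z_j$ for all $\{ij\}\in E(TMG)$ (this is automatic if the discs of the packing have disjoint interiors). **Differentials and realizations.** For an interior edge $\{uv\}$ of $G$ with left face $uvs$ and right face $vut$ of the oriented edge $e_{uv}$, put $i=\{uv\}$, $k=\{us\}$, $m=\{ut\}$ and $\omega(e_{uv})=\frac{(z_k-z_i)(z_m-z_i)}{z_m-z_k}$. * $\lambda:E_{int}(G)\to\mathbb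 R$ is a holomorphic quadratic differential *of Koebe type* if for every interior vertex $u$ of $G$ $$\sum_v\frac{\lambda_{uv}}{\omega(e_{uv})}=\sum_v\frac{\lambda_{uv}}{\omega(e_{uv})}z_{uv}=\sum_v\frac{\lambda_{uv}}{\omega(e_{uv})}z_{uv}^2=0.$$ Its Weierstrass realizations are the maps $\mathcal F:F(G)\to\mathbb C^3$ with $$\mathcal F_{\mathrm{left}(e_{uv})}-\mathcal F_{\mathrm{right}(e_{uv})}=\frac{\lambda_{uv}}{\omega(e_{uv})}\begin{pmatrix}1-z_{uv}^2\\ \mathbf i(1+z_{uv}^2)\\ 2z_{uv}\end{pmatrix}\quad\text{for all interior edges of } G.$$ * $q:E_{int}(TMG)\to\mathbb R$ is a holomorphic quadratic differential *of general type* if for every interior vertex $i$ of $TMG$ one has $\sum_j q_{ij}=0$ and $\sum_j \frac{q_{ij}}{z_j-z_i}=0$. Its Weierstrass realizations are the maps $\hat{\mathcal F}:F(TMG)\to\mathbb C^3$ with $$\hat{\mathcal F}_{\mathrm{left}(e_{ij})}-\hat{\mathcal F}_{\mathrm{right}(e_{ij})}=\frac{q_{ij}}{z_j-z_i}\begin{pmatrix}1-z_iz_j\\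 \mathbf i(1+z_iz_j)\\ z_i+z_j\end{pmatrix}\quad\text{for all interior edges of } TMG.$$ **Minimal surfaces.** Let $\sigma$ be stereographic projection from $\mathbb C$ to the unit sphere of $\mathbb R^3$. The Koebe polyhedral surface $N_C:F(G)\to\mathbb R^3$ of the packing (if it exists with finite vertices) is the one whose face dual to $u\in V$ lies in the plane of the circle $\sigma(C_u)$. A map $f:F(G)\to\mathbb R^3$ is a discrete minimal surface *of Koebe type* with normal $N=N_C$ if corresponding edges of $f$ and $N$ are parallel and $\sum_j (f_j\times N_{j+1}+N_j\times f_{j+1})=0$ for every interior vertex $u$ of $G$, where the sum is over the cyclically ordered faces around $u$. A map $g:F(TMG)\to\mathbb R^3$ is a discrete minimal surface *of general type* with face normals $\sigma(z_i)$ if for every interior edge $\{ij\}$ of $TMG$ the edge vector $g_{\mathrm{left}(e_{ij})}-g_{\mathrm{right}(e_{ij})}$ is orthogonal to $\sigma(z_i)$ and $\sigma(z_j)$, and for every interior vertex $i$ of $TMG$ one has $\sum_j\ell_{ij}\tan\frac{\alpha_{ij}}2=0$, where $\ell_{ij}$ is the length of this edge vector and $\alpha_{ij}\in(-\pi,\pi)$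 is the signed dihedral angle between the normals $\sigma(z_i),\sigma(z_j)$. **Theorem 6.1.** There is a one-to-one correspondence $\lambda\leftrightarrow q$ between the holomorphic quadratic differentials of Koebe type on $E_{int}(G)$ and those of general type on $E_{int}(TMG)$ such that the following holds. 1. If $\lambda\leftrightarrow q$, then Weierstrass realizations $\mathcal F$ of $\lambda$ and $\hat{\mathcal F}$ of $q$ exist, and any two such realizations satisfy $\hat{\mathcal F}|_{F(G)}=\mathcal F$ up to a translation of $\mathbb C^3$. 2. Every discrete minimal surface $f$ of Koebe type with normal $N_C$ extends to general type: there are corresponding $\lambda\leftrightarrow q$ with Weierstrass realizations $\mathcal F$, $\hat{\mathcal F}$ such that $\operatorname{Re}\mathcal F=f$ and $\hat{\mathcal F}|_{F(G)}=\mathcal F$ (so $\operatorname{Re}\hat{\mathcal F}$ extends $f$), and, if $\sigma(z_i)\neq-\sigma(z_j)$ for all $\{ij\}\in E(TMG)$, the conjugate surface $\operatorname{Im}\hat{\mathcal F}$ is a discrete minimal surface of general type with face normals $\sigma(z_i)$. -/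

import Mathlib

open scoped Matrix

/-! ### Oriented triangle meshes -/

/-- The oriented triangle `u → v → w → u`, as a cyclic word. -/
def tri {V : Type*} (u v w : V) : Cycle V := (([u, v, w] : List V) : Cycle V)

/-- A finite oriented triangle mesh: a finite set of oriented triangles with three distinct vertices
such that every oriented edge belongs to at most one triangle (so that every edge lies in at most two
triangles, and the orientations of neighbouring triangles agree). -/
structure TriMesh (V : Type*) where
  faces : Finset (Cycle V)
  eq_tri : ∀ f ∈ faces, ∃ u v w, u ≠ v ∧ v ≠ w ∧ w ≠ u ∧ f = tri u v w
  unique_left : ∀ u v w w', tri u v w ∈ faces → tri u v w' ∈ faces → w = w'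

namespace TriMesh

variable {V : Type*} (G : TriMesh V)

/-- The type of faces. -/
def Face : Type _ := {f : Cycle V // f ∈ G.faces}

/-- The oriented edge `e_{uv}` occurs in the boundary of some face, which is then the face to the left
of `e_{uv}`. -/
def DEdge (u v : V) : Prop := ∃ w, tri u v w ∈ G.faces

/-- The 1-skeleton. -/
def graph : SimpleGraph V where
  Adj u v := u ≠ v ∧ (G.DEdge u v ∨ G.DEdge v u)
  symm := ⟨fun _ _ h => ⟨h.1.symm, h.2.symm⟩⟩
  loopless := ⟨fun _ h => h.1 rfl⟩

/-- `{uv}` is an interior edge: it has a face on its left and a face on its right. -/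
def IsIntEdge (u v : V) : Prop := G.DEdge u v ∧ G.DEdge v u

variable {G} in
theorem IsIntEdge.symm {u v : V} (h : G.IsIntEdge u v) : G.IsIntEdge v u := ⟨h.2, h.1⟩

/-- The type `E_int` of (unoriented) interior edges. -/
def IntEdge : Type _ := {e : Sym2 V // ∃ u v, e = s(u, v) ∧ G.IsIntEdge u v}

/-- The type of neighbours of `u` along interior edges. -/
def IntNbr (u : V) : Type _ := {v : V // G.IsIntEdge u v}

noncomputable instance [Finite V] (u : V) : Fintype (G.IntNbr u) :=
  @Fintype.ofFinite _ (Subtype.finite : Finite {v : V // G.IsIntEdge u v})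

/-- `u` is an interior vertex: it is a vertex of the mesh and all edges at `u` are interior. -/
def IsIntVertex (u : V) : Prop := (∃ v, G.DEdge u v) ∧ ∀ v, G.DEdge u v ↔ G.DEdge v u

variable {G}

/-- An interior edge `{uv}` as an element of `E_int`. -/
def IsIntEdge.edge {u v : V} (h : G.IsIntEdge u v) : G.IntEdge := ⟨s(u, v), u, v, rfl, h⟩

/-- The third vertex of the face to the left of `e_{uv}`. -/
noncomputable def IsIntEdge.leftApex {u v : V} (h : G.IsIntEdge u v) : V := h.1.choose

/-- The third vertex of the face to the right of `e_{uv}`. -/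
noncomputable def IsIntEdge.rightApex {u v : V} (h : G.IsIntEdge u v) : V := h.2.choose

/-- The face to the left of `e_{uv}`. -/
noncomputable def IsIntEdge.left {u v : V} (h : G.IsIntEdge u v) : G.Face :=
  ⟨tri u v h.leftApex, h.1.choose_spec⟩

/-- The face to the right of `e_{uv}`. -/
noncomputable def IsIntEdge.right {u v : V} (h : G.IsIntEdge u v) : G.Face :=
  ⟨tri v u h.rightApex, h.2.choose_spec⟩

variable (G)

/-- `w = [w₀, …, wₖ]` lists the neighbours of `u` counterclockwise: either the faces at `u` are
`u w₀ w₁, …, u wₖ₋₁ wₖ` (boundary vertex), or they are these together with `u wₖ w₀`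
(interior vertex). -/
def IsLink (u : V) (w : List V) : Prop :=
  w.Nodup ∧
    ((2 ≤ w.length ∧ ∀ a b, tri u a b ∈ G.faces ↔ [a, b] <:+: w) ∨
     (3 ≤ w.length ∧ ∀ a b, tri u a b ∈ G.faces ↔
        [a, b] <:+: w ∨ (w.getLast? = some a ∧ w.head? = some b)))

/-- `G` is a triangulated disk with vertex set `V`: a connected oriented triangulated surface (every
vertex link is a path or a cycle) with non-empty boundary and Euler characteristic `1`. -/
structure IsDisk : Prop where
  link : ∀ u, ∃ w, G.IsLink u w
  connected : G.graph.Connected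
  boundary : ∃ u v, G.DEdge u v ∧ ¬ G.DEdge v u
  euler : (Nat.card V : ℤ) - Nat.card G.graph.edgeSet + G.faces.card = 1

end TriMesh

/-! ### Triangulations of the medial graph -/

/-- `PolygonTriangulation p S`: the set `S` of oriented triangles is a triangulation of the polygon
with consecutive vertices `p = [p₀, …, pₙ]` without additional vertices. A 2-gon has the empty
triangulation; otherwise the triangle at the edge `pₙ p₀` has some apex `pₖ`, and what remains are
triangulations of the polygons `[p₀, …, pₖ]` and `[pₖ, …, pₙ]`. -/
inductive PolygonTriangulation {W : Type*} : List W → Set (Cycle W) → Prop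
  | segment (a b : W) : PolygonTriangulation [a, b] ∅
  | glue (a b c : W) (l r : List W) (S S' : Set (Cycle W)) :
      PolygonTriangulation (a :: (l ++ [b])) S → PolygonTriangulation (b :: (r ++ [c])) S' →
      PolygonTriangulation (a :: (l ++ b :: (r ++ [c]))) (insert (tri a b c) (S ∪ S'))

/-- `T` is a triangulation of the medial graph of `G`. Its vertices are the edges of `G`. Its faces are
the medial triangles `{uv}, {vw}, {wu}` of the faces `uvw` of `G`, and the triangles of a triangulation
of the polygon formed, for each vertex `u` of `G`, by the edges of `G` at `u` in cyclic order. -/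
def TriMesh.IsMedialTriangulation {V : Type*} (G : TriMesh V) (T : TriMesh (Sym2 V)) : Prop :=
  ∃ S : V → Set (Cycle (Sym2 V)),
    (∀ u, ∃ w, G.IsLink u w ∧ PolygonTriangulation (w.map fun v => s(u, v)) (S u)) ∧
    ∀ f, f ∈ T.faces ↔
      (∃ u v w, tri u v w ∈ G.faces ∧ f = tri s(u, v) s(v, w) s(w, u)) ∨ ∃ u, f ∈ S u

/-- The inclusion of the faces of `G` into the faces of a triangulation of the medial graph. -/
theorem TriMesh.IsMedialTriangulation.mem {V : Type*} {G : TriMesh V} {T : TriMesh (Sym2 V)}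
    (hT : G.IsMedialTriangulation T) {u v w : V} (h : tri u v w ∈ G.faces) :
    tri s(u, v) s(v, w) s(w, u) ∈ T.faces := by
  obtain ⟨S, -, hS⟩ := hT
  exact (hS _).2 (Or.inl ⟨u, v, w, h, rfl⟩)

/-! ### Circle packings -/

/-- A circle packing in the plane with the combinatorics of `G`: circles with centers `c u` and radii
`R u`, externally tangent along every edge of `G`, such that every (oriented) face is mapped to a
positively oriented triangle of centers. -/
structure CirclePacking {V : Type*} (G : TriMesh V) where
  c : V → ℂ
  R : V → ℝ
  R_pos : ∀ u, 0 < R u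
  tangent : ∀ u v, G.graph.Adj u v → dist (c u) (c v) = R u + R v
  oriented : ∀ u v w, tri u v w ∈ G.faces →
    0 < ((starRingEnd ℂ) (c v - c u) * (c w - c u)).im

/-- The tangency point of the circles at the end points of an edge. -/
noncomputable def CirclePacking.tangency {V : Type*} {G : TriMesh V} (P : CirclePacking G) :
    Sym2 V → ℂ :=
  Sym2.lift ⟨fun u v => (P.R v * P.c u + P.R u * P.c v) / (P.R u + P.R v), fun u v => by
    simp only [add_comm]⟩

/-! ### Discrete holomorphic quadratic differentials and their Weierstrass realizations -/

section

variable {V : Type*} [Finite V]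

/-- Holomorphic quadratic differentials of general type on a realized triangle mesh `z`. -/
def IsGeneralHQD (T : TriMesh V) (z : V → ℂ) (q : T.IntEdge → ℝ) : Prop :=
  ∀ i, T.IsIntVertex i →
    ∑ j : T.IntNbr i, q j.2.edge = 0 ∧
    ∑ j : T.IntNbr i, (q j.2.edge : ℂ) / (z j.1 - z i) = 0

/-- The Weierstrass formula for differentials of general type. -/
def IsGeneralRealization (T : TriMesh V) (z : V → ℂ) (q : T.IntEdge → ℝ)
    (F : T.Face → Fin 3 → ℂ) : Prop :=
  ∀ (i j : V) (h : T.IsIntEdge i j),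
    F h.left - F h.right = ((q h.edge : ℂ) / (z j - z i)) •
      ![1 - z i * z j, Complex.I * (1 + z i * z j), z i + z j]

/-- The 1-form `ω(e_{uv}) = (z_k - z_i)(z_m - z_i)/(z_m - z_k)`, where `i = {uv}`, `k = {us}`,
`m = {ut}` and `s`, `t` are the third vertices of the left and right faces of `e_{uv}`. -/
noncomputable def CirclePacking.omega {G : TriMesh V} (P : CirclePacking G) {u v : V}
    (h : G.IsIntEdge u v) : ℂ :=
  (P.tangency s(u, h.leftApex) - P.tangency s(u, v)) *
    (P.tangency s(u, h.rightApex) - P.tangency s(u, v)) /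
    (P.tangency s(u, h.rightApex) - P.tangency s(u, h.leftApex))

/-- Holomorphic quadratic differentials of Koebe type. -/
def IsKoebeHQD {G : TriMesh V} (P : CirclePacking G) (l : G.IntEdge → ℝ) : Prop :=
  ∀ u, G.IsIntVertex u →
    ∑ v : G.IntNbr u, (l v.2.edge : ℂ) / P.omega v.2 = 0 ∧
    ∑ v : G.IntNbr u, (l v.2.edge : ℂ) / P.omega v.2 * P.tangency s(u, v.1) = 0 ∧
    ∑ v : G.IntNbr u, (l v.2.edge : ℂ) / P.omega v.2 * P.tangency s(u, v.1) ^ 2 = 0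

/-- The Weierstrass formula for differentials of Koebe type. -/
def IsKoebeRealization {G : TriMesh V} (P : CirclePacking G) (l : G.IntEdge → ℝ)
    (F : G.Face → Fin 3 → ℂ) : Prop :=
  ∀ (u v : V) (h : G.IsIntEdge u v),
    F h.left - F h.right = ((l h.edge : ℂ) / P.omega h) •
      ![1 - P.tangency s(u, v) ^ 2, Complex.I * (1 + P.tangency s(u, v) ^ 2),
        2 * P.tangency s(u, v)]

/-! ### Discrete minimal surfaces -/

/-- Stereographic projection from the plane to the unit sphere in `ℝ³`. -/
noncomputable def stereo (z : ℂ) : Fin 3 → ℝ :=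
  (1 + ‖z‖ ^ 2)⁻¹ • ![2 * z.re, 2 * z.im, ‖z‖ ^ 2 - 1]

/-- `N` gives the vertices of the Koebe polyhedral surface of the packing: the face of `N` dual to a
vertex `u` of `G` lies in the plane which cuts the unit sphere in the stereographic image of the
circle `C_u` (hence the edge of `N` dual to `{uv}` touches the sphere at the image of the tangency
point of `C_u` and `C_v`). -/
def IsKoebePolyhedron {G : TriMesh V} (P : CirclePacking G) (N : G.Face → Fin 3 → ℝ) : Prop :=
  ∀ (f : G.Face) (u : V), u ∈ f.1 →
    N f ∈ affineSpan ℝ (stereo '' Metric.sphere (P.c u) (P.R u))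

/-- `f` is a discrete minimal surface of Koebe type with vertex normal `N`: corresponding edges
of `f` and `N` are parallel and the mean curvature from Steiner's formula vanishes on every face,
i.e. at every interior vertex `u` of `G`. Going counterclockwise around `u`, one crosses `e_{uv}` from
its right face to its left face. -/
def IsKoebeMinimal (G : TriMesh V) (N f : G.Face → Fin 3 → ℝ) : Prop :=
  (∀ (u v : V) (h : G.IsIntEdge u v), ∃ r : ℝ, f h.left - f h.right = r • (N h.left - N h.right)) ∧
  ∀ u, G.IsIntVertex u →
    ∑ v : G.IntNbr u, (f v.2.right ⨯₃ N v.2.left + N v.2.right ⨯₃ f v.2.left) = 0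

/-- The quantity `ℓ tan (α / 2)` for an edge vector `e` of a polyhedral surface between two faces with
unit normals `n`, `n'`: `ℓ` is the Euclidean length of `e`, and `α ∈ (-π, π)` is the dihedral angle,
i.e. the angle between `n` and `n'`, signed by the side of `e` on which `n × n'` lies. -/
noncomputable def edgeCurvature (n n' e : Fin 3 → ℝ) : ℝ :=
  Real.sqrt (e ⬝ᵥ e) *
    Real.tan ((SignType.sign ((n ⨯₃ n') ⬝ᵥ e) : ℝ) * Real.arccos (n ⬝ᵥ n') / 2)

/-- `g` is a discrete minimal surface of general type with face normals `n`. It is defined on the dual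
of the mesh `T`: its vertices correspond to the faces of `T`, its edges to the interior edges of `T`
and its faces to the interior vertices of `T`. -/
def IsGeneralMinimal (T : TriMesh V) (n : V → Fin 3 → ℝ) (g : T.Face → Fin 3 → ℝ) : Prop :=
  (∀ (i j : V) (h : T.IsIntEdge i j),
    n i ⬝ᵥ (g h.left - g h.right) = 0 ∧ n j ⬝ᵥ (g h.left - g h.right) = 0) ∧
  ∀ i, T.IsIntVertex i →
    ∑ j : T.IntNbr i, edgeCurvature (n i) (n j.1) (g j.2.left - g j.2.right) = 0

end

/-! ### Oriented triangles, faces and interior edges. -/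

section Tri

variable {V : Type*}

/-! Identify a vector of ℂ³ with a quadratic polynomial so that `weierstrass a b` becomes (X - a)(X
- b), and read a polynomial as an infinitesimal Möbius motion. The jump of a Koebe realization
across {uv} is then λ/ω · (X - z_uv)², and the jump of a general realization across {ij} is q/(z_j -
z_i) · (X - z_i)(X - z_j). Reality of λ and q is a tangency statement: on a circle through a and b,
the tangent fields vanishing at a and b are the real multiples of (X - a)(X - b)/(b - a), and the
fields tangent to both C_u and C_v that vanish at their contact point are the real multiples of (X -
z_uv)²/ω. The latter rests on 1/ω = iκē, with e the unit vector joining the centers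
(`CirclePacking.inv_omega`).

From Koebe to general type (`IsKoebeRealization.extend`): the jump of F at an edge i of G has a
double zero at z_i, so F has a well defined value at z_i. Interpolate these values by a quadratic
polynomial on every triangle of T. The points of the polygon at u lie on C_u, and around u the map F
changes only by fields tangent to C_u. Since tangency at three points implies tangency, every jump
of the interpolation across an edge of this polygon is tangent to C_u and vanishes at both end
points, so its coefficient is real. Integration is needed only on the disk G, where an Euler
characteristic count shows that closed forms have primitives (`IsDisk.exists_primitive`).

From general to Koebe type (`toKoebe`): at the vertex {uv} of T, split the vanishing sum of jumps
into the edges in the polygon at u and those in the polygon at v. The two parts are opposite to each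
other and tangent to C_u and C_v respectively, so each is tangent to both and is a real multiple of
(X - z_uv)²/ω. If all these multiples vanish, the weights on each triangulated polygon are in
equilibrium, and without inner vertices this forces them to be zero
(`PolygonTriangulation.eq_zero_of_equilibrium`). Both linear maps are therefore injective, and
comparing dimensions makes the first one bijective.

Minimal surfaces: an edge of N_C lies on the common tangent of two circles on the sphere at σ(z),
whose direction is Im(ē · `weierstrass z z`). Hence the edges of f are real parts of Weierstrass
terms. That f closes up is the real part of the holomorphicity condition. The curvature equation is
its imaginary part, because the vector product with σ(z) turns real parts into imaginary ones
(`re_cross_stereo`). For the conjugate surface of general type, ℓ tan(α/2) equals -q on every edge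
(`edgeCurvature_eq`, `weierstrass_div_im`). -/

theorem tri_rotate (u v w : V) : tri u v w = tri v w u :=
  Cycle.coe_eq_coe.2 ⟨1, rfl⟩

theorem mem_tri {x u v w : V} : x ∈ tri u v w ↔ x = u ∨ x = v ∨ x = w := by
  simp [tri]

theorem tri_eq_iff {u v w u' v' w' : V} : tri u v w = tri u' v' w' ↔
    (u = u' ∧ v = v' ∧ w = w') ∨ (u = v' ∧ v = w' ∧ w = u') ∨ (u = w' ∧ v = u' ∧ w = v') := by
  constructor
  · intro h
    obtain ⟨n, hn⟩ := Cycle.coe_eq_coe.1 h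
    rw [← List.rotate_mod] at hn
    have : n % 3 < 3 := Nat.mod_lt _ (by norm_num)
    simp only [List.length_cons, List.length_nil, zero_add, Nat.reduceAdd] at hn
    interval_cases n % 3 <;> simp [List.rotate] at hn <;> tauto
  · rintro (⟨rfl, rfl, rfl⟩ | ⟨rfl, rfl, rfl⟩ | ⟨rfl, rfl, rfl⟩)
    · rfl
    · rw [tri_rotate, tri_rotate]
    · rw [tri_rotate]

end Tri

namespace TriMesh

variable {V : Type*} {G : TriMesh V}

theorem tri_mem_rotate {u v w : V} (h : tri u v w ∈ G.faces) : tri v w u ∈ G.faces :=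
  tri_rotate u v w ▸ h

theorem ne_of_tri_mem {u v w : V} (h : tri u v w ∈ G.faces) : u ≠ v ∧ v ≠ w ∧ w ≠ u := by
  obtain ⟨a, b, c, hab, hbc, hca, e⟩ := G.eq_tri _ h
  rcases tri_eq_iff.1 e with ⟨rfl, rfl, rfl⟩ | ⟨rfl, rfl, rfl⟩ | ⟨rfl, rfl, rfl⟩ <;>
    exact ⟨by assumption, by assumption, by assumption⟩

theorem DEdge.ne {u v : V} (h : G.DEdge u v) : u ≠ v :=
  (ne_of_tri_mem h.choose_spec).1

theorem DEdge.adj {u v : V} (h : G.DEdge u v) : G.graph.Adj u v := ⟨h.ne, Or.inl h⟩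

theorem Face.exists_eq_of_mem (f : G.Face) {u : V} (hu : u ∈ f.1) :
    ∃ v w, ∃ h : tri u v w ∈ G.faces, f = ⟨tri u v w, h⟩ := by
  obtain ⟨f, hf⟩ := f
  obtain ⟨a, b, c, -, -, -, rfl⟩ := G.eq_tri _ hf
  rcases mem_tri.1 hu with rfl | rfl | rfl
  · exact ⟨b, c, hf, rfl⟩
  · exact ⟨c, a, tri_mem_rotate hf, Subtype.ext (tri_rotate _ _ _)⟩
  · exact ⟨a, b, tri_mem_rotate (tri_mem_rotate hf),
      Subtype.ext ((tri_rotate _ _ _).trans (tri_rotate _ _ _))⟩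

theorem IsIntEdge.leftApex_mem {u v : V} (h : G.IsIntEdge u v) : tri u v h.leftApex ∈ G.faces :=
  h.1.choose_spec

theorem IsIntEdge.rightApex_mem {u v : V} (h : G.IsIntEdge u v) : tri v u h.rightApex ∈ G.faces :=
  h.2.choose_spec

/-- By `unique_left` the chosen apex is the only possible one. All later computations with `left`
and `right` go through this, so the choice in their definition never matters. -/
theorem IsIntEdge.leftApex_eq {u v w : V} (h : G.IsIntEdge u v) (hw : tri u v w ∈ G.faces) :
    h.leftApex = w :=
  G.unique_left _ _ _ _ h.leftApex_mem hw

theorem IsIntEdge.rightApex_eq {u v w : V} (h : G.IsIntEdge u v) (hw : tri v u w ∈ G.faces) :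
    h.rightApex = w :=
  G.unique_left _ _ _ _ h.rightApex_mem hw

theorem IsIntEdge.left_eq {u v w : V} (h : G.IsIntEdge u v) (hw : tri u v w ∈ G.faces) :
    h.left = ⟨tri u v w, hw⟩ :=
  Subtype.ext (congrArg (tri u v) (h.leftApex_eq hw))

theorem IsIntEdge.right_eq {u v w : V} (h : G.IsIntEdge u v) (hw : tri v u w ∈ G.faces) :
    h.right = ⟨tri v u w, hw⟩ :=
  Subtype.ext (congrArg (tri v u) (h.rightApex_eq hw))

theorem IsIntEdge.symm_left {u v : V} (h : G.IsIntEdge u v) : h.symm.left = h.right := rfl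

theorem IsIntEdge.symm_right {u v : V} (h : G.IsIntEdge u v) : h.symm.right = h.left := rfl

theorem IsIntEdge.symm_edge {u v : V} (h : G.IsIntEdge u v) : h.symm.edge = h.edge :=
  Subtype.ext Sym2.eq_swap

theorem IsIntEdge.mem_left {u v : V} (h : G.IsIntEdge u v) : u ∈ h.left.1 ∧ v ∈ h.left.1 :=
  ⟨mem_tri.2 (by simp), mem_tri.2 (by simp)⟩

theorem IsIntEdge.mem_right {u v : V} (h : G.IsIntEdge u v) : u ∈ h.right.1 ∧ v ∈ h.right.1 :=
  h.symm.mem_left.symm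

/-- The next neighbour of an interior vertex in counterclockwise order. -/
noncomputable def nextNbr {u : V} (hu : G.IsIntVertex u) (v : G.IntNbr u) : G.IntNbr u :=
  ⟨v.2.leftApex, (hu.2 _).2 ⟨v.1, tri_mem_rotate (tri_mem_rotate v.2.leftApex_mem)⟩,
    ⟨v.1, tri_mem_rotate (tri_mem_rotate v.2.leftApex_mem)⟩⟩

theorem right_nextNbr {u : V} (hu : G.IsIntVertex u) (v : G.IntNbr u) :
    (nextNbr hu v).2.right = v.2.left :=
  ((nextNbr hu v).2.right_eq (tri_mem_rotate (tri_mem_rotate v.2.leftApex_mem))).trans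
    (Subtype.ext ((tri_rotate _ _ _)))

theorem nextNbr_injective {u : V} (hu : G.IsIntVertex u) : Function.Injective (nextNbr hu) := by
  intro v v' e
  have e' : v.2.leftApex = v'.2.leftApex := congrArg Subtype.val e
  have h := tri_mem_rotate (tri_mem_rotate v.2.leftApex_mem)
  have h' := tri_mem_rotate (tri_mem_rotate v'.2.leftApex_mem)
  rw [e'] at h
  exact Subtype.ext (G.unique_left _ _ _ _ h h')

/-- Differences across the edges at an interior vertex add up to zero. -/
theorem sum_left_sub_right [Finite V] {M : Type*} [AddCommGroup M] {u : V} (hu : G.IsIntVertex u)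
    (F : G.Face → M) : ∑ v : G.IntNbr u, (F v.2.left - F v.2.right) = 0 := by
  -- Turning to the next neighbour permutes the finite set of neighbours and matches left faces with
  -- right faces, so the sum telescopes without the cyclic order being written out.
  have hb := Finite.injective_iff_bijective.1 (nextNbr_injective hu)
  rw [Finset.sum_sub_distrib, ← hb.sum_comp (fun v : G.IntNbr u => F v.2.right), sub_eq_zero]
  simp only [right_nextNbr]

/-- In a connected mesh a function on the faces which is constant around every vertex is
constant. -/
theorem const_of_const_at_vertices (hG : G.graph.Connected) {X : Type*} (g : G.Face → X)
    (hg : ∀ u (f f' : G.Face), u ∈ f.1 → u ∈ f'.1 → g f = g f') (f f' : G.Face) : g f = g f' := by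
  obtain ⟨a, b, c, -, -, -, hf⟩ := G.eq_tri _ f.2
  obtain ⟨a', b', c', -, -, -, hf'⟩ := G.eq_tri _ f'.2
  have ha : a ∈ f.1 := by rw [hf]; exact mem_tri.2 (by simp)
  have ha' : a' ∈ f'.1 := by rw [hf']; exact mem_tri.2 (by simp)
  obtain ⟨p⟩ := hG.preconnected a a'
  clear hf hf'
  induction p generalizing f with
  | nil => exact hg _ _ _ ha ha'
  | @cons u v w h p ih =>
    -- A face containing the edge of the path is shared by both of its end points and passes the
    -- value from one to the other.
    obtain ⟨k, hk, hk'⟩ : ∃ k : G.Face, u ∈ k.1 ∧ v ∈ k.1 := by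
      rcases h.2 with ⟨x, hx⟩ | ⟨x, hx⟩ <;>
        exact ⟨⟨_, hx⟩, mem_tri.2 (by simp), mem_tri.2 (by simp)⟩
    exact (hg _ _ _ ha hk).trans (ih k hk' ha')

end TriMesh

/-! ### Consecutive pairs in lists. -/

section PairInfix

variable {α : Type*}

theorem List.pair_infix_iff {a b : α} {l : List α} :
    [a, b] <:+: l ↔ ∃ n, l[n]? = some a ∧ l[n + 1]? = some b := by
  induction l with
  | nil => simp
  | cons x l ih =>
    rw [List.infix_cons_iff, ih]
    constructor
    · rintro (h | ⟨n, h1, h2⟩)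
      · obtain ⟨t, ht⟩ := h
        simp at ht
        obtain ⟨rfl, rfl⟩ := ht
        exact ⟨0, by simp, by simp⟩
      · exact ⟨n + 1, by simpa using h1, by simpa using h2⟩
    · rintro ⟨n, h1, h2⟩
      cases n with
      | zero =>
        left
        cases l with
        | nil => simp at h2
        | cons y l =>
          simp at h1 h2
          subst h1 h2
          exact ⟨l, rfl⟩
      | succ n => exact Or.inr ⟨n, by simpa using h1, by simpa using h2⟩

/-- Cutting a list at an entry b and keeping b in both pieces loses no consecutive pair. This is how
the sides of a polygon are distributed over the two polygons that meet at the apex b. -/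
theorem List.pair_infix_append_cons {x y b : α} {l m : List α} :
    [x, y] <:+: l ++ b :: m ↔ [x, y] <:+: l ++ [b] ∨ [x, y] <:+: b :: m := by
  induction l with
  | nil => simp [List.infix_cons_iff]
  | cons a l ih =>
    simp only [List.cons_append, List.infix_cons_iff, ih]
    cases l <;> simp [List.infix_cons_iff]; tauto

end PairInfix

section PairInfix

variable {α : Type*}

theorem List.pair_infix_mem {a b : α} {l : List α} (h : [a, b] <:+: l) : a ∈ l ∧ b ∈ l :=
  ⟨h.subset (by simp), h.subset (by simp)⟩

theorem List.exists_pair_infix_left_iff {a : α} {l : List α} (hl : l.Nodup) :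
    (∃ b, [a, b] <:+: l) ↔ a ∈ l ∧ l.getLast? ≠ some a := by
  simp only [List.pair_infix_iff, List.getLast?_eq_getElem?]
  constructor
  · rintro ⟨b, n, h1, h2⟩
    refine ⟨List.mem_of_getElem? h1, fun h3 => ?_⟩
    have hn := (List.getElem?_eq_some_iff.1 h2).1
    have := (List.getElem?_inj (by omega) hl).1 (h1.trans h3.symm)
    omega
  · rintro ⟨h1, h2⟩
    obtain ⟨n, hn⟩ := List.mem_iff_getElem?.1 h1
    have hlt := (List.getElem?_eq_some_iff.1 hn).1
    have : n ≠ l.length - 1 := by rintro rfl; exact h2 hn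
    have h3 : n + 1 < l.length := by omega
    exact ⟨l[n + 1], n, hn, List.getElem?_eq_getElem h3⟩

theorem List.exists_pair_infix_right_iff {b : α} {l : List α} (hl : l.Nodup) :
    (∃ a, [a, b] <:+: l) ↔ b ∈ l ∧ l.head? ≠ some b := by
  simp only [List.pair_infix_iff, List.head?_eq_getElem?]
  constructor
  · rintro ⟨a, n, h1, h2⟩
    refine ⟨List.mem_of_getElem? h2, fun h3 => ?_⟩
    have hn := (List.getElem?_eq_some_iff.1 h2).1
    have := (List.getElem?_inj (by omega) hl).1 (h2.trans h3.symm)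
    omega
  · rintro ⟨h1, h2⟩
    obtain ⟨n, hn⟩ := List.mem_iff_getElem?.1 h1
    have hlt := (List.getElem?_eq_some_iff.1 hn).1
    obtain _ | n := n
    · exact absurd hn h2
    · have h3 : n < l.length := by omega
      exact ⟨l[n], n, List.getElem?_eq_getElem h3, hn⟩

end PairInfix

/-! ### Vertex links and the Euler count of interior cells. -/

namespace TriMesh

variable {V : Type*} {G : TriMesh V}

/-- Links of boundary vertices (`cyc` false) and of interior vertices (`cyc` true), treated
uniformly. -/
structure LinkData (G : TriMesh V) (u : V) (w : List V) (cyc : Prop) : Prop where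
  nodup : w.Nodup
  two_le : 2 ≤ w.length
  three_le : cyc → 3 ≤ w.length
  mem_faces : ∀ a b, tri u a b ∈ G.faces ↔
    [a, b] <:+: w ∨ (cyc ∧ w.getLast? = some a ∧ w.head? = some b)

theorem IsLink.linkData {u : V} {w : List V} (h : G.IsLink u w) : ∃ cyc, G.LinkData u w cyc := by
  obtain ⟨h1, ⟨h2, h3⟩ | ⟨h2, h3⟩⟩ := h
  · exact ⟨False, h1, h2, False.elim, fun a b => by simp [h3]⟩
  · exact ⟨True, h1, by omega, fun _ => h2, fun a b => by simp [h3]⟩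

namespace LinkData

variable {u : V} {w : List V} {cyc : Prop}

/-- Every entry of the link spans a triangle with its successor. Only the last entry has no
successor, and it gets one exactly when the link closes up to a cycle. -/
theorem dEdge_iff (L : G.LinkData u w cyc) {b : V} :
    G.DEdge u b ↔ b ∈ w ∧ (w.getLast? = some b → cyc) := by
  have h := List.exists_pair_infix_left_iff (a := b) L.nodup
  simp only [DEdge, L.mem_faces, exists_or, h]
  constructor
  · rintro (h | ⟨x, hc, h, -⟩)
    · exact ⟨h.1, fun h' => absurd h' h.2⟩
    · exact ⟨List.mem_of_getLast? h, fun _ => hc⟩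
  · rintro ⟨h, h'⟩
    by_cases hb : w.getLast? = some b
    · have h0 : 0 < w.length := by have := L.two_le; omega
      exact Or.inr ⟨w[0], h' hb, hb, by simp [List.head?_eq_getElem?]⟩
    · exact Or.inl ⟨h, hb⟩

theorem dEdge_iff' (L : G.LinkData u w cyc) {b : V} :
    G.DEdge b u ↔ b ∈ w ∧ (w.head? = some b → cyc) := by
  have h := List.exists_pair_infix_right_iff (b := b) L.nodup
  have h0 : G.DEdge b u ↔ ∃ a, tri u a b ∈ G.faces := by
    simp only [DEdge, tri_rotate b u]
  rw [h0]
  simp only [L.mem_faces, exists_or, h]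
  constructor
  · rintro (h | ⟨x, hc, -, h⟩)
    · exact ⟨h.1, fun h' => absurd h' h.2⟩
    · exact ⟨List.mem_of_head? h, fun _ => hc⟩
  · rintro ⟨h, h'⟩
    by_cases hb : w.head? = some b
    · have h0 : w.length - 1 < w.length := by have := L.two_le; omega
      exact Or.inr ⟨w[w.length - 1], h' hb, by simp [List.getLast?_eq_getElem?], hb⟩
    · exact Or.inl ⟨h, hb⟩

theorem exists_head_last (L : G.LinkData u w cyc) :
    ∃ a b, a ≠ b ∧ w.head? = some a ∧ w.getLast? = some b ∧ a ∈ w ∧ b ∈ w := by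
  have h2 := L.two_le
  have h0 : 0 < w.length := by omega
  have h1 : w.length - 1 < w.length := by omega
  refine ⟨w[0], w[w.length - 1], fun e => ?_, by simp [List.head?_eq_getElem?],
    by simp [List.getLast?_eq_getElem?], List.getElem_mem _, List.getElem_mem _⟩
  have := (L.nodup.getElem_inj_iff).1 e
  omega

theorem isIntVertex_iff (L : G.LinkData u w cyc) : G.IsIntVertex u ↔ cyc := by
  obtain ⟨a, b, hab, ha, hb, haw, hbw⟩ := L.exists_head_last
  constructor
  · rintro ⟨-, h⟩
    have := h a
    rw [L.dEdge_iff, L.dEdge_iff'] at this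
    refine (this.1 ⟨haw, fun h' => ?_⟩).2 ha
    rw [hb] at h'
    exact absurd (Option.some.inj h').symm hab
  · intro hc
    exact ⟨⟨a, L.dEdge_iff.2 ⟨haw, fun _ => hc⟩⟩, fun v => by
      rw [L.dEdge_iff, L.dEdge_iff']; simp [hc]⟩

/-- The unique such neighbour is the head of the path. It pairs each boundary vertex with the
boundary edge that leaves it. -/
theorem existsUnique_out (L : G.LinkData u w cyc) (hu : ¬ G.IsIntVertex u) :
    ∃! b, G.DEdge u b ∧ ¬ G.DEdge b u := by
  have hc : ¬ cyc := fun h => hu (L.isIntVertex_iff.2 h)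
  obtain ⟨a, b, hab, ha, hb, haw, hbw⟩ := L.exists_head_last
  simp only [L.dEdge_iff, L.dEdge_iff']
  refine ⟨a, ⟨⟨haw, fun h' => ?_⟩, fun h => hc (h.2 ha)⟩, ?_⟩
  · rw [hb] at h'
    exact absurd (Option.some.inj h').symm hab
  · rintro x ⟨⟨hx, -⟩, h2⟩
    by_contra hne
    refine h2 ⟨hx, fun h => absurd ?_ hne⟩
    rw [ha] at h
    exact (Option.some.inj h).symm

/-- A function on the faces which takes the same value on both sides of every interior edge is
constant around a vertex. -/
theorem const_at_vertex (L : G.LinkData u w cyc) {X : Type*} {g : G.Face → X}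
    (hg : ∀ a b (h : G.IsIntEdge a b), u = a → g h.left = g h.right) {f f' : G.Face} (hf : u ∈ f.1)
    (hf' : u ∈ f'.1) : g f = g f' := by
  have h2 := L.two_le
  obtain ⟨a₀, b₀, h₀a, h₀b⟩ : ∃ a b, w[0]? = some a ∧ w[1]? = some b :=
    ⟨w[0], w[1], by simp, by simp⟩
  have h₀ : tri u a₀ b₀ ∈ G.faces :=
    (L.mem_faces _ _).2 (Or.inl (List.pair_infix_iff.2 ⟨0, h₀a, h₀b⟩))
  have step : ∀ x a b (h : tri u x a ∈ G.faces) (h' : tri u a b ∈ G.faces),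
      g ⟨_, h'⟩ = g ⟨_, h⟩ := by
    intro x a b h h'
    have hx : tri a u x ∈ G.faces := tri_mem_rotate (tri_mem_rotate h)
    have e : G.IsIntEdge u a := ⟨⟨b, h'⟩, ⟨x, hx⟩⟩
    have := hg u a e rfl
    rw [e.left_eq h', e.right_eq hx] at this
    rw [this]
    exact congrArg g (Subtype.ext (tri_rotate _ _ _))
  have key : ∀ n a b, w[n]? = some a → w[n + 1]? = some b → ∀ h : tri u a b ∈ G.faces,
      g ⟨_, h⟩ = g ⟨_, h₀⟩ := by
    intro n
    induction n with
    | zero =>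
      intro a b ha hb h
      rw [h₀a] at ha
      rw [h₀b] at hb
      cases ha
      cases hb
      rfl
    | succ n ih =>
      intro a b ha hb h
      have hn := (List.getElem?_eq_some_iff.1 ha).1
      have hx : w[n]? = some w[n] := List.getElem?_eq_getElem (by omega)
      have h' : tri u w[n] a ∈ G.faces :=
        (L.mem_faces _ _).2 (Or.inl (List.pair_infix_iff.2 ⟨n, hx, ha⟩))
      exact (step _ _ _ h' h).trans (ih _ _ hx ha h')
  have all : ∀ f : G.Face, u ∈ f.1 → g f = g ⟨_, h₀⟩ := by
    intro f hf
    obtain ⟨a, b, h, rfl⟩ := f.exists_eq_of_mem hf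
    rcases (L.mem_faces _ _).1 h with h' | ⟨hc, ha, hb⟩
    · obtain ⟨n, ha, hb⟩ := List.pair_infix_iff.1 h'
      exact key n a b ha hb h
    -- The triangle that closes the cycle is not an infix pair. It is reached by one further step
    -- from the triangle of the last two entries, which sit at m and m + 1.
    · have h3 := L.three_le hc
      rw [List.getLast?_eq_getElem?] at ha
      obtain ⟨m, hm⟩ : ∃ m, w.length = m + 2 := ⟨w.length - 2, by omega⟩
      have hx : w[m]? = some w[m] := List.getElem?_eq_getElem (by omega)
      have ha' : w[m + 1]? = some a := by rw [← ha, hm]; rfl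
      have h' : tri u w[m] a ∈ G.faces :=
        (L.mem_faces _ _).2 (Or.inl (List.pair_infix_iff.2 ⟨m, hx, ha'⟩))
      exact (step _ _ _ h' h).trans (key m _ _ hx ha' h')
  rw [all f hf, all f' hf']

end LinkData

/-- In a triangulated disk a function on the faces which takes the same value on both sides of every
interior edge is constant. -/
theorem IsDisk.const_of_left_eq_right (hG : G.IsDisk) {X : Type*} (g : G.Face → X)
    (hg : ∀ a b (h : G.IsIntEdge a b), g h.left = g h.right) (f f' : G.Face) : g f = g f' := by
  refine const_of_const_at_vertices hG.connected g (fun u f f' hf hf' => ?_) f f'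
  obtain ⟨w, hw⟩ := hG.link u
  obtain ⟨_, L⟩ := hw.linkData
  exact L.const_at_vertex (fun a b h _ => hg a b h) hf hf'

noncomputable instance : Fintype G.Face := inferInstanceAs (Fintype {f // f ∈ G.faces})

theorem card_face : Fintype.card G.Face = G.faces.card := by
  rw [← Fintype.card_coe]
  exact Fintype.card_congr (Equiv.refl _)

namespace IntEdge

/-- The first end point of an interior edge, for an arbitrary choice of orientation. -/
noncomputable def src (e : G.IntEdge) : V := e.2.choose

/-- The second end point of an interior edge, for an arbitrary choice of orientation. -/
noncomputable def tgt (e : G.IntEdge) : V := e.2.choose_spec.choose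

theorem val_eq (e : G.IntEdge) : e.1 = s(e.src, e.tgt) := e.2.choose_spec.choose_spec.1

theorem isIntEdge (e : G.IntEdge) : G.IsIntEdge e.src e.tgt := e.2.choose_spec.choose_spec.2

theorem edge_isIntEdge (e : G.IntEdge) : e.isIntEdge.edge = e := Subtype.ext e.val_eq.symm

theorem src_tgt_edge {u v : V} (h : G.IsIntEdge u v) :
    (h.edge.src = u ∧ h.edge.tgt = v) ∨ (h.edge.src = v ∧ h.edge.tgt = u) := by
  have : s(u, v) = s(h.edge.src, h.edge.tgt) := h.edge.val_eq
  rcases Sym2.eq_iff.1 this with h | h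
  · exact Or.inl ⟨h.1.symm, h.2.symm⟩
  · exact Or.inr ⟨h.2.symm, h.1.symm⟩

end IntEdge

instance [Finite V] : Finite G.IntEdge :=
  inferInstanceAs (Finite {e : Sym2 V // ∃ u v, e = s(u, v) ∧ G.IsIntEdge u v})

noncomputable instance [Finite V] : Fintype G.IntEdge := Fintype.ofFinite _

/-- The interior vertices of a disk, its interior edges and its faces satisfy
`V_int - E_int + F = 1`. -/
theorem IsDisk.euler_int [Finite V] (hG : G.IsDisk) :
    Nat.card {u // G.IsIntVertex u} + Nat.card G.Face = Nat.card G.IntEdge + 1 := by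
  classical
  have hV : Nat.card V = Nat.card {u // G.IsIntVertex u} + Nat.card {u // ¬ G.IsIntVertex u} := by
    rw [← Nat.card_sum]
    exact Nat.card_congr (Equiv.sumCompl _).symm
  let p : G.graph.edgeSet → Prop := fun e => ∃ u v, e.1 = s(u, v) ∧ G.IsIntEdge u v
  have hE : Nat.card G.graph.edgeSet = Nat.card {e // p e} + Nat.card {e // ¬ p e} := by
    rw [← Nat.card_sum]
    exact Nat.card_congr (Equiv.sumCompl _).symm
  have hE' : Nat.card {e // p e} = Nat.card G.IntEdge := by
    refine Nat.card_congr ⟨fun e => ⟨e.1.1, e.2⟩, fun e => ⟨⟨e.1, ?_⟩, e.2⟩, fun _ => rfl,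
      fun _ => rfl⟩
    rw [e.val_eq]
    exact e.isIntEdge.1.adj
  -- Boundary vertices and boundary edges are equinumerous, so both drop out of V - E + F = 1.
  have hB : Nat.card {u // ¬ G.IsIntVertex u} = Nat.card {e // ¬ p e} := by
    have hout : ∀ u : {u // ¬ G.IsIntVertex u}, ∃! b, G.DEdge u.1 b ∧ ¬ G.DEdge b u.1 := by
      intro u
      obtain ⟨w, hw⟩ := hG.link u
      obtain ⟨_, L⟩ := hw.linkData
      exact L.existsUnique_out u.2
    choose b hb hbu using hout
    refine Nat.card_eq_of_bijective (fun u => ⟨⟨s(u.1, b u), (hb u).1.adj⟩, ?_⟩) ⟨?_, ?_⟩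
    · rintro ⟨x, y, e, h⟩
      rcases Sym2.eq_iff.1 e with ⟨h1, h2⟩ | ⟨h1, h2⟩
      · exact (hb u).2 (h1 ▸ h2 ▸ h.2)
      · exact (hb u).2 (h1 ▸ h2 ▸ h.1)
    · intro u u' e
      have e' : s(u.1, b u) = s(u'.1, b u') := congrArg (fun x => x.1.1) e
      rcases Sym2.eq_iff.1 e' with ⟨h1, -⟩ | ⟨h1, h2⟩
      · exact Subtype.ext h1
      · have h3 := (hb u).1
        rw [h1, h2] at h3
        exact absurd h3 (hb u').2
    · rintro ⟨⟨e, he⟩, hp⟩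
      have main : ∀ x y, e = s(x, y) → G.DEdge x y →
          ∃ u : {u // ¬ G.IsIntVertex u}, s(u.1, b u) = e := by
        rintro x y rfl hxy
        have hyx : ¬ G.DEdge y x := fun h => hp ⟨x, y, rfl, hxy, h⟩
        exact ⟨⟨x, fun h => hyx ((h.2 y).1 hxy)⟩, by rw [← hbu ⟨x, _⟩ y ⟨hxy, hyx⟩]⟩
      induction e using Sym2.ind with
      | _ x y =>
        obtain ⟨-, h | h⟩ := (he : G.graph.Adj x y)
        · obtain ⟨u, hu⟩ := main x y rfl h
          exact ⟨u, Subtype.ext (Subtype.ext hu)⟩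
        · obtain ⟨u, hu⟩ := main y x Sym2.eq_swap h
          exact ⟨u, Subtype.ext (Subtype.ext hu)⟩
  have := hG.euler
  have hF : Nat.card G.Face = G.faces.card := by rw [Nat.card_eq_fintype_card, card_face]
  rw [hF]
  omega

end TriMesh

/-! ### Closed forms on a disk have primitives on the faces. -/

namespace TriMesh

variable {V : Type*} {G : TriMesh V}

variable (G) in
/-- The differences of a function on the faces across the (oriented) interior edges. -/
noncomputable def faceDiff : (G.Face → ℂ) →ₗ[ℂ] (G.IntEdge → ℂ) where
  toFun F e := F e.isIntEdge.left - F e.isIntEdge.right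
  map_add' F F' := by ext e; simp only [Pi.add_apply]; ring
  map_smul' c F := by ext e; simp only [Pi.smul_apply, smul_eq_mul, RingHom.id_apply]; ring

/-- `faceDiff` uses an arbitrary orientation of each edge. When the chosen source is u, the chosen
faces are the faces of the given oriented edge. -/
theorem left_sub_right_eq_of_src {M : Type*} [AddCommGroup M] (F : G.Face → M) {u v : V}
    (h : G.IsIntEdge u v) (hs : h.edge.src = u) :
    F h.left - F h.right = F h.edge.isIntEdge.left - F h.edge.isIntEdge.right := by
  obtain ⟨-, ht⟩ | ⟨hs', -⟩ := IntEdge.src_tgt_edge h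
  · generalize h.edge = e at *
    subst hs ht
    rfl
  · exact absurd (hs.symm.trans hs') h.1.ne

variable [Finite V]

open Classical in
variable (G) in
/-- The sums of a function on the oriented interior edges around the interior vertices. -/
noncomputable def vertexSum : (G.IntEdge → ℂ) →ₗ[ℂ] ({u // G.IsIntVertex u} → ℂ) where
  toFun c u := ∑ e, ((if e.src = u.1 then c e else 0) - if e.tgt = u.1 then c e else 0)
  map_add' c c' := by
    ext u
    simp only [Pi.add_apply, ← Finset.sum_add_distrib]
    refine Finset.sum_congr rfl fun e _ => ?_
    split_ifs <;> ring
  map_smul' a c := by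
    ext u
    simp only [Pi.smul_apply, smul_eq_mul, RingHom.id_apply, Finset.mul_sum]
    refine Finset.sum_congr rfl fun e _ => ?_
    split_ifs <;> ring

/-- For an antisymmetric function the signs in `vertexSum` undo the arbitrary orientations, so the
sum runs over outgoing edges. -/
theorem vertexSum_apply (u : {u // G.IsIntVertex u}) (α : V → V → ℂ)
    (hα : ∀ u v, G.IsIntEdge u v → α v u = -α u v) :
    G.vertexSum (fun e => α e.src e.tgt) u = ∑ v : G.IntNbr u.1, α u.1 v.1 := by
  classical
  symm
  refine Fintype.sum_of_injective (fun v : G.IntNbr u.1 => v.2.edge) ?_ _ _ ?_ ?_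
  · intro v v' e
    have e' : s(u.1, v.1) = s(u.1, v'.1) := congrArg Subtype.val e
    exact Subtype.ext (Sym2.congr_right.1 e')
  · intro e he
    rw [if_neg, if_neg, sub_zero]
    · intro h
      have hi := e.isIntEdge.symm
      rw [h] at hi
      refine he ⟨⟨e.src, hi⟩, Subtype.ext ?_⟩
      rw [e.val_eq, h]
      exact Sym2.eq_swap
    · intro h
      have hi := e.isIntEdge
      rw [h] at hi
      refine he ⟨⟨e.tgt, hi⟩, Subtype.ext ?_⟩
      rw [e.val_eq, h]
      rfl
  · intro v
    have hne := v.2.1.ne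
    dsimp only
    obtain ⟨h1, h2⟩ | ⟨h1, h2⟩ := IntEdge.src_tgt_edge v.2
    · rw [h1, h2, if_pos rfl, if_neg hne.symm, sub_zero]
    · rw [h1, h2, if_neg hne.symm, if_pos rfl, zero_sub, hα _ _ v.2, neg_neg]

theorem range_faceDiff_le : LinearMap.range G.faceDiff ≤ LinearMap.ker G.vertexSum := by
  classical
  rintro _ ⟨F, rfl⟩
  rw [LinearMap.mem_ker]
  ext u
  let α : V → V → ℂ := fun u v => if h : G.IsIntEdge u v then F h.left - F h.right else 0
  have hα : ∀ u v (h : G.IsIntEdge u v), α u v = F h.left - F h.right := fun u v h => dif_pos h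
  have h1 : G.faceDiff F = fun e => α e.src e.tgt := by
    ext e
    rw [hα _ _ e.isIntEdge]
    rfl
  rw [h1, vertexSum_apply]
  · rw [Finset.sum_congr rfl fun v _ => hα _ _ v.2, sum_left_sub_right u.2]
    rfl
  · intro u v h
    rw [hα _ _ h, hα _ _ h.symm, h.symm_left, h.symm_right, neg_sub]

/-- By duality: a functional that kills the range is a function on the interior vertices. Extended
by zero to the boundary, it takes equal values at the end points of every edge. A connected graph
with non-empty boundary leaves only the zero function. -/
theorem IsDisk.vertexSum_surjective (hG : G.IsDisk) : Function.Surjective G.vertexSum := by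
  classical
  rw [← LinearMap.range_eq_top]
  by_contra hne
  obtain ⟨f, hf0, hf⟩ := Submodule.exists_le_ker_of_lt_top _ (lt_top_iff_ne_top.2 hne)
  let g : V → ℂ := fun u => if h : G.IsIntVertex u then f (Pi.single ⟨u, h⟩ 1) else 0
  have hedge : ∀ e : G.IntEdge, g e.src = g e.tgt := by
    intro e
    let ι : V → ({u // G.IsIntVertex u} → ℂ) := fun u =>
      if h : G.IsIntVertex u then Pi.single ⟨u, h⟩ 1 else 0
    have hι : ∀ u (x : {u // G.IsIntVertex u}), ι u x = if u = x.1 then 1 else 0 := by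
      intro u x
      by_cases h : G.IsIntVertex u
      · simp only [ι, dif_pos h, Pi.single_apply, Subtype.ext_iff, eq_comm]
      · have : u ≠ x.1 := fun e => h (e ▸ x.2)
        simp [ι, dif_neg h, this]
    have hg : ∀ u, g u = f (ι u) := by
      intro u
      by_cases h : G.IsIntVertex u <;> simp [g, ι, h]
    have hD : G.vertexSum (Pi.single e 1) = ι e.src - ι e.tgt := by
      ext x
      rw [Pi.sub_apply, hι, hι]
      change ∑ e', _ = _
      rw [Finset.sum_eq_single e]
      · simp
      · intro b _ hb
        simp [hb]
      · simp
    have := hf ⟨Pi.single e 1, hD⟩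
    rw [LinearMap.mem_ker, map_sub, sub_eq_zero] at this
    rw [hg, hg, this]
  have hint : ∀ u v, G.IsIntEdge u v → g u = g v := by
    intro u v h
    have := hedge h.edge
    obtain ⟨h1, h2⟩ | ⟨h1, h2⟩ := IntEdge.src_tgt_edge h
    · rwa [h1, h2] at this
    · rw [h1, h2] at this
      exact this.symm
  -- Both end points of a boundary edge are boundary vertices, where the extension by zero applies.
  have hbd : ∀ u v, G.DEdge u v → ¬ G.DEdge v u → g u = 0 ∧ g v = 0 := by
    intro u v h h'
    exact ⟨dif_neg fun hu => h' ((hu.2 v).1 h), dif_neg fun hv => h' ((hv.2 u).2 h)⟩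
  have hdir : ∀ u v, G.DEdge u v → g u = g v := by
    intro u v h
    by_cases h' : G.DEdge v u
    · exact hint u v ⟨h, h'⟩
    · rw [(hbd u v h h').1, (hbd u v h h').2]
  obtain ⟨a, b, hab, hba⟩ := hG.boundary
  have hzero : ∀ u, g u = 0 := by
    intro u
    obtain ⟨p⟩ := hG.connected.preconnected u a
    have ha := (hbd a b hab hba).1
    induction p with
    | nil => exact ha
    | cons h p ih =>
      rcases h.2 with h | h
      · rw [hdir _ _ h, ih hab hba ha]
      · rw [← hdir _ _ h, ih hab hba ha]
  refine hf0 (LinearMap.pi_ext' fun u => LinearMap.ext_ring ?_)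
  have := hzero u.1
  simp only [g, dif_pos u.2] at this
  simpa using this

/-- One inclusion is telescoping around a vertex, and the other a count. The kernel of `faceDiff`
has dimension at most 1, so its rank is at least F - 1 = E_int - V_int, which is the dimension of
the kernel of the surjective map `vertexSum`. -/
theorem IsDisk.range_faceDiff (hG : G.IsDisk) :
    LinearMap.range G.faceDiff = LinearMap.ker G.vertexSum := by
  classical
  have : Fintype {u // G.IsIntVertex u} := Fintype.ofFinite _
  refine Submodule.eq_of_le_of_finrank_le range_faceDiff_le ?_
  have h1 := G.faceDiff.finrank_range_add_finrank_ker
  have h2 := G.vertexSum.finrank_range_add_finrank_ker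
  rw [LinearMap.range_eq_top.2 hG.vertexSum_surjective, finrank_top] at h2
  rw [Module.finrank_fintype_fun_eq_card] at h1
  rw [Module.finrank_fintype_fun_eq_card, Module.finrank_fintype_fun_eq_card] at h2
  have h3 : Module.finrank ℂ (LinearMap.ker G.faceDiff) ≤ 1 := by
    refine finrank_le_one ⟨fun _ => 1, ?_⟩ fun F => ?_
    · rw [LinearMap.mem_ker]
      ext e
      simp [faceDiff]
    · have hF : ∀ f f', F.1 f = F.1 f' := by
        refine hG.const_of_left_eq_right F.1 fun a b h => ?_
        have hk : ∀ e : G.IntEdge, F.1 e.isIntEdge.left - F.1 e.isIntEdge.right = 0 :=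
          fun e => congrFun (LinearMap.mem_ker.1 F.2) e
        obtain ⟨h1, -⟩ | ⟨h1, -⟩ := IntEdge.src_tgt_edge h
        · have := left_sub_right_eq_of_src F.1 h h1
          rwa [hk, sub_eq_zero] at this
        · have := left_sub_right_eq_of_src F.1 h.symm (by rw [h.symm_edge, h1])
          rw [hk, sub_eq_zero] at this
          exact this.symm
      obtain ⟨a, b, ⟨c, hc⟩, -⟩ := hG.boundary
      refine ⟨F.1 ⟨_, hc⟩, Subtype.ext (funext fun f => ?_)⟩
      change F.1 ⟨_, hc⟩ * 1 = F.1 f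
      rw [mul_one]
      exact hF _ _
  have h4 := hG.euler_int
  rw [Nat.card_eq_fintype_card, Nat.card_eq_fintype_card, Nat.card_eq_fintype_card] at h4
  omega

/-- On a triangulated disk, an antisymmetric function on the oriented interior edges which adds up to
zero around the interior vertices is the difference of a function on the faces, which can be chosen
to depend linearly on it. -/
theorem IsDisk.exists_primitive (hG : G.IsDisk) : ∃ s : (V → V → ℂ) →ₗ[ℂ] (G.Face → ℂ),
    ∀ α : V → V → ℂ, (∀ u v, G.IsIntEdge u v → α v u = -α u v) →
      (∀ u, G.IsIntVertex u → ∑ v : G.IntNbr u, α u v.1 = 0) →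
      ∀ u v (h : G.IsIntEdge u v), s α h.left - s α h.right = α u v := by
  -- A linear section over the range, extended linearly to all edge functions, makes the primitive
  -- depend linearly on the form. The correspondence of differentials inherits its linearity from
  -- this.
  obtain ⟨r, hr⟩ := LinearMap.exists_rightInverse_of_surjective G.faceDiff.rangeRestrict
    (LinearMap.range_eq_top.2 G.faceDiff.surjective_rangeRestrict)
  obtain ⟨s, hs⟩ := LinearMap.exists_extend r
  let restr : (V → V → ℂ) →ₗ[ℂ] (G.IntEdge → ℂ) :=
    { toFun := fun α e => α e.src e.tgt
      map_add' := fun _ _ => rfl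
      map_smul' := fun _ _ => rfl }
  refine ⟨s ∘ₗ restr, fun α hα hsum u v h => ?_⟩
  have hmem : restr α ∈ LinearMap.range G.faceDiff := by
    rw [hG.range_faceDiff, LinearMap.mem_ker]
    ext u
    exact (vertexSum_apply u α hα).trans (hsum u.1 u.2)
  have h1 : s (restr α) = r ⟨_, hmem⟩ := congrArg (fun f => f ⟨_, hmem⟩) hs
  have h2 : G.faceDiff (r ⟨_, hmem⟩) = restr α :=
    congrArg Subtype.val (congrArg (fun f => f ⟨_, hmem⟩) hr)
  have h3 : ∀ e : G.IntEdge, s (restr α) e.isIntEdge.left - s (restr α) e.isIntEdge.right =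
      α e.src e.tgt := by
    intro e
    rw [h1]
    exact congrFun h2 e
  change s (restr α) h.left - s (restr α) h.right = α u v
  obtain ⟨hs, ht⟩ | ⟨hs, ht⟩ := IntEdge.src_tgt_edge h
  · rw [left_sub_right_eq_of_src _ h hs, h3, hs, ht]
  · have h4 := left_sub_right_eq_of_src (s (restr α)) h.symm (by rw [h.symm_edge, hs])
    rw [h3, h.symm_edge, hs, ht, h.symm_left, h.symm_right, hα _ _ h] at h4
    rw [← neg_sub, h4, neg_neg]

end TriMesh

/-! ### Triangulated polygons. -/

theorem List.map_pair_infix_iff {α β : Type*} {f : α → β} (hf : Function.Injective f) {x y : α}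
    {l : List α} : [f x, f y] <:+: l.map f ↔ [x, y] <:+: l := by
  simp only [List.pair_infix_iff, List.getElem?_map, Option.map_eq_some_iff]
  constructor
  · rintro ⟨n, ⟨a, h1, h2⟩, ⟨b, h3, h4⟩⟩
    exact ⟨n, hf h2 ▸ h1, hf h4 ▸ h3⟩
  · rintro ⟨n, h1, h2⟩
    exact ⟨n, ⟨x, h1, rfl⟩, ⟨y, h2, rfl⟩⟩

theorem List.getLast?_cons_concat {α : Type*} (a b : α) (l : List α) :
    (a :: (l ++ [b])).getLast? = some b := by
  rw [← List.cons_append, List.getLast?_append]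
  rfl

theorem List.getLast?_cons_append_cons_concat {α : Type*} (a b c : α) (l r : List α) :
    (a :: (l ++ b :: (r ++ [c]))).getLast? = some c := by
  rw [← List.cons_append, ← List.cons_append, ← List.append_assoc, List.getLast?_append]
  rfl

theorem List.pair_infix_pair {α : Type*} {x y a b : α} :
    [x, y] <:+: [a, b] ↔ x = a ∧ y = b := by
  rw [List.pair_infix_iff]
  constructor
  · rintro ⟨_ | n, h1, h2⟩
    · simp at h1 h2
      exact ⟨h1.symm, h2.symm⟩
    · simp at h2
  · rintro ⟨rfl, rfl⟩
    exact ⟨0, rfl, rfl⟩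

namespace PolygonTriangulation

variable {W : Type*} {p : List W} {S : Set (Cycle W)}

theorem mem_of_mem (h : PolygonTriangulation p S) {t : Cycle W} (ht : t ∈ S) {x : W}
    (hx : x ∈ t) : x ∈ p := by
  induction h with
  | segment => exact absurd ht (Set.notMem_empty _)
  | glue a b c l r S S' _ _ ih ih' =>
    rcases ht with rfl | ht | ht
    · rcases mem_tri.1 hx with rfl | rfl | rfl <;> simp
    · have := ih ht
      simp only [List.mem_cons, List.mem_append] at this ⊢
      tauto
    · have := ih' ht
      simp only [List.mem_cons, List.mem_append] at this ⊢
      tauto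

/-- The closing edge of a polygon with at least three vertices belongs to a triangle. -/
theorem closing (h : PolygonTriangulation p S) {x y : W} (hx : p.getLast? = some x)
    (hy : p.head? = some y) : p = [y, x] ∨ ∃ z, tri x y z ∈ S := by
  induction h with
  | segment a b =>
    simp at hx hy
    simp [hx, hy]
  | glue a b c l r S S' _ _ ih ih' =>
    simp [
      List.getLast?_cons_append_cons_concat] at hx hy
    subst hx hy
    exact Or.inr ⟨b, Or.inl ((tri_rotate _ _ _))⟩

/-- A side of a polygon with at least three vertices belongs to a triangle. -/
theorem side (h : PolygonTriangulation p S) {x y : W} (hxy : [x, y] <:+: p) :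
    p = [x, y] ∨ ∃ z, tri x y z ∈ S := by
  induction h with
  | segment a b =>
    left
    obtain ⟨rfl, rfl⟩ := List.pair_infix_pair.1 hxy
    rfl
  | glue a b c l r S S' _ _ ih ih' =>
    right
    rw [← List.cons_append, List.pair_infix_append_cons] at hxy
    rcases hxy with hxy | hxy
    · rcases ih hxy with e | ⟨z, hz⟩
      · cases l with
        | nil =>
          simp at e
          obtain ⟨rfl, rfl⟩ := e
          exact ⟨c, Or.inl rfl⟩
        | cons => simp at e
      · exact ⟨z, Or.inr (Or.inl hz)⟩
    · rcases ih' hxy with e | ⟨z, hz⟩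
      · cases r with
        | nil =>
          simp at e
          obtain ⟨rfl, rfl⟩ := e
          exact ⟨a, Or.inl (tri_rotate _ _ _).symm⟩
        | cons => simp at e
      · exact ⟨z, Or.inr (Or.inr hz)⟩

/-- An oriented edge of a triangle is a side of the polygon, or its closing edge, or a diagonal, which
has a triangle on its other side. -/
theorem edge_cases (h : PolygonTriangulation p S) {x y z : W} (ht : tri x y z ∈ S) :
    [x, y] <:+: p ∨ (p.getLast? = some x ∧ p.head? = some y) ∨ ∃ z', tri y x z' ∈ S := by
  induction h generalizing x y z with
  | segment => exact absurd ht (Set.notMem_empty _)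
  | glue a b c l r S S' h h' ih ih' =>
    rw [← List.cons_append, List.pair_infix_append_cons]
    -- The side ab of the middle triangle is the closing edge of the left polygon. Its reverse lies
    -- on a triangle of that polygon, unless the polygon is a segment and ab is a side of the whole
    -- polygon.
    have hab : [a, b] <:+: a :: (l ++ [b]) ∨ ∃ z', tri b a z' ∈ insert (tri a b c) (S ∪ S') := by
      rcases h.closing (x := b) (y := a) (by simp [List.getLast?_cons_concat]) (by simp) with e | ⟨z, hz⟩
      · exact Or.inl (by rw [e])
      · exact Or.inr ⟨z, Or.inr (Or.inl hz)⟩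
    have hbc : [b, c] <:+: b :: (r ++ [c]) ∨ ∃ z', tri c b z' ∈ insert (tri a b c) (S ∪ S') := by
      rcases h'.closing (x := c) (y := b) (by simp [List.getLast?_cons_concat]) (by simp) with e | ⟨z, hz⟩
      · exact Or.inl (by rw [e])
      · exact Or.inr ⟨z, Or.inr (Or.inr hz)⟩
    have hm : ∀ t, t ∈ S → t ∈ insert (tri a b c) (S ∪ S') := fun t ht => Or.inr (Or.inl ht)
    have hm' : ∀ t, t ∈ S' → t ∈ insert (tri a b c) (S ∪ S') := fun t ht => Or.inr (Or.inr ht)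
    rcases ht with e | ht | ht
    · rcases tri_eq_iff.1 e with ⟨rfl, rfl, rfl⟩ | ⟨rfl, rfl, rfl⟩ | ⟨rfl, rfl, rfl⟩
      · exact hab.imp Or.inl Or.inr
      · exact hbc.imp Or.inr Or.inr
      · exact Or.inr (Or.inl (by simp [
      List.getLast?_cons_append_cons_concat]))
    · rcases ih ht with h | ⟨h1, h2⟩ | ⟨z', h⟩
      · exact Or.inl (Or.inl h)
      · simp [List.getLast?_cons_concat] at h1 h2
        subst h1 h2
        exact Or.inr (Or.inr ⟨c, Or.inl rfl⟩)
      · exact Or.inr (Or.inr ⟨z', hm _ h⟩)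
    · rcases ih' ht with h | ⟨h1, h2⟩ | ⟨z', h⟩
      · exact Or.inl (Or.inr h)
      · simp [List.getLast?_cons_concat] at h1 h2
        subst h1 h2
        exact Or.inr (Or.inr ⟨a, Or.inl (tri_rotate _ _ _).symm⟩)
      · exact Or.inr (Or.inr ⟨z', hm' _ h⟩)

/-- The reverse of the closing edge does not belong to a triangle of the polygon. -/
theorem reverse_closing_notMem (h : PolygonTriangulation p S) (hp : p.Nodup) {x y z : W}
    (hx : p.head? = some x) (hy : p.getLast? = some y) : tri x y z ∉ S := by
  intro ht
  cases h with
  | segment => exact ht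
  | glue a b c l r S S' h h' =>
    simp [
      List.getLast?_cons_append_cons_concat] at hx hy
    subst hx hy
    simp only [List.nodup_cons, List.nodup_append, List.mem_append, List.mem_cons] at hp
    have hab : a ≠ b := by rintro rfl; simp at hp
    have hac : a ≠ c := by rintro rfl; simp at hp
    have hbc : b ≠ c := by rintro rfl; simp at hp
    rcases ht with e | ht | ht
    · rcases tri_eq_iff.1 e with ⟨-, h, -⟩ | ⟨h, -, -⟩ | ⟨h, -, -⟩
      · exact hbc h.symm
      · exact hab h
      · exact hac h
    -- Triangles of the left polygon cannot contain c, and those of the right polygon cannot contain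
    -- a.
    · have := h.mem_of_mem ht (x := c) (mem_tri.2 (by simp))
      simp only [List.mem_cons, List.mem_append] at this
      have h2 := hp.2.2.2
      rcases this with h | h | h | h
      · exact hac h.symm
      · exact h2 c h c (by simp) rfl
      · exact hbc h.symm
      · simp at h
    · have := h'.mem_of_mem ht (x := a) (mem_tri.2 (by simp))
      simp only [List.mem_cons, List.mem_append] at this
      tauto

/-- A function on the faces of a mesh which takes the same values on both sides of the interior edges
takes the same value on all faces which are adjacent to a triangulated polygon along a side. -/
theorem exists_eq_closing (h : PolygonTriangulation p S) {T : TriMesh W}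
    (hST : ∀ t ∈ S, t ∈ T.faces) {X : Type*} {g : T.Face → X}
    (hg : ∀ x y z z' (h : tri x y z ∈ T.faces) (h' : tri y x z' ∈ T.faces), g ⟨_, h⟩ = g ⟨_, h'⟩)
    {a c : W} (ha : p.head? = some a) (hc : p.getLast? = some c)
    {x y z : W} (ht : tri y x z ∈ T.faces) (hxy : [x, y] <:+: p) :
    ∃ z', ∃ h' : tri c a z' ∈ T.faces, g ⟨_, ht⟩ = g ⟨_, h'⟩ := by
  induction h generalizing a c x y z with
  | segment a' b' =>
    simp at ha hc
    subst ha hc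
    obtain ⟨rfl, rfl⟩ := List.pair_infix_pair.1 hxy
    exact ⟨z, ht, rfl⟩
  | glue a' b c' l r S S' _ _ ih ih' =>
    simp [
      List.getLast?_cons_append_cons_concat] at ha hc
    subst ha hc
    have habc : tri a' b c' ∈ T.faces := hST _ (Or.inl rfl)
    have hbca : tri b c' a' ∈ T.faces := TriMesh.tri_mem_rotate habc
    have hcab : tri c' a' b ∈ T.faces := TriMesh.tri_mem_rotate hbca
    have e1 : g ⟨_, hcab⟩ = g ⟨_, habc⟩ :=
      congrArg g (Subtype.ext (tri_rotate _ _ _))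
    have e2 : g ⟨_, hcab⟩ = g ⟨_, hbca⟩ :=
      congrArg g (Subtype.ext ((tri_rotate _ _ _).trans (tri_rotate _ _ _)))
    rw [← List.cons_append, List.pair_infix_append_cons] at hxy
    refine ⟨b, hcab, ?_⟩
    rcases hxy with hxy | hxy
    -- Induction carries the value to the inner side of the edge between a' and b. One more crossing
    -- reaches the middle triangle, which also lies at the closing edge of the whole polygon.
    · obtain ⟨z', h', e⟩ := ih (fun t ht => hST t (Or.inr (Or.inl ht))) (a := a') (c := b) (by simp)
        (by simp [List.getLast?_cons_concat]) ht hxy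
      rw [e, e1]
      exact hg _ _ _ _ _ _
    · obtain ⟨z', h', e⟩ := ih' (fun t ht => hST t (Or.inr (Or.inr ht))) (a := b) (c := c') (by simp)
        (by simp [List.getLast?_cons_concat]) ht hxy
      rw [e, e2]
      exact hg _ _ _ _ _ _

end PolygonTriangulation

/-- A real weighting of two vectors from `z₀` to distinct points which is in equilibrium is zero. -/
theorem weights_eq_zero {z₀ z₁ z₂ : ℂ} (h1 : z₁ ≠ z₀) (h2 : z₂ ≠ z₀) (h12 : z₁ ≠ z₂) {q₁ q₂ : ℝ}
    (h : q₁ + q₂ = 0) (h' : (q₁ : ℂ) / (z₁ - z₀) + q₂ / (z₂ - z₀) = 0) : q₁ = 0 ∧ q₂ = 0 := by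
  have e : q₂ = -q₁ := by linarith
  subst e
  have h1' := sub_ne_zero.2 h1
  have h2' := sub_ne_zero.2 h2
  rw [div_add_div _ _ h1' h2', div_eq_zero_iff, or_iff_left (mul_ne_zero h1' h2')] at h'
  push_cast at h'
  -- With q₂ = -q₁, the numerator of the sum of fractions is q₁ (z₂ - z₁).
  have : (q₁ : ℂ) * (z₂ - z₁) = 0 := by linear_combination h'
  rcases mul_eq_zero.1 this with h | h
  · have : q₁ = 0 := by exact_mod_cast h
    simp [this]
  · exact absurd (sub_eq_zero.1 h).symm h12

/-- A weighting of the edges of a triangulated polygon without additional vertices which is in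
equilibrium at all vertices except the end points of the closing edge vanishes on all other edges. -/
theorem PolygonTriangulation.eq_zero_of_equilibrium {W : Type*} [Fintype W] {p : List W}
    {S : Set (Cycle W)} (h : PolygonTriangulation p S) (hp : p.Nodup) {Q : W → W → ℝ}
    (hQ : ∀ x y, Q x y = Q y x) (hQ0 : ∀ x, Q x x = 0) {z : W → ℂ}
    (hz : ∀ t ∈ S, ∀ x ∈ t, ∀ y ∈ t, x ≠ y → z x ≠ z y)
    (hsum : ∀ x ∈ p, p.head? ≠ some x → p.getLast? ≠ some x →
      ∑ y, Q x y = 0 ∧ ∑ y, (Q x y : ℂ) / (z y - z x) = 0)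
    (hsupp : ∀ x ∈ p, p.head? ≠ some x → p.getLast? ≠ some x → ∀ y, Q x y ≠ 0 →
      [x, y] <:+: p ∨ [y, x] <:+: p ∨ ∃ t ∈ S, x ∈ t ∧ y ∈ t) :
    ∀ x ∈ p, p.head? ≠ some x → p.getLast? ≠ some x → ∀ y, Q x y = 0 := by
  classical
  induction h with
  | segment a b =>
    intro x hx h1 h2
    simp at hx h1 h2
    rcases hx with rfl | rfl
    · exact absurd rfl h1
    · exact absurd rfl h2
  | glue a b c l r S S' h h' ih ih' =>
    have hp0 := hp
    rw [← List.cons_append, List.Nodup, List.pairwise_append] at hp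
    obtain ⟨hp1, hp2, hp3⟩ := hp
    have hd : ∀ x ∈ a :: l, ∀ y ∈ b :: (r ++ [c]), x ≠ y := hp3
    have hab : a ≠ b := hd a (by simp) b (by simp)
    have hac : a ≠ c := hd a (by simp) c (by simp)
    have hbr : b ∉ r ++ [c] := (List.nodup_cons.1 hp2).1
    have hbc : b ≠ c := fun e => hbr (by simp [e])
    have hrc : c ∉ r := by
      have := (List.nodup_append.1 (List.nodup_cons.1 hp2).2).2.2
      exact fun hc => this c hc c (by simp) rfl
    have hal : a ∉ l := (List.nodup_cons.1 hp1).1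
    have hn1 : (a :: (l ++ [b])).Nodup := by
      rw [← List.cons_append, List.nodup_append]
      exact ⟨hp1, by simp, fun x hx y hy => hd x hx y (by simp at hy; simp [hy])⟩
    have inner1 : ∀ x ∈ a :: (l ++ [b]), (a :: (l ++ [b])).head? ≠ some x →
        (a :: (l ++ [b])).getLast? ≠ some x → x ∈ l := by
      intro x hx h1 h2
      simp [List.getLast?_cons_concat] at hx h1 h2
      rcases hx with rfl | hx | rfl
      · exact absurd rfl h1
      · exact hx
      · exact absurd rfl h2
    have inner2 : ∀ x ∈ b :: (r ++ [c]), (b :: (r ++ [c])).head? ≠ some x →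
        (b :: (r ++ [c])).getLast? ≠ some x → x ∈ r := by
      intro x hx h1 h2
      simp [List.getLast?_cons_concat] at hx h1 h2
      rcases hx with rfl | hx | rfl
      · exact absurd rfl h1
      · exact hx
      · exact absurd rfl h2
    have outer : ∀ x, x ∈ l ∨ x = b ∨ x ∈ r → x ∈ a :: (l ++ b :: (r ++ [c])) ∧
        (a :: (l ++ b :: (r ++ [c]))).head? ≠ some x ∧
        (a :: (l ++ b :: (r ++ [c]))).getLast? ≠ some x := by
      intro x hx
      refine ⟨by simp only [List.mem_cons, List.mem_append]; tauto, ?_, ?_⟩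
      · simp only [List.head?_cons, ne_eq, Option.some.injEq]
        rintro rfl
        rcases hx with hx | hx | hx
        · exact hal hx
        · exact hab hx
        · exact hd a (by simp) a (by simp [hx]) rfl
      · have : (a :: (l ++ b :: (r ++ [c]))).getLast? = some c := by simp [
      List.getLast?_cons_append_cons_concat]
        rw [this, ne_eq, Option.some.injEq]
        rintro rfl
        rcases hx with hx | hx | hx
        · exact hd c (by simp [hx]) c (by simp) rfl
        · exact hbc hx.symm
        · exact hrc hx
    have hinf : ∀ x y, [x, y] <:+: a :: (l ++ b :: (r ++ [c])) ↔
        [x, y] <:+: a :: (l ++ [b]) ∨ [x, y] <:+: b :: (r ++ [c]) := by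
      intro x y
      rw [← List.cons_append, List.pair_infix_append_cons, List.cons_append]
    -- An inner vertex of the left polygon lies in no other piece, so its equilibrium condition
    -- involves edges of that polygon only.
    have z1 : ∀ x ∈ l, ∀ y, Q x y = 0 := by
      have := ih hn1 (fun t ht => hz t (Or.inr (Or.inl ht)))
        (fun x hx h1 h2 => by
          obtain ⟨o1, o2, o3⟩ := outer x (Or.inl (inner1 x hx h1 h2))
          exact hsum x o1 o2 o3)
        (fun x hx h1 h2 y hy => by
          have hxl := inner1 x hx h1 h2
          have hx2 : x ∉ b :: (r ++ [c]) := fun h => hd x (by simp [hxl]) x h rfl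
          obtain ⟨o1, o2, o3⟩ := outer x (Or.inl hxl)
          simp only [hinf] at hsupp
          rcases hsupp x o1 o2 o3 y hy with (h | h) | (h | h) | ⟨t, ht, hxt, hyt⟩
          · exact Or.inl h
          · exact absurd (List.pair_infix_mem h).1 hx2
          · exact Or.inr (Or.inl h)
          · exact absurd (List.pair_infix_mem h).2 hx2
          · rcases ht with rfl | ht | ht
            · rcases mem_tri.1 hxt with rfl | rfl | rfl
              · exact absurd hxl hal
              · exact absurd (by simp) hx2
              · exact absurd (by simp) hx2
            · exact Or.inr (Or.inr ⟨t, ht, hxt, hyt⟩)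
            · exact absurd (h'.mem_of_mem ht hxt) hx2)
      intro x hx
      refine this x (by simp [hx]) ?_ ?_
      · simp only [List.head?_cons, ne_eq, Option.some.injEq]
        rintro rfl
        exact hal hx
      · have e : (a :: (l ++ [b])).getLast? = some b := by simp [List.getLast?_cons_concat]
        rw [e, ne_eq, Option.some.injEq]
        rintro rfl
        exact hd b (by simp [hx]) b (by simp) rfl
    have z2 : ∀ x ∈ r, ∀ y, Q x y = 0 := by
      have := ih' hp2 (fun t ht => hz t (Or.inr (Or.inr ht)))
        (fun x hx h1 h2 => by
          obtain ⟨o1, o2, o3⟩ := outer x (Or.inr (Or.inr (inner2 x hx h1 h2)))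
          exact hsum x o1 o2 o3)
        (fun x hx h1 h2 y hy => by
          have hxr := inner2 x hx h1 h2
          have hxb : x ≠ b := by rintro rfl; exact hbr (by simp [hxr])
          have hx2 : x ∉ a :: (l ++ [b]) := fun h => by
            simp only [List.mem_cons, List.mem_append, List.not_mem_nil, or_false] at h
            rcases h with rfl | h | h
            · exact hd x (by simp) x (by simp [hxr]) rfl
            · exact hd x (by simp [h]) x (by simp [hxr]) rfl
            · exact hxb h
          obtain ⟨o1, o2, o3⟩ := outer x (Or.inr (Or.inr hxr))
          simp only [hinf] at hsupp
          rcases hsupp x o1 o2 o3 y hy with (h | h) | (h | h) | ⟨t, ht, hxt, hyt⟩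
          · exact absurd (List.pair_infix_mem h).1 hx2
          · exact Or.inl h
          · exact absurd (List.pair_infix_mem h).2 hx2
          · exact Or.inr (Or.inl h)
          · rcases ht with rfl | ht | ht
            · rcases mem_tri.1 hxt with rfl | rfl | rfl
              · exact absurd (by simp) hx2
              · exact absurd rfl hxb
              · exact absurd hxr hrc
            · exact absurd (h.mem_of_mem ht hxt) hx2
            · exact Or.inr (Or.inr ⟨t, ht, hxt, hyt⟩))
      intro x hx
      refine this x (by simp [hx]) ?_ ?_
      · simp only [List.head?_cons, ne_eq, Option.some.injEq]
        rintro rfl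
        exact hbr (by simp [hx])
      · have e : (b :: (r ++ [c])).getLast? = some c := by simp [List.getLast?_cons_concat]
        rw [e, ne_eq, Option.some.injEq]
        rintro rfl
        exact hrc hx
    -- All weights between b and the inner vertices of the two pieces are zero by now, so only the
    -- edges to a and c remain at b, and two weights toward distinct points cannot balance.
    have z3 : ∀ y, Q b y = 0 := by
      obtain ⟨o1, o2, o3⟩ := outer b (Or.inr (Or.inl rfl))
      have hsub : ∀ y, y ≠ a ∧ y ≠ c → Q b y = 0 := by
        rintro y ⟨hya, hyc⟩
        by_contra hy
        have hyp : y ∈ a :: (l ++ b :: (r ++ [c])) := by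
          rcases hsupp b o1 o2 o3 y hy with h | h | ⟨t, ht, -, hyt⟩
          · exact (List.pair_infix_mem h).2
          · exact (List.pair_infix_mem h).1
          · exact (PolygonTriangulation.glue a b c l r S S' h h').mem_of_mem ht hyt
        simp only [List.mem_cons, List.mem_append, List.not_mem_nil, or_false] at hyp
        rcases hyp with h | h | h | h | h
        · exact hya h
        · exact hy ((hQ _ _).trans (z1 y h b))
        · exact hy (h ▸ hQ0 b)
        · exact hy ((hQ _ _).trans (z2 y h b))
        · exact hyc h
      obtain ⟨s1, s2⟩ := hsum b o1 o2 o3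
      rw [Fintype.sum_eq_add a c hac hsub] at s1
      rw [Fintype.sum_eq_add a c hac (fun y hy => by rw [hsub y hy]; simp)] at s2
      have hz' := hz (tri a b c) (Or.inl rfl)
      have ma : a ∈ tri a b c := mem_tri.2 (by simp)
      have mb : b ∈ tri a b c := mem_tri.2 (by simp)
      have mc : c ∈ tri a b c := mem_tri.2 (by simp)
      obtain ⟨h1, h2⟩ := weights_eq_zero (hz' a ma b mb hab) (hz' c mc b mb hbc.symm)
        (hz' a ma c mc hac) s1 s2
      intro y
      by_cases hya : y = a
      · rw [hya, h1]
      · by_cases hyc : y = c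
        · rw [hyc, h2]
        · exact hsub y ⟨hya, hyc⟩
    intro x hx h1 h2
    have e : (a :: (l ++ b :: (r ++ [c]))).getLast? = some c := by simp [
      List.getLast?_cons_append_cons_concat]
    rw [e] at h2
    simp only [List.mem_cons, List.mem_append, List.not_mem_nil, or_false, List.head?_cons, ne_eq,
      Option.some.injEq] at hx h1 h2
    rcases hx with rfl | hx | rfl | hx | rfl
    · exact absurd rfl h1
    · exact z1 x hx
    · exact z3
    · exact z2 x hx
    · exact absurd rfl h2

/-! ### Combinatorics of the triangulated medial graph. -/

/-- Two different edges of G share at most one vertex. Hence an edge of T determines the vertex u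
whose polygon it belongs to. -/
theorem Sym2.eq_of_common {V : Type*} {u u' a b a' b' : V} (hab : a ≠ b)
    (ha : s(u, a) = s(u', a')) (hb : s(u, b) = s(u', b')) : u = u' ∧ a = a' ∧ b = b' := by
  rcases Sym2.eq_iff.1 ha with ⟨rfl, rfl⟩ | ⟨rfl, rfl⟩
  · exact ⟨rfl, rfl, Sym2.congr_right.1 hb⟩
  · rcases Sym2.eq_iff.1 hb with ⟨rfl, rfl⟩ | ⟨-, rfl⟩
    · exact ⟨rfl, rfl, rfl⟩
    · exact absurd rfl hab

theorem Sym2.mk_injective {V : Type*} (u : V) : Function.Injective fun v => s(u, v) :=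
  fun _ _ h => Sym2.congr_right.1 h

namespace TriMesh

variable {V : Type*} {G : TriMesh V} {T : TriMesh (Sym2 V)}

theorem LinkData.mem_iff_adj {u a : V} {w : List V} {cyc : Prop} (L : G.LinkData u w cyc) :
    a ∈ w ↔ G.graph.Adj u a := by
  constructor
  · intro h
    obtain ⟨x, y, hxy, hx, hy, -, -⟩ := L.exists_head_last
    have : G.DEdge u a ∨ G.DEdge a u := by
      rw [L.dEdge_iff, L.dEdge_iff']
      -- The last entry may have no outgoing face, but it differs from the head and so has an
      -- incoming one.
      by_cases hl : w.getLast? = some a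
      · right
        refine ⟨h, fun h' => absurd ?_ hxy⟩
        rw [h'] at hx
        rw [hl] at hy
        exact (Option.some.inj hx).symm.trans (Option.some.inj hy)
      · exact Or.inl ⟨h, fun h' => absurd h' hl⟩
    rcases this with h | h
    · exact h.adj
    · exact h.adj.symm
  · rintro ⟨-, h | h⟩
    · exact (L.dEdge_iff.1 h).1
    · exact (L.dEdge_iff'.1 h).1

/-- The data of a triangulation of the medial graph: for every vertex `u` the list `w u` of its
neighbours and the triangles `S u` of the polygon at `u`. -/
structure MedialData (G : TriMesh V) (T : TriMesh (Sym2 V)) (w : V → List V) (cyc : V → Prop)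
    (S : V → Set (Cycle (Sym2 V))) : Prop where
  link : ∀ u, G.LinkData u (w u) (cyc u)
  poly : ∀ u, PolygonTriangulation ((w u).map fun v => s(u, v)) (S u)
  mem_faces : ∀ f, f ∈ T.faces ↔
    (∃ u v w, tri u v w ∈ G.faces ∧ f = tri s(u, v) s(v, w) s(w, u)) ∨ ∃ u, f ∈ S u

theorem IsMedialTriangulation.exists_data (hT : G.IsMedialTriangulation T) :
    ∃ w cyc S, MedialData G T w cyc S := by
  obtain ⟨S, hS, hf⟩ := hT
  choose w hw hp using hS
  choose cyc hc using fun u => (hw u).linkData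
  exact ⟨w, cyc, S, hc, hp, hf⟩

namespace MedialData

variable {w : V → List V} {cyc : V → Prop} {S : V → Set (Cycle (Sym2 V))}

theorem exists_of_mem (M : MedialData G T w cyc S) {u : V} {t : Cycle (Sym2 V)} (ht : t ∈ S u)
    {i : Sym2 V} (hi : i ∈ t) : ∃ a ∈ w u, i = s(u, a) := by
  obtain ⟨a, ha, rfl⟩ := List.mem_map.1 ((M.poly u).mem_of_mem ht hi)
  exact ⟨a, ha, rfl⟩

/-- A side of a medial triangle cuts off the corner u of a face `tri u b a`. It runs from {ua} to
{ub}, opposite to the order of the link, whereas polygon triangles follow the order of the link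
along its sides. -/
theorem dEdge_iff (M : MedialData G T w cyc S) {i j : Sym2 V} : T.DEdge i j ↔
    (∃ u a b, i = s(u, a) ∧ j = s(u, b) ∧ tri u b a ∈ G.faces) ∨ ∃ u z, tri i j z ∈ S u := by
  constructor
  · rintro ⟨k, hk⟩
    rcases (M.mem_faces _).1 hk with ⟨x, y, z, h, e⟩ | ⟨u, hu⟩
    · left
      rcases tri_eq_iff.1 e with ⟨rfl, rfl, rfl⟩ | ⟨rfl, rfl, rfl⟩ | ⟨rfl, rfl, rfl⟩
      · exact ⟨y, x, z, Sym2.eq_swap, rfl, tri_mem_rotate h⟩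
      · exact ⟨z, y, x, Sym2.eq_swap, rfl, tri_mem_rotate (tri_mem_rotate h)⟩
      · exact ⟨x, z, y, Sym2.eq_swap, rfl, h⟩
    · exact Or.inr ⟨u, k, hu⟩
  · rintro (⟨u, a, b, rfl, rfl, h⟩ | ⟨u, z, h⟩)
    · refine ⟨s(b, a), (M.mem_faces _).2 (Or.inl ⟨a, u, b, tri_mem_rotate (tri_mem_rotate h), ?_⟩)⟩
      rw [Sym2.eq_swap (a := a)]
    · exact ⟨z, (M.mem_faces _).2 (Or.inr ⟨u, h⟩)⟩

theorem exists_of_dEdge (M : MedialData G T w cyc S) {i j : Sym2 V} (h : T.DEdge i j) :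
    ∃ u a b, a ≠ b ∧ a ∈ w u ∧ b ∈ w u ∧ i = s(u, a) ∧ j = s(u, b) := by
  have hne := h.ne
  rw [M.dEdge_iff] at h
  obtain ⟨u, a, b, rfl, rfl, h⟩ | ⟨u, z, h⟩ := h
  · obtain ⟨-, h2, -⟩ := ne_of_tri_mem h
    exact ⟨u, a, b, h2.symm, (M.link u).mem_iff_adj.2 (DEdge.adj ⟨b,
      tri_mem_rotate (tri_mem_rotate h)⟩).symm, (M.link u).mem_iff_adj.2 (DEdge.adj ⟨a, h⟩),
      rfl, rfl⟩
  · obtain ⟨a, ha, rfl⟩ := M.exists_of_mem h (mem_tri.2 (Or.inl rfl))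
    obtain ⟨b, hb, rfl⟩ := M.exists_of_mem h (mem_tri.2 (Or.inr (Or.inl rfl)))
    exact ⟨u, a, b, fun e => hne (by rw [e]), ha, hb, rfl, rfl⟩

theorem dEdge_iff_at (M : MedialData G T w cyc S) {u a b : V} (hab : a ≠ b) :
    T.DEdge s(u, a) s(u, b) ↔ tri u b a ∈ G.faces ∨ ∃ z, tri s(u, a) s(u, b) z ∈ S u := by
  rw [M.dEdge_iff]
  constructor
  · rintro (⟨u', a', b', ha, hb, h⟩ | ⟨u', z, h⟩)
    · obtain ⟨rfl, rfl, rfl⟩ := Sym2.eq_of_common hab ha hb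
      exact Or.inl h
    · obtain ⟨a', -, ha⟩ := M.exists_of_mem h (mem_tri.2 (Or.inl rfl))
      obtain ⟨b', -, hb⟩ := M.exists_of_mem h (mem_tri.2 (Or.inr (Or.inl rfl)))
      obtain ⟨rfl, rfl, rfl⟩ := Sym2.eq_of_common hab ha hb
      exact Or.inr ⟨z, h⟩
  · rintro (h | ⟨z, h⟩)
    · exact Or.inl ⟨u, a, b, rfl, rfl, h⟩
    · exact Or.inr ⟨u, z, h⟩

theorem nodup (M : MedialData G T w cyc S) (u : V) : ((w u).map fun v => s(u, v)).Nodup :=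
  (M.link u).nodup.map (Sym2.mk_injective u)

theorem head?_map_iff {u a : V} :
    ((w u).map fun v => s(u, v)).head? = some s(u, a) ↔ (w u).head? = some a := by
  rw [List.head?_map, Option.map_eq_some_iff]
  exact ⟨fun ⟨b, hb, e⟩ => Sym2.mk_injective u e ▸ hb, fun h => ⟨a, h, rfl⟩⟩

theorem getLast?_map_iff {u a : V} :
    ((w u).map fun v => s(u, v)).getLast? = some s(u, a) ↔ (w u).getLast? = some a := by
  rw [List.getLast?_map, Option.map_eq_some_iff]
  exact ⟨fun ⟨b, hb, e⟩ => Sym2.mk_injective u e ▸ hb, fun h => ⟨a, h, rfl⟩⟩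

/-- An edge of `T` at the polygon of `u` is interior unless it is the closing edge of the polygon of a
boundary vertex. -/
theorem dEdge_symm_at (M : MedialData G T w cyc S) {u a b : V} (hab : a ≠ b)
    (h : T.DEdge s(u, a) s(u, b))
    (ha : (w u).getLast? = some a → (w u).head? = some b → cyc u) :
    T.DEdge s(u, b) s(u, a) := by
  have L := M.link u
  have hinj := Sym2.mk_injective u
  rw [M.dEdge_iff_at hab] at h
  rw [M.dEdge_iff_at hab.symm]
  rcases h with h | ⟨z, h⟩
  · right
    rcases (L.mem_faces _ _).1 h with h' | ⟨hc, hl, hh⟩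
    · rcases (M.poly u).side ((List.map_pair_infix_iff hinj).2 h') with e | h
      -- For a 2-gon the side is also the closing edge, so the assumption would make u interior, and
      -- an interior vertex has at least three neighbours.
      · exfalso
        have e' : w u = [b, a] := by
          apply List.map_injective_iff.2 hinj
          exact e
        have := L.three_le (ha (by simp [e']) (by simp [e']))
        simp [e'] at this
      · exact h
    · have h3 := L.three_le hc
      rcases (M.poly u).closing (getLast?_map_iff.2 hl) (head?_map_iff.2 hh) with e | h
      · have := congrArg List.length e
        simp at this
        omega
      · exact h
  · rcases (M.poly u).edge_cases h with h | ⟨hl, hh⟩ | h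
    · left
      exact (L.mem_faces _ _).2 (Or.inl ((List.map_pair_infix_iff hinj).1 h))
    · left
      rw [getLast?_map_iff] at hl
      rw [head?_map_iff] at hh
      exact (L.mem_faces _ _).2 (Or.inr ⟨ha hl hh, hl, hh⟩)
    · exact Or.inr h

/-- An interior edge of `G` is an interior vertex of the triangulated medial graph. -/
theorem isIntVertex (M : MedialData G T w cyc S) {u v : V} (h : G.IsIntEdge u v) :
    T.IsIntVertex s(u, v) := by
  -- The end points of the path at a boundary vertex are boundary edges of G, so the exceptional
  -- closing edge never touches an interior edge {uv}.
  have key : ∀ {u v}, G.IsIntEdge u v → ((w u).getLast? = some v → cyc u) ∧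
      ((w u).head? = some v → cyc u) := fun {u v} h =>
    ⟨((M.link u).dEdge_iff.1 h.1).2, ((M.link u).dEdge_iff'.1 h.2).2⟩
  constructor
  · obtain ⟨x, hx⟩ := h.1
    exact ⟨_, M.dEdge_iff.2 (Or.inl ⟨v, u, x, Sym2.eq_swap, rfl, tri_mem_rotate hx⟩)⟩
  · intro j
    constructor
    · intro hj
      obtain ⟨x, a, b, hab, -, -, e, rfl⟩ := M.exists_of_dEdge hj
      rw [e] at hj ⊢
      have h' : G.IsIntEdge x a := by
        rcases Sym2.eq_iff.1 e with ⟨rfl, rfl⟩ | ⟨rfl, rfl⟩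
        · exact h
        · exact h.symm
      exact M.dEdge_symm_at hab hj fun h1 _ => (key h').1 h1
    · intro hj
      obtain ⟨x, b, a, hab, -, -, rfl, e⟩ := M.exists_of_dEdge hj
      rw [e] at hj ⊢
      have h' : G.IsIntEdge x a := by
        rcases Sym2.eq_iff.1 e with ⟨rfl, rfl⟩ | ⟨rfl, rfl⟩
        · exact h
        · exact h.symm
      exact M.dEdge_symm_at hab hj fun _ h1 => (key h').2 h1

/-- The closing edge of the polygon at a boundary vertex is not an interior edge. -/
theorem not_isIntEdge_closing (M : MedialData G T w cyc S) {u a b : V} (hc : ¬ cyc u)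
    (ha : (w u).head? = some a) (hb : (w u).getLast? = some b) :
    ¬ T.DEdge s(u, a) s(u, b) := by
  have L := M.link u
  have hab : a ≠ b := by
    obtain ⟨x, y, hxy, hx, hy, -, -⟩ := L.exists_head_last
    rw [ha] at hx
    rw [hb] at hy
    cases hx
    cases hy
    exact hxy
  rw [M.dEdge_iff_at hab]
  rintro (h | ⟨z, h⟩)
  · exact hc ((L.dEdge_iff.1 ⟨a, h⟩).2 hb)
  · exact (M.poly u).reverse_closing_notMem (M.nodup u) (head?_map_iff.2 ha)
      (getLast?_map_iff.2 hb) h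

theorem edge_at_cases (M : MedialData G T w cyc S) {u a b : V} (hab : a ≠ b)
    (h : T.DEdge s(u, a) s(u, b)) :
    [b, a] <:+: w u ∨ ((w u).getLast? = some b ∧ (w u).head? = some a) ∨
      ∃ t ∈ S u, s(u, a) ∈ t ∧ s(u, b) ∈ t := by
  rcases (M.dEdge_iff_at hab).1 h with h | ⟨z, h⟩
  · rcases ((M.link u).mem_faces _ _).1 h with h | ⟨-, h⟩
    · exact Or.inl h
    · exact Or.inr (Or.inl h)
  · exact Or.inr (Or.inr ⟨_, h, mem_tri.2 (by simp), mem_tri.2 (by simp)⟩)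

end MedialData

/-- The medial triangle of a face of `G`. -/
noncomputable def medialFace (hT : G.IsMedialTriangulation T) (f : G.Face) : T.Face :=
  have h := G.eq_tri _ f.2
  ⟨tri s(h.choose, h.choose_spec.choose) s(h.choose_spec.choose, h.choose_spec.choose_spec.choose)
    s(h.choose_spec.choose_spec.choose, h.choose),
    hT.mem (h.choose_spec.choose_spec.choose_spec.2.2.2 ▸ f.2)⟩

theorem medialFace_eq (hT : G.IsMedialTriangulation T) {u v w : V} (h : tri u v w ∈ G.faces) :
    medialFace hT ⟨tri u v w, h⟩ = ⟨tri s(u, v) s(v, w) s(w, u), hT.mem h⟩ := by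
  have h' := G.eq_tri _ h
  have e := h'.choose_spec.choose_spec.choose_spec.2.2.2
  refine Subtype.ext ?_
  change tri s(h'.choose, _) s(_, _) s(_, _) = _
  generalize h'.choose_spec.choose_spec.choose = z at e ⊢
  generalize h'.choose_spec.choose = y at e ⊢
  generalize h'.choose = x at e ⊢
  rcases tri_eq_iff.1 e with ⟨rfl, rfl, rfl⟩ | ⟨rfl, rfl, rfl⟩ | ⟨rfl, rfl, rfl⟩
  · rfl
  · exact tri_rotate _ _ _
  · exact (tri_rotate _ _ _).trans (tri_rotate _ _ _)

/-- A function on the faces of a triangulation of the medial graph which takes the same values on both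
sides of the interior edges takes the same value on all medial triangles. -/
theorem const_on_medialFaces (hT : G.IsMedialTriangulation T) (hG : G.graph.Connected) {X : Type*}
    (g : T.Face → X) (hg : ∀ i j (h : T.IsIntEdge i j), g h.left = g h.right) (f f' : G.Face) :
    g (medialFace hT f) = g (medialFace hT f') := by
  obtain ⟨w, cyc, S, M⟩ := hT.exists_data
  have hg' : ∀ x y z z' (h : tri x y z ∈ T.faces) (h' : tri y x z' ∈ T.faces),
      g ⟨_, h⟩ = g ⟨_, h'⟩ := by
    intro x y z z' h h'
    have e : T.IsIntEdge x y := ⟨⟨z, h⟩, ⟨z', h'⟩⟩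
    rw [← e.left_eq h, ← e.right_eq h', hg]
  refine const_of_const_at_vertices hG (fun f => g (medialFace hT f)) (fun u => ?_) f f'
  have L := M.link u
  obtain ⟨a, b, hab, ha, hb, -, -⟩ := L.exists_head_last
  have hrot : ∀ (x y : V) (h : tri u x y ∈ G.faces), ∃ h' : tri s(u, y) s(u, x) s(x, y) ∈ T.faces,
      medialFace hT ⟨_, h⟩ = ⟨_, h'⟩ := by
    intro x y h
    have e : tri s(u, x) s(x, y) s(y, u) = tri s(u, y) s(u, x) s(x, y) := by
      rw [Sym2.eq_swap (a := y), tri_rotate, tri_rotate]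
    refine ⟨e ▸ hT.mem h, ?_⟩
    rw [medialFace_eq]
    exact Subtype.ext e
  have hside : ∀ x y (h : tri u x y ∈ G.faces), [x, y] <:+: w u →
      ∃ z', ∃ h' : tri s(u, b) s(u, a) z' ∈ T.faces, g (medialFace hT ⟨_, h⟩) = g ⟨_, h'⟩ := by
    intro x y h hxy
    obtain ⟨h', e⟩ := hrot x y h
    rw [e]
    exact (M.poly u).exists_eq_closing (fun t ht => (M.mem_faces t).2 (Or.inr ⟨u, ht⟩)) hg'
      (MedialData.head?_map_iff.2 ha) (MedialData.getLast?_map_iff.2 hb) h'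
      ((List.map_pair_infix_iff (Sym2.mk_injective u)).2 hxy)
  -- The triangle to the left of the closing edge, directed from last to first. By `unique_left` it
  -- is the common place to which all values are carried across the polygon.
  obtain ⟨z, hz⟩ : ∃ z, tri s(u, b) s(u, a) z ∈ T.faces := by
    obtain ⟨x, y, hxy⟩ : ∃ x y, [x, y] <:+: w u := by
      have h2 := L.two_le
      exact ⟨(w u)[0], (w u)[1], List.pair_infix_iff.2 ⟨0, by simp, by simp⟩⟩
    obtain ⟨z, hz, -⟩ := hside x y ((L.mem_faces _ _).2 (Or.inl hxy)) hxy
    exact ⟨z, hz⟩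
  have all : ∀ f : G.Face, u ∈ f.1 → g (medialFace hT f) = g ⟨_, hz⟩ := by
    intro f hf
    obtain ⟨x, y, h, rfl⟩ := f.exists_eq_of_mem hf
    rcases (L.mem_faces _ _).1 h with h' | ⟨-, hx, hy⟩
    · obtain ⟨z', hz', e⟩ := hside x y h h'
      obtain rfl := T.unique_left _ _ _ _ hz hz'
      exact e
    -- The face that closes the cycle has its medial triangle directly on the other side of the
    -- closing edge.
    · rw [hb] at hx
      rw [ha] at hy
      cases hx
      cases hy
      obtain ⟨h', e⟩ := hrot b a h
      rw [e]
      exact hg' _ _ _ _ _ _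
  intro f f' hf hf'
  exact (all f hf).trans (all f' hf').symm

end TriMesh

/-! ### Quadratic vector fields and their tangency to circles. -/

open scoped ComplexConjugate

/-- The vector of `ℂ³` which corresponds to the quadratic polynomial `(X - a) (X - b)`. -/
noncomputable def weierstrass (a b : ℂ) : Fin 3 → ℂ :=
  ![1 - a * b, Complex.I * (1 + a * b), a + b]

theorem weierstrass_comm (a b : ℂ) : weierstrass a b = weierstrass b a := by
  simp only [weierstrass, mul_comm, add_comm]

theorem weierstrass_self (z : ℂ) :
    weierstrass z z = ![1 - z ^ 2, Complex.I * (1 + z ^ 2), 2 * z] := by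
  simp only [weierstrass, sq, two_mul]

/-- The value at `x` of the quadratic polynomial which corresponds to a vector of `ℂ³`. -/
noncomputable def quadEval (x : ℂ) : (Fin 3 → ℂ) →ₗ[ℂ] ℂ where
  toFun v := (v 0 - Complex.I * v 1) / 2 * x ^ 2 - v 2 * x + (-v 0 - Complex.I * v 1) / 2
  map_add' v v' := by simp only [Pi.add_apply]; ring
  map_smul' c v := by simp only [Pi.smul_apply, smul_eq_mul, RingHom.id_apply]; ring

/-- The leading coefficient of the quadratic polynomial which corresponds to a vector of `ℂ³`. -/
noncomputable def quadLead : (Fin 3 → ℂ) →ₗ[ℂ] ℂ where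
  toFun v := (v 0 - Complex.I * v 1) / 2
  map_add' v v' := by simp only [Pi.add_apply]; ring
  map_smul' c v := by simp only [Pi.smul_apply, smul_eq_mul, RingHom.id_apply]; ring

theorem quadEval_apply (x : ℂ) (v : Fin 3 → ℂ) : quadEval x v =
    (v 0 - Complex.I * v 1) / 2 * x ^ 2 - v 2 * x + (-v 0 - Complex.I * v 1) / 2 := rfl

theorem quadLead_apply (v : Fin 3 → ℂ) : quadLead v = (v 0 - Complex.I * v 1) / 2 := rfl

/-- This identity is the dictionary: jumps of realizations become quadratics with prescribed zeros.
-/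
theorem quadEval_weierstrass (x a b : ℂ) : quadEval x (weierstrass a b) = (x - a) * (x - b) := by
  simp only [quadEval_apply, weierstrass, Matrix.cons_val_zero, Matrix.cons_val_one,
    Matrix.cons_val]
  linear_combination (-((1 + a * b) * x ^ 2 + (1 + a * b)) / 2) * Complex.I_sq

theorem quadLead_weierstrass (a b : ℂ) : quadLead (weierstrass a b) = 1 := by
  simp only [quadLead_apply, weierstrass, Matrix.cons_val_zero, Matrix.cons_val_one]
  linear_combination (-(1 + a * b) / 2) * Complex.I_sq

theorem eq_smul_weierstrass_of_coeff {v : Fin 3 → ℂ} {a b : ℂ} (h2 : v 2 = quadLead v * (a + b))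
    (h0 : (-v 0 - Complex.I * v 1) / 2 = quadLead v * (a * b)) : v = quadLead v • weierstrass a b := by
  rw [quadLead_apply] at *
  have h1 : v 0 = (v 0 - Complex.I * v 1) / 2 * (1 - a * b) := by linear_combination -h0
  have h1' : v 1 = (v 0 - Complex.I * v 1) / 2 * (Complex.I * (1 + a * b)) := by
    linear_combination Complex.I * h0 + v 1 * Complex.I_sq
  ext i
  fin_cases i
  · exact h1
  · exact h1'
  · exact h2

theorem eq_smul_weierstrass {v : Fin 3 → ℂ} {a b : ℂ} (hab : a ≠ b) (ha : quadEval a v = 0)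
    (hb : quadEval b v = 0) : v = quadLead v • weierstrass a b := by
  have h : quadLead v * (a + b) = v 2 := by
    have : (a - b) * (quadLead v * (a + b) - v 2) = 0 := by
      rw [quadEval_apply] at ha hb
      rw [quadLead_apply]
      linear_combination ha - hb
    exact sub_eq_zero.1 ((mul_eq_zero.1 this).resolve_left (sub_ne_zero.2 hab))
  refine eq_smul_weierstrass_of_coeff h.symm ?_
  rw [quadEval_apply, ← quadLead_apply, ← h] at ha
  linear_combination ha

theorem eq_zero_of_quadEval {v : Fin 3 → ℂ} {a b c : ℂ} (hab : a ≠ b) (hbc : b ≠ c) (hca : c ≠ a)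
    (ha : quadEval a v = 0) (hb : quadEval b v = 0) (hc : quadEval c v = 0) : v = 0 := by
  have h := eq_smul_weierstrass hab ha hb
  rw [h, map_smul, quadEval_weierstrass, smul_eq_mul] at hc
  have h0 := (mul_eq_zero.1 hc).resolve_right
    (mul_ne_zero (sub_ne_zero.2 hca) (sub_ne_zero.2 hbc.symm))
  rw [h, h0, zero_smul]

/-- The quadratic vector fields which are tangent to a circle. -/
noncomputable def tangentFields (c : ℂ) (R : ℝ) : Submodule ℝ (Fin 3 → ℂ) where
  carrier := {v | ∀ x, ‖x - c‖ = R → (quadEval x v * conj (x - c)).re = 0}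
  add_mem' := by
    intro v v' h h' x hx
    rw [map_add, add_mul, Complex.add_re, h x hx, h' x hx, add_zero]
  zero_mem' := by
    intro x _
    simp
  smul_mem' := by
    intro r v h x hx
    have : quadEval x (r • v) = r * quadEval x v := by
      rw [← Complex.coe_smul, map_smul, smul_eq_mul]
    rw [this, mul_assoc, Complex.re_ofReal_mul, h x hx, mul_zero]

theorem re_eq_zero_of_conj_eq_neg {z : ℂ} (h : conj z = -z) : z.re = 0 := by
  have := congrArg Complex.re h
  rw [Complex.conj_re, Complex.neg_re] at this
  linarith

theorem mul_conj_of_norm_eq {z : ℂ} {R : ℝ} (h : ‖z‖ = R) : z * conj z = (R : ℂ) ^ 2 := by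
  rw [Complex.mul_conj, Complex.normSq_eq_norm_sq, h]
  push_cast
  rfl

/-- The orbits of the field (X - a)(X - b)/(b - a) are the circles through a and b. On the circle,
conjugation acts on points relative to c as w ↦ R²/w, which turns the expression into its negative.
-/
theorem re_cross_ratio_eq_zero {R : ℝ} {x a b c : ℂ} (hab : a ≠ b)
    (ha : ‖a - c‖ = R) (hb : ‖b - c‖ = R) (hx : ‖x - c‖ = R) :
    ((x - a) * (x - b) / (b - a) * conj (x - c)).re = 0 := by
  apply re_eq_zero_of_conj_eq_neg
  have h1 := mul_conj_of_norm_eq ha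
  have h2 := mul_conj_of_norm_eq hb
  have h3 := mul_conj_of_norm_eq hx
  have hne : b - a ≠ 0 := sub_ne_zero.2 hab.symm
  have hne' : conj b - conj a ≠ 0 := by
    rw [← map_sub]
    exact (map_ne_zero _).2 hne
  simp only [map_mul, map_div₀, map_sub, Complex.conj_conj] at *
  rw [div_mul_eq_mul_div, div_mul_eq_mul_div, ← neg_div, div_eq_div_iff hne' hne]
  generalize (R : ℂ) ^ 2 = r at *
  generalize conj a = a' at *
  generalize conj b = b' at *
  generalize conj x = x' at *
  generalize conj c = c' at *
  -- Moving the center to the origin reduces the three circle equations to AA' = BB' = XX' = r.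
  obtain ⟨A, rfl⟩ : ∃ A, a = A + c := ⟨a - c, by ring⟩
  obtain ⟨B, rfl⟩ : ∃ A, b = A + c := ⟨b - c, by ring⟩
  obtain ⟨X, rfl⟩ : ∃ A, x = A + c := ⟨x - c, by ring⟩
  obtain ⟨A', rfl⟩ : ∃ A, a' = A + c' := ⟨a' - c', by ring⟩
  obtain ⟨B', rfl⟩ : ∃ A, b' = A + c' := ⟨b' - c', by ring⟩
  obtain ⟨X', rfl⟩ : ∃ A, x' = A + c' := ⟨x' - c', by ring⟩
  simp only [add_sub_cancel_right, add_sub_add_right_eq_sub] at *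
  grind

theorem smul_weierstrass_mem_tangentFields {R : ℝ} {a b c : ℂ} (hab : a ≠ b) (ha : ‖a - c‖ = R)
    (hb : ‖b - c‖ = R) (q : ℝ) :
    ((q : ℂ) / (b - a)) • weierstrass a b ∈ tangentFields c R := by
  intro x hx
  have h := re_cross_ratio_eq_zero hab ha hb hx
  have : quadEval x (((q : ℂ) / (b - a)) • weierstrass a b) * conj (x - c) =
      q * ((x - a) * (x - b) / (b - a) * conj (x - c)) := by
    rw [map_smul, quadEval_weierstrass, smul_eq_mul]
    ring
  rw [this, Complex.re_ofReal_mul, h, mul_zero]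

theorem exists_third_point {R : ℝ} (hR : 0 < R) {a b c : ℂ} (ha : ‖a - c‖ = R) :
    ∃ x, ‖x - c‖ = R ∧ x ≠ a ∧ x ≠ b := by
  have hne : a - c ≠ 0 := by
    rw [← norm_pos_iff, ha]
    exact hR
  -- The antipode of a will do, and if it happens to be b, a quarter turn of a will.
  by_cases h : c - (a - c) = b
  · refine ⟨c + Complex.I * (a - c), by simp [ha], fun e => hne ?_, fun e => hne ?_⟩
    · have : (1 - Complex.I) * (a - c) = 0 := by linear_combination -e
      refine (mul_eq_zero.1 this).resolve_left fun h => ?_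
      simpa using congrArg Complex.re h
    · have : (1 + Complex.I) * (a - c) = 0 := by linear_combination e - h
      refine (mul_eq_zero.1 this).resolve_left fun h => ?_
      simpa using congrArg Complex.re h
  · refine ⟨c - (a - c), by rw [sub_sub_cancel_left, norm_neg, ha], fun e => hne ?_, h⟩
    linear_combination (-1 / 2 : ℂ) * e

/-- At a third point of the circle, the given field and (X - a)(X - b)/(b - a) are both tangent and
the latter is non-zero, so their ratio k (b - a) is real. -/
theorem im_eq_zero_of_smul_weierstrass_mem {R : ℝ} (hR : 0 < R) {a b c : ℂ} (hab : a ≠ b)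
    (ha : ‖a - c‖ = R) (hb : ‖b - c‖ = R) {k : ℂ} (h : k • weierstrass a b ∈ tangentFields c R) :
    (k * (b - a)).im = 0 := by
  obtain ⟨x, hx, hxa, hxb⟩ := exists_third_point (b := b) hR ha
  have h1 := re_cross_ratio_eq_zero hab ha hb hx
  have h2 := h x hx
  have hne : b - a ≠ 0 := sub_ne_zero.2 hab.symm
  have hxc : conj (x - c) ≠ 0 := by
    rw [map_ne_zero, ← norm_pos_iff, hx]
    exact hR
  have h3 : (x - a) * (x - b) / (b - a) * conj (x - c) ≠ 0 :=
    mul_ne_zero (div_ne_zero (mul_ne_zero (sub_ne_zero.2 hxa) (sub_ne_zero.2 hxb)) hne) hxc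
  have h4 : quadEval x (k • weierstrass a b) * conj (x - c) =
      k * (b - a) * ((x - a) * (x - b) / (b - a) * conj (x - c)) := by
    rw [map_smul, quadEval_weierstrass, smul_eq_mul]
    field_simp
  rw [h4, Complex.mul_re, h1, mul_zero, zero_sub, neg_eq_zero] at h2
  exact (mul_eq_zero.1 h2).resolve_right fun h5 => h3 (Complex.ext h1 h5)

theorem exists_real_mul_eq {x y t : ℂ} (hy : y ≠ 0) (ht : t ≠ 0) (h1 : (x * t).re = 0)
    (h2 : (y * t).re = 0) : ∃ r : ℝ, x = r * y := by
  have h3 : (y * t).im ≠ 0 := fun h => mul_ne_zero hy ht (Complex.ext h2 h)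
  refine ⟨(x * t).im / (y * t).im, mul_right_cancel₀ ht ?_⟩
  rw [mul_assoc]
  apply Complex.ext
  · rw [Complex.re_ofReal_mul, h1, h2, mul_zero]
  · rw [Complex.im_ofReal_mul, div_mul_cancel₀ _ h3]

/-- A quadratic vector field which is tangent to a circle at three points is tangent to it
everywhere. -/
theorem mem_tangentFields_of_three {R : ℝ} (hR : 0 < R) {a b d c : ℂ} (hab : a ≠ b) (hbd : b ≠ d)
    (hda : d ≠ a) (ha : ‖a - c‖ = R) (hb : ‖b - c‖ = R) (hd : ‖d - c‖ = R) {v : Fin 3 → ℂ}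
    (hva : (quadEval a v * conj (a - c)).re = 0) (hvb : (quadEval b v * conj (b - c)).re = 0)
    (hvd : (quadEval d v * conj (d - c)).re = 0) : v ∈ tangentFields c R := by
  -- Lagrange interpolation inside the space of tangent fields: a real multiple of (X - b)(X - d)/(d
  -- - b) takes any tangential value at a.
  have key : ∀ {a b d : ℂ}, a ≠ b → b ≠ d → d ≠ a → ‖a - c‖ = R → ‖b - c‖ = R → ‖d - c‖ = R →
      (quadEval a v * conj (a - c)).re = 0 →
      ∃ e ∈ tangentFields c R, quadEval a e = quadEval a v ∧ quadEval b e = 0 ∧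
        quadEval d e = 0 := by
    intro a b d hab hbd hda ha hb hd hva
    have hac : conj (a - c) ≠ 0 := by
      rw [map_ne_zero, ← norm_pos_iff, ha]
      exact hR
    have hne : (a - b) * (a - d) / (d - b) ≠ 0 :=
      div_ne_zero (mul_ne_zero (sub_ne_zero.2 hab) (sub_ne_zero.2 hda.symm))
        (sub_ne_zero.2 hbd.symm)
    obtain ⟨r, hr⟩ := exists_real_mul_eq hne hac hva (re_cross_ratio_eq_zero hbd hb hd ha)
    refine ⟨_, smul_weierstrass_mem_tangentFields hbd hb hd r, ?_, ?_, ?_⟩ <;>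
      rw [map_smul, quadEval_weierstrass, smul_eq_mul]
    · rw [hr]
      ring
    · simp
    · simp
  obtain ⟨e₁, m₁, h1a, h1b, h1d⟩ := key hab hbd hda ha hb hd hva
  obtain ⟨e₂, m₂, h2b, h2d, h2a⟩ := key hbd hda hab hb hd ha hvb
  obtain ⟨e₃, m₃, h3d, h3a, h3b⟩ := key hda hab hbd hd ha hb hvd
  have : v - (e₁ + e₂ + e₃) = 0 := by
    apply eq_zero_of_quadEval hab hbd hda <;> simp only [map_sub, map_add]
    · rw [h1a, h2a, h3a]; ring
    · rw [h1b, h2b, h3b]; ring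
    · rw [h1d, h2d, h3d]; ring
  rw [sub_eq_zero.1 this]
  exact add_mem (add_mem m₁ m₂) m₃

/-- This is the parabolic limit of the fields with two zeros: both zeros merge at z along the
circle, where b - a points in the direction ± i e, and the inverse of i e is -i ē. -/
theorem smul_weierstrass_self_mem {R : ℝ} {z e : ℂ} (he : ‖e‖ = 1) (κ : ℝ) :
    (Complex.I * κ * conj e) • weierstrass z z ∈ tangentFields (z - R * e) R := by
  intro x hx
  apply re_eq_zero_of_conj_eq_neg
  have h1 := mul_conj_of_norm_eq he
  have h2 := mul_conj_of_norm_eq hx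
  rw [map_smul, quadEval_weierstrass, smul_eq_mul]
  simp only [map_mul, map_sub, Complex.conj_conj, Complex.conj_I, Complex.conj_ofReal] at *
  generalize conj e = e' at *
  generalize conj x = x' at *
  generalize conj z = z' at *
  obtain ⟨X, rfl⟩ : ∃ A, x = A + (z - R * e) := ⟨x - (z - R * e), by ring⟩
  obtain ⟨X', rfl⟩ : ∃ A, x' = A + (z' - R * e') := ⟨x' - (z' - R * e'), by ring⟩
  simp only [add_sub_cancel_right, Complex.ofReal_one, one_pow] at *
  generalize Complex.I = i at *
  generalize (κ : ℂ) = k at *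
  generalize (R : ℂ) = R at *
  have e1 : (X + (z - R * e) - z) = X - R * e := by ring
  have e2 : (X' + (z' - R * e') - z') = X' - R * e' := by ring
  rw [e1, e2]
  linear_combination (i * k * (e' * X - e * X')) * h2 + (i * k * R ^ 2 * (e * X' - e' * X)) * h1

theorem quadEval_expand (x z : ℂ) (v : Fin 3 → ℂ) : quadEval x v =
    quadLead v * (x - z) ^ 2 + (2 * quadLead v * z - v 2) * (x - z) + quadEval z v := by
  rw [quadEval_apply, quadEval_apply, quadLead_apply]
  ring

/-- Write the field as A (X - z)² + B (X - z). The two equations are tangency at the antipode of z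
and at the point a quarter turn away from z. Together they say that B is real and equal to 2R
Re(Ae). -/
theorem tangentFields_conditions {R : ℝ} (hR : 0 < R) {z e : ℂ} (he : ‖e‖ = 1) {v : Fin 3 → ℂ}
    (h : v ∈ tangentFields (z - R * e) R) (hz : quadEval z v = 0) :
    (2 * quadLead v * z - v 2).re = 2 * R * (quadLead v * e).re ∧
    (2 * quadLead v * z - v 2).re - (2 * quadLead v * z - v 2).im =
      2 * R * (quadLead v * e).re := by
  have h1 := mul_conj_of_norm_eq he
  rw [Complex.ofReal_one, one_pow] at h1
  have hRn : ‖(R : ℂ)‖ = R := by rw [Complex.norm_real, Real.norm_of_nonneg hR.le]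
  have a1 := h (z - 2 * R * e) (by
    rw [show z - 2 * R * e - (z - R * e) = -(R * e) by ring, norm_neg, norm_mul, he, hRn, mul_one])
  have a2 := h (z - R * e + Complex.I * (R * e)) (by
    rw [add_sub_cancel_left, norm_mul, norm_mul, he, hRn, Complex.norm_I]
    ring)
  rw [quadEval_expand _ z, hz, add_zero] at a1 a2
  generalize quadLead v = A at *
  generalize 2 * A * z - v 2 = B at *
  have e1 : (A * (z - 2 * R * e - z) ^ 2 + B * (z - 2 * R * e - z)) *
      conj (z - 2 * R * e - (z - R * e)) =
      ((2 * R ^ 2 : ℝ) : ℂ) * (B - ((2 * R : ℝ) : ℂ) * (A * e)) := by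
    rw [show z - 2 * R * e - (z - R * e) = -(R * e) by ring, map_neg, map_mul, Complex.conj_ofReal]
    push_cast
    linear_combination (-4 * R ^ 3 * A * e + 2 * R ^ 2 * B) * h1
  have e2 : (A * (z - R * e + Complex.I * (R * e) - z) ^ 2 +
      B * (z - R * e + Complex.I * (R * e) - z)) *
      conj (z - R * e + Complex.I * (R * e) - (z - R * e)) =
      ((R ^ 2 : ℝ) : ℂ) * (B * (1 + Complex.I) - ((2 * R : ℝ) : ℂ) * (A * e)) := by
    rw [add_sub_cancel_left, map_mul, map_mul, Complex.conj_ofReal, Complex.conj_I]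
    push_cast
    have hI := Complex.I_sq
    generalize Complex.I = i at *
    generalize conj e = e' at *
    have hI3 : i ^ 3 = -i := by linear_combination i * hI
    linear_combination (A * R ^ 3 * e * (-i + 2 * i ^ 2 - i ^ 3) + B * R ^ 2 * (i - i ^ 2)) * h1 +
      (2 * A * R ^ 3 * e - B * R ^ 2) * hI - A * R ^ 3 * e * hI3
  rw [e1, Complex.re_ofReal_mul] at a1
  rw [e2, Complex.re_ofReal_mul] at a2
  have b1 := (mul_eq_zero.1 a1).resolve_left (by positivity)
  have b2 := (mul_eq_zero.1 a2).resolve_left (by positivity)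
  rw [Complex.sub_re, Complex.re_ofReal_mul] at b1 b2
  have b3 : (B * (1 + Complex.I)).re = B.re - B.im := by simp [Complex.mul_re]
  rw [b3] at b2
  exact ⟨by linarith, by linarith⟩

/-- A quadratic vector field which is tangent to two externally tangent circles and which vanishes at
their point of contact has a double zero there. -/
theorem eq_smul_weierstrass_self {R R' : ℝ} (hR : 0 < R) (hR' : 0 < R') {z e : ℂ} (he : ‖e‖ = 1)
    {v : Fin 3 → ℂ} (h : v ∈ tangentFields (z - R * e) R) (h' : v ∈ tangentFields (z + R' * e) R')
    (hz : quadEval z v = 0) : ∃ κ : ℝ, v = (Complex.I * κ * conj e) • weierstrass z z := by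
  obtain ⟨a1, a2⟩ := tangentFields_conditions hR he h hz
  -- The second circle lies on the opposite side, which replaces e by -e. So Re B equals both 2R
  -- Re(Ae) and -2R' Re(Ae), and both vanish because the radii are positive.
  obtain ⟨a3, -⟩ := tangentFields_conditions (z := z) (e := -e) hR' (by rwa [norm_neg])
    (by rwa [mul_neg, sub_neg_eq_add]) hz
  rw [mul_neg, Complex.neg_re] at a3
  have h0 : (quadLead v * e).re = 0 := by
    have : (R + R') * (quadLead v * e).re = 0 := by linarith
    exact (mul_eq_zero.1 this).resolve_left (by positivity)
  have hB : 2 * quadLead v * z - v 2 = 0 := by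
    apply Complex.ext
    · rw [a1, h0, mul_zero]
      rfl
    · rw [h0, mul_zero] at a1 a2
      rw [Complex.zero_im]
      linarith
  have hv : v = quadLead v • weierstrass z z := by
    apply eq_smul_weierstrass_of_coeff
    · linear_combination -hB
    · rw [quadEval_apply, ← quadLead_apply] at hz
      linear_combination hz - z * hB
  refine ⟨(quadLead v * e).im, ?_⟩
  have h1 := mul_conj_of_norm_eq he
  rw [Complex.ofReal_one, one_pow] at h1
  have h2 : quadLead v * e = Complex.I * ((quadLead v * e).im : ℂ) := by
    apply Complex.ext <;> simp [h0]
  have h3 : quadLead v = Complex.I * ((quadLead v * e).im : ℂ) * conj e := by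
    rw [← h2]
    linear_combination -(quadLead v) * h1
  rw [← h3]
  exact hv

/-! ### Tangency points of the packing and the form ω. -/

/-- Twice the oriented area of a triangle. -/
noncomputable def triArea (x y z : ℂ) : ℝ := (conj (y - x) * (z - x)).im

theorem triArea_swap (x y z : ℂ) : triArea y x z = -triArea x y z := by
  simp only [triArea, Complex.mul_im, Complex.conj_re, Complex.conj_im, Complex.sub_re,
    Complex.sub_im]
  ring

/-- The positions of the contact points in a triple of mutually tangent circles. -/
theorem tangent_triple {x y : ℂ} {a b d : ℝ} (ha : 0 < a) (hb : 0 < b) (hd : 0 < d)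
    (hx : ‖x‖ = a + b) (hy : ‖y‖ = a + d) (hxy : ‖y - x‖ = b + d) :
    (a * y / (a + d) - a * x / (a + b)) *
      (-1 / (2 * a) - Complex.I * ((conj x * y).im / (4 * a * b * d))) = x / (a + b) := by
  have hab : (a : ℂ) + b ≠ 0 := by exact_mod_cast (by positivity : a + b ≠ 0)
  have had : (a : ℂ) + d ≠ 0 := by exact_mod_cast (by positivity : a + d ≠ 0)
  have ha' : (a : ℂ) ≠ 0 := by exact_mod_cast ha.ne'
  have hb' : (b : ℂ) ≠ 0 := by exact_mod_cast hb.ne'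
  have hd' : (d : ℂ) ≠ 0 := by exact_mod_cast hd.ne'
  have hx0 : conj x ≠ 0 := by
    rw [map_ne_zero, ← norm_pos_iff, hx]
    positivity
  have h1 : x.re ^ 2 + x.im ^ 2 = (a + b) ^ 2 := by
    rw [← hx, Complex.sq_norm, Complex.normSq_apply]; ring
  have h2 : y.re ^ 2 + y.im ^ 2 = (a + d) ^ 2 := by
    rw [← hy, Complex.sq_norm, Complex.normSq_apply]; ring
  have h3 : (y.re - x.re) ^ 2 + (y.im - x.im) ^ 2 = (b + d) ^ 2 := by
    rw [← hxy, Complex.sq_norm, Complex.normSq_apply, Complex.sub_re, Complex.sub_im]; ring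
  -- The law of cosines in the triangle with sides a + b, a + d, b + d.
  have hre : (conj x * y).re = (a + b) * (a + d) - 2 * b * d := by
    rw [Complex.mul_re, Complex.conj_re, Complex.conj_im]
    linear_combination (h1 + h2 - h3) / 2
  -- Heron's formula in the same triangle.
  have him : (conj x * y).im ^ 2 = 4 * b * d * ((a + b) * (a + d)) - 4 * b ^ 2 * d ^ 2 := by
    have h4 : (conj x * y).re ^ 2 + (conj x * y).im ^ 2 = (a + b) ^ 2 * (a + d) ^ 2 := by
      rw [Complex.mul_re, Complex.mul_im, Complex.conj_re, Complex.conj_im]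
      linear_combination (y.re ^ 2 + y.im ^ 2) * h1 + (a + b) ^ 2 * h2
    rw [hre] at h4
    linear_combination h4
  have hX := mul_conj_of_norm_eq hx
  have hXY : conj x * y = ((a + b) * (a + d) - 2 * b * d : ℝ) + ((conj x * y).im : ℂ) * Complex.I := by
    rw [← hre]
    exact (Complex.re_add_im _).symm
  have him' : ((conj x * y).im : ℂ) ^ 2 =
      4 * b * d * ((a + b) * (a + d)) - 4 * b ^ 2 * d ^ 2 := by exact_mod_cast him
  generalize ((conj x * y).im : ℂ) = D at *
  refine mul_left_cancel₀ hx0 ?_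
  have e1 : conj x * ((a * y / (a + d) - a * x / (a + b)) *
      (-1 / (2 * a) - Complex.I * (D / (4 * a * b * d)))) =
      (conj x * y * (a + b) - x * conj x * (a + d)) / ((a + b) * (a + d)) *
        ((-2 * b * d - Complex.I * D) / (4 * b * d)) := by
    field_simp
    ring
  have e2 : conj x * (x / (a + b)) = x * conj x / (a + b) := by ring
  rw [e1, e2, hXY, hX]
  push_cast
  rw [div_mul_div_comm, div_eq_div_iff (by simp [hab, had, hb', hd']) hab]
  have hI := Complex.I_sq
  generalize Complex.I = i at *
  linear_combination ((a : ℂ) + b) ^ 2 * (-D ^ 2 * hI + him')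

theorem triArea_eq_mul {x y z : ℂ} : triArea x y z = (conj (y - x) * (z - x)).im := rfl

namespace CirclePacking

variable {V : Type*} {G : TriMesh V} (P : CirclePacking G)

/-- The unit vector which points from the center of `C_u` to the center of `C_v`. -/
noncomputable def dir (u v : V) : ℂ := (P.c v - P.c u) / (P.R u + P.R v)

theorem dir_swap (u v : V) : P.dir v u = -P.dir u v := by
  rw [dir, dir, ← neg_div, neg_sub, add_comm]

theorem R_add_pos (u v : V) : 0 < P.R u + P.R v := add_pos (P.R_pos u) (P.R_pos v)

theorem R_add_ne_zero (u v : V) : (P.R u : ℂ) + P.R v ≠ 0 := by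
  exact_mod_cast (P.R_add_pos u v).ne'

theorem norm_sub {u v : V} (h : G.graph.Adj u v) : ‖P.c v - P.c u‖ = P.R u + P.R v := by
  rw [← P.tangent u v h, dist_comm, dist_eq_norm]

theorem norm_dir {u v : V} (h : G.graph.Adj u v) : ‖P.dir u v‖ = 1 := by
  have := P.R_add_pos u v
  rw [dir, norm_div, P.norm_sub h, ← Complex.ofReal_add, Complex.norm_real,
    Real.norm_of_nonneg this.le, div_self this.ne']

theorem tangency_mk (u v : V) : P.tangency s(u, v) =
    (P.R v * P.c u + P.R u * P.c v) / (P.R u + P.R v) := rfl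

theorem tangency_eq (u v : V) : P.tangency s(u, v) = P.c u + P.R u * P.dir u v := by
  have := P.R_add_ne_zero u v
  rw [tangency_mk, dir]
  field_simp
  ring

theorem center_eq (u v : V) : P.c u = P.tangency s(u, v) - P.R u * P.dir u v := by
  rw [tangency_eq]
  ring

theorem center_eq' (u v : V) : P.c v = P.tangency s(u, v) + P.R v * P.dir u v := by
  rw [Sym2.eq_swap, tangency_eq, dir_swap P v u]
  ring

theorem norm_tangency_sub {u v : V} (h : G.graph.Adj u v) :
    ‖P.tangency s(u, v) - P.c u‖ = P.R u := by
  rw [tangency_eq, add_sub_cancel_left, norm_mul, P.norm_dir h, mul_one, Complex.norm_real,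
    Real.norm_of_nonneg (P.R_pos u).le]

theorem triArea_pos {u v w : V} (h : tri u v w ∈ G.faces) :
    0 < triArea (P.c u) (P.c v) (P.c w) := P.oriented u v w h

theorem tangency_sub_mul {u v s : V} (huv : G.graph.Adj u v) (hus : G.graph.Adj u s)
    (hvs : G.graph.Adj v s) : (P.tangency s(u, s) - P.tangency s(u, v)) *
      (-1 / (2 * P.R u) - Complex.I * (triArea (P.c u) (P.c v) (P.c s) /
        (4 * P.R u * P.R v * P.R s))) = P.dir u v := by
  have := tangent_triple (P.R_pos u) (P.R_pos v) (P.R_pos s) (P.norm_sub huv) (P.norm_sub hus)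
    (by rw [sub_sub_sub_cancel_right]; exact P.norm_sub hvs)
  rw [← triArea_eq_mul] at this
  rw [dir, ← this, tangency_eq, tangency_eq, dir, dir]
  ring

/-- What matters is that the real part -1/(2 R_u) does not depend on the third circle, so it cancels
between the two faces at an edge. -/
theorem dir_div_tangency_sub {u v s : V} (huv : G.graph.Adj u v) (hus : G.graph.Adj u s)
    (hvs : G.graph.Adj v s) : P.tangency s(u, s) - P.tangency s(u, v) ≠ 0 ∧
      P.dir u v / (P.tangency s(u, s) - P.tangency s(u, v)) =
      -1 / (2 * P.R u) - Complex.I * (triArea (P.c u) (P.c v) (P.c s) /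
        (4 * P.R u * P.R v * P.R s)) := by
  have h := P.tangency_sub_mul huv hus hvs
  have hne : P.tangency s(u, s) - P.tangency s(u, v) ≠ 0 := by
    intro h0
    rw [h0, zero_mul] at h
    have := P.norm_dir huv
    rw [← h, norm_zero] at this
    exact zero_ne_one this
  exact ⟨hne, by rw [div_eq_iff hne, ← h, mul_comm]⟩

/-- The factor `κ` in `1 / ω(e_{uv}) = i κ ē`, where `e` is the direction from the center of `C_u` to
the center of `C_v`. -/
noncomputable def kappa {u v : V} (h : G.IsIntEdge u v) : ℝ :=
  -(triArea (P.c u) (P.c v) (P.c h.leftApex) / (4 * P.R u * P.R v * P.R h.leftApex) +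
    triArea (P.c v) (P.c u) (P.c h.rightApex) / (4 * P.R u * P.R v * P.R h.rightApex))

theorem kappa_symm {u v : V} (h : G.IsIntEdge u v) : P.kappa h.symm = P.kappa h := by
  have e1 : h.symm.leftApex = h.rightApex := rfl
  have e2 : h.symm.rightApex = h.leftApex := rfl
  rw [kappa, kappa, e1, e2]
  ring

/-- Both faces at an edge are positively oriented, so their two area terms cannot cancel. -/
theorem kappa_neg {u v : V} (h : G.IsIntEdge u v) : P.kappa h < 0 := by
  have h1 := P.triArea_pos h.leftApex_mem
  have h2 := P.triArea_pos h.rightApex_mem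
  have := P.R_pos u
  have := P.R_pos v
  have := P.R_pos h.leftApex
  have := P.R_pos h.rightApex
  rw [kappa, neg_lt_zero]
  positivity

theorem kappa_ne_zero {u v : V} (h : G.IsIntEdge u v) : P.kappa h ≠ 0 := (P.kappa_neg h).ne

/-- 1/ω is the difference of the inverses of z_k - z_i and z_m - z_i. Multiplied by e, these have
equal real parts by `dir_div_tangency_sub`, so only an imaginary number survives. -/
theorem inv_omega {u v : V} (h : G.IsIntEdge u v) :
    (P.omega h)⁻¹ = Complex.I * P.kappa h * conj (P.dir u v) := by
  have hl := h.leftApex_mem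
  have hr := h.rightApex_mem
  have huv : G.graph.Adj u v := h.1.adj
  have hvs : G.graph.Adj v h.leftApex := TriMesh.DEdge.adj ⟨_, TriMesh.tri_mem_rotate hl⟩
  have hsu : G.graph.Adj h.leftApex u :=
    TriMesh.DEdge.adj ⟨_, TriMesh.tri_mem_rotate (TriMesh.tri_mem_rotate hl)⟩
  have hut : G.graph.Adj u h.rightApex := TriMesh.DEdge.adj ⟨_, TriMesh.tri_mem_rotate hr⟩
  have htv : G.graph.Adj h.rightApex v :=
    TriMesh.DEdge.adj ⟨_, TriMesh.tri_mem_rotate (TriMesh.tri_mem_rotate hr)⟩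
  obtain ⟨n1, e1⟩ := P.dir_div_tangency_sub huv hsu.symm hvs
  obtain ⟨n2, e2⟩ := P.dir_div_tangency_sub huv hut htv.symm
  have hd := mul_conj_of_norm_eq (P.norm_dir huv)
  rw [Complex.ofReal_one, one_pow] at hd
  have hk : P.dir u v * (P.omega h)⁻¹ = Complex.I * P.kappa h := by
    have : P.dir u v * (P.omega h)⁻¹ =
        P.dir u v / (P.tangency s(u, h.leftApex) - P.tangency s(u, v)) -
        P.dir u v / (P.tangency s(u, h.rightApex) - P.tangency s(u, v)) := by
      rw [omega, inv_div]
      field_simp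
      ring
    rw [this, e1, e2, kappa, triArea_swap (P.c u) (P.c v)]
    push_cast
    ring
  rw [← hk]
  linear_combination -(P.omega h)⁻¹ * hd

theorem dir_ne_zero {u v : V} (h : G.graph.Adj u v) : P.dir u v ≠ 0 := by
  rw [← norm_pos_iff, P.norm_dir h]
  exact one_pos

theorem omega_ne_zero {u v : V} (h : G.IsIntEdge u v) : P.omega h ≠ 0 := by
  refine (inv_eq_zero.not).1 ?_
  rw [P.inv_omega h]
  refine mul_ne_zero (mul_ne_zero Complex.I_ne_zero ?_) ?_
  · exact_mod_cast P.kappa_ne_zero h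
  · exact (map_ne_zero _).2 (P.dir_ne_zero h.1.adj)

/-- Reversing the edge replaces the tangency points on C_u in the definition by those on C_v, so the
sign is not visible there. In iκē it is, since κ is symmetric and e changes sign. -/
theorem omega_symm {u v : V} (h : G.IsIntEdge u v) : P.omega h.symm = -P.omega h := by
  rw [← inv_inj, P.inv_omega, P.kappa_symm, dir_swap, inv_neg, P.inv_omega, map_neg, mul_neg]

theorem div_omega {u v : V} (h : G.IsIntEdge u v) (l : ℝ) :
    (l : ℂ) / P.omega h = Complex.I * (l * P.kappa h : ℝ) * conj (P.dir u v) := by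
  rw [div_eq_mul_inv, P.inv_omega]
  push_cast
  ring

/-- The vector fields tangent to `C_u`. -/
noncomputable abbrev fields (u : V) : Submodule ℝ (Fin 3 → ℂ) := tangentFields (P.c u) (P.R u)

theorem div_omega_smul_mem {u v : V} (h : G.IsIntEdge u v) (l : ℝ) :
    ((l : ℂ) / P.omega h) • weierstrass (P.tangency s(u, v)) (P.tangency s(u, v)) ∈
      P.fields u := by
  rw [P.div_omega, fields, P.center_eq u v]
  exact smul_weierstrass_self_mem (P.norm_dir h.1.adj) _

/-- A quadratic vector field tangent to both circles at an edge which vanishes at the point of contact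
is a real multiple of `(X - z)² / ω`. -/
theorem exists_eq_div_omega_smul {u v : V} (h : G.IsIntEdge u v) {x : Fin 3 → ℂ}
    (hu : x ∈ P.fields u) (hv : x ∈ P.fields v) (hx : quadEval (P.tangency s(u, v)) x = 0) :
    ∃ l : ℝ, x = ((l : ℂ) / P.omega h) •
      weierstrass (P.tangency s(u, v)) (P.tangency s(u, v)) := by
  rw [fields, P.center_eq u v] at hu
  rw [fields, P.center_eq' u v] at hv
  obtain ⟨k, hk⟩ := eq_smul_weierstrass_self (P.R_pos u) (P.R_pos v) (P.norm_dir h.1.adj) hu hv hx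
  refine ⟨k / P.kappa h, ?_⟩
  rw [P.div_omega, div_mul_cancel₀ _ (P.kappa_ne_zero h)]
  exact hk

end CirclePacking

/-! ### Closing conditions as vector equations, and quadratic interpolation. -/

section Interpolation

theorem sum_smul_weierstrass_eq_zero_iff {ι : Type*} (s : Finset ι) (α a b : ι → ℂ) :
    ∑ i ∈ s, α i • weierstrass (a i) (b i) = 0 ↔
      ∑ i ∈ s, α i = 0 ∧ ∑ i ∈ s, α i * (a i + b i) = 0 ∧ ∑ i ∈ s, α i * (a i * b i) = 0 := by
  have e0 : (∑ i ∈ s, α i • weierstrass (a i) (b i)) 0 =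
      ∑ i ∈ s, α i - ∑ i ∈ s, α i * (a i * b i) := by
    rw [Finset.sum_apply, ← Finset.sum_sub_distrib]
    refine Finset.sum_congr rfl fun i _ => ?_
    simp only [weierstrass, Pi.smul_apply, smul_eq_mul, Matrix.cons_val_zero]
    ring
  have e1 : (∑ i ∈ s, α i • weierstrass (a i) (b i)) 1 =
      Complex.I * (∑ i ∈ s, α i + ∑ i ∈ s, α i * (a i * b i)) := by
    rw [Finset.sum_apply, ← Finset.sum_add_distrib, Finset.mul_sum]
    refine Finset.sum_congr rfl fun i _ => ?_
    simp only [weierstrass, Pi.smul_apply, smul_eq_mul, Matrix.cons_val_one, Matrix.cons_val_zero]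
    ring
  have e2 : (∑ i ∈ s, α i • weierstrass (a i) (b i)) 2 = ∑ i ∈ s, α i * (a i + b i) := by
    rw [Finset.sum_apply]
    refine Finset.sum_congr rfl fun i _ => ?_
    simp [weierstrass]
  constructor
  · intro h
    rw [h, Pi.zero_apply] at e0 e1 e2
    have h1 := (mul_eq_zero.1 e1.symm).resolve_left Complex.I_ne_zero
    refine ⟨?_, e2.symm, ?_⟩
    · linear_combination (h1 - e0) / 2
    · linear_combination (h1 + e0) / 2
  · rintro ⟨h0, h1, h2⟩
    rw [h0, h2] at e0 e1
    rw [h1] at e2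
    ext i
    fin_cases i
    · simpa using e0
    · simpa using e1
    · simpa using e2

/-- Two scalar conditions suffice for the three coefficients: z₀ + z_j = (z_j - z₀) + 2z₀ relates
the linear coefficient to the sum of the weights, and z₀ z_j = z₀ (z₀ + z_j) - z₀² makes the
constant one redundant. -/
theorem sum_div_smul_weierstrass_eq_zero_iff {ι : Type*} {s : Finset ι} {q : ι → ℝ} {z₀ : ℂ}
    (z : ι → ℂ) (hz : ∀ j ∈ s, q j ≠ 0 → z j ≠ z₀) :
    ∑ j ∈ s, ((q j : ℂ) / (z j - z₀)) • weierstrass z₀ (z j) = 0 ↔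
      ∑ j ∈ s, q j = 0 ∧ ∑ j ∈ s, (q j : ℂ) / (z j - z₀) = 0 := by
  rw [sum_smul_weierstrass_eq_zero_iff]
  have e1 : ∑ j ∈ s, (q j : ℂ) / (z j - z₀) * (z₀ + z j) =
      ((∑ j ∈ s, q j : ℝ) : ℂ) + 2 * z₀ * ∑ j ∈ s, (q j : ℂ) / (z j - z₀) := by
    rw [Complex.ofReal_sum, Finset.mul_sum, ← Finset.sum_add_distrib]
    refine Finset.sum_congr rfl fun j hj => ?_
    by_cases hq : q j = 0
    · simp [hq]
    · have := sub_ne_zero.2 (hz j hj hq)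
      field_simp
      ring
  have e2 : ∑ j ∈ s, (q j : ℂ) / (z j - z₀) * (z₀ * z j) =
      z₀ * (∑ j ∈ s, (q j : ℂ) / (z j - z₀) * (z₀ + z j)) -
        z₀ ^ 2 * ∑ j ∈ s, (q j : ℂ) / (z j - z₀) := by
    rw [Finset.mul_sum, Finset.mul_sum, ← Finset.sum_sub_distrib]
    exact Finset.sum_congr rfl fun j _ => by ring
  constructor
  · rintro ⟨h1, h2, -⟩
    rw [h1, h2, mul_zero, add_zero] at e1
    exact ⟨by exact_mod_cast e1.symm, h1⟩
  · rintro ⟨h1, h2⟩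
    rw [h1, h2, Complex.ofReal_zero, mul_zero, add_zero] at e1
    rw [h2, e1, mul_zero, mul_zero, sub_zero] at e2
    exact ⟨h2, e1, e2⟩

/-- The quadratic polynomial which takes the values `h a`, `h b`, `h c` at `z a`, `z b`, `z c`. -/
noncomputable def interp {W : Type*} (z : W → ℂ) (a b c : W) : (W → ℂ) →ₗ[ℂ] (Fin 3 → ℂ) where
  toFun h := (h a / ((z a - z b) * (z a - z c))) • weierstrass (z b) (z c) +
    (h b / ((z b - z c) * (z b - z a))) • weierstrass (z c) (z a) +
    (h c / ((z c - z a) * (z c - z b))) • weierstrass (z a) (z b)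
  map_add' h h' := by
    simp only [Pi.add_apply, add_div, add_smul]
    abel
  map_smul' r h := by
    simp only [Pi.smul_apply, smul_eq_mul, RingHom.id_apply, smul_add, smul_smul, mul_div_assoc]

theorem quadEval_interp {W : Type*} {z : W → ℂ} {a b c : W} (hab : z a ≠ z b) (hbc : z b ≠ z c)
    (hca : z c ≠ z a) (h : W → ℂ) : quadEval (z a) (interp z a b c h) = h a ∧
      quadEval (z b) (interp z a b c h) = h b ∧ quadEval (z c) (interp z a b c h) = h c := by
  have h1 := sub_ne_zero.2 hab
  have h2 := sub_ne_zero.2 hbc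
  have h3 := sub_ne_zero.2 hca
  have h1' := sub_ne_zero.2 hab.symm
  have h2' := sub_ne_zero.2 hbc.symm
  have h3' := sub_ne_zero.2 hca.symm
  refine ⟨?_, ?_, ?_⟩ <;>
  · simp only [interp, LinearMap.coe_mk, AddHom.coe_mk, map_add, map_smul, quadEval_weierstrass,
      smul_eq_mul, sub_self, mul_zero, zero_mul, add_zero, zero_add]
    field_simp

end Interpolation

namespace TriMesh

variable {W : Type*} {T : TriMesh W} {z : W → ℂ}

/-- Interpolation of a function on the vertices by quadratic polynomials on the faces. -/
noncomputable def faceInterp (T : TriMesh W) (z : W → ℂ) : (W → ℂ) →ₗ[ℂ] (T.Face → Fin 3 → ℂ) :=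
  LinearMap.pi fun t =>
    have h := T.eq_tri _ t.2
    interp z h.choose h.choose_spec.choose h.choose_spec.choose_spec.choose

theorem ne_of_mem_face (hz : ∀ i j, T.graph.Adj i j → z i ≠ z j) {a b c : W}
    (h : tri a b c ∈ T.faces) : z a ≠ z b ∧ z b ≠ z c ∧ z c ≠ z a :=
  ⟨hz _ _ (DEdge.adj ⟨c, h⟩), hz _ _ (DEdge.adj ⟨a, tri_mem_rotate h⟩),
    hz _ _ (DEdge.adj ⟨b, tri_mem_rotate (tri_mem_rotate h)⟩)⟩

theorem quadEval_faceInterp (hz : ∀ i j, T.graph.Adj i j → z i ≠ z j) (h : W → ℂ) (t : T.Face)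
    {x : W} (hx : x ∈ t.1) : quadEval (z x) (T.faceInterp z h t) = h x := by
  obtain ⟨t, ht⟩ := t
  have h' := T.eq_tri _ ht
  have e : t = tri h'.choose h'.choose_spec.choose h'.choose_spec.choose_spec.choose :=
    h'.choose_spec.choose_spec.choose_spec.2.2.2
  have hd : T.faceInterp z h ⟨t, ht⟩ =
    interp z h'.choose h'.choose_spec.choose h'.choose_spec.choose_spec.choose h := rfl
  rw [hd]
  clear hd
  change x ∈ t at hx
  generalize h'.choose_spec.choose_spec.choose = c at *
  generalize h'.choose_spec.choose = b at *
  generalize h'.choose = a at *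
  subst e
  obtain ⟨h1, h2, h3⟩ := ne_of_mem_face hz ht
  obtain ⟨e1, e2, e3⟩ := quadEval_interp h1 h2 h3 h
  rcases mem_tri.1 hx with rfl | rfl | rfl <;> assumption

theorem face_ext_of_quadEval (hz : ∀ i j, T.graph.Adj i j → z i ≠ z j) (t : T.Face)
    {v v' : Fin 3 → ℂ} (h : ∀ x ∈ t.1, quadEval (z x) v = quadEval (z x) v') : v = v' := by
  obtain ⟨t, ht⟩ := t
  obtain ⟨a, b, c, -, -, -, rfl⟩ := T.eq_tri _ ht
  obtain ⟨h1, h2, h3⟩ := ne_of_mem_face hz ht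
  refine sub_eq_zero.1 (eq_zero_of_quadEval h1 h2 h3 ?_ ?_ ?_) <;>
    rw [map_sub, sub_eq_zero] <;> exact h _ (mem_tri.2 (by simp))

/-- The differential `q` of a map on the faces, as read off from the Weierstrass formula. -/
noncomputable def quadDiff (T : TriMesh W) (z : W → ℂ) :
    (T.Face → Fin 3 → ℂ) →ₗ[ℝ] (T.IntEdge → ℝ) where
  toFun F e := ((z e.tgt - z e.src) * quadLead (F e.isIntEdge.left - F e.isIntEdge.right)).re
  map_add' F F' := by
    ext e
    simp only [Pi.add_apply, add_sub_add_comm, map_add, mul_add, Complex.add_re]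
  map_smul' r F := by
    ext e
    simp only [Pi.smul_apply, RingHom.id_apply, ← smul_sub, ← Complex.coe_smul r, map_smul]
    rw [smul_eq_mul, smul_eq_mul, mul_left_comm, Complex.re_ofReal_mul]

/-- Reversing an edge changes the sign of both factors, so the orientation chosen in `quadDiff` is
irrelevant. -/
theorem quadDiff_apply (F : T.Face → Fin 3 → ℂ) {i j : W} (h : T.IsIntEdge i j) :
    T.quadDiff z F h.edge = ((z j - z i) * quadLead (F h.left - F h.right)).re := by
  have key : ∀ (e : T.IntEdge) (a b : W) (h : T.IsIntEdge a b), e.src = a → e.tgt = b →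
      T.quadDiff z F e = ((z b - z a) * quadLead (F h.left - F h.right)).re := by
    rintro e a b h rfl rfl
    rfl
  obtain ⟨h1, h2⟩ | ⟨h1, h2⟩ := IntEdge.src_tgt_edge h
  · exact key _ _ _ h h1 h2
  · rw [key _ _ _ h.symm h1 h2, h.symm_left, h.symm_right, ← neg_sub (F h.left), map_neg,
      mul_neg, ← neg_mul, neg_sub]

end TriMesh

open TriMesh

section Closing

variable {V : Type*} {G : TriMesh V}

theorem isKoebeHQD_iff [Finite V] (P : CirclePacking G) (l : G.IntEdge → ℝ) : IsKoebeHQD P l ↔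
    ∀ u, G.IsIntVertex u → ∑ v : G.IntNbr u, ((l v.2.edge : ℂ) / P.omega v.2) •
      weierstrass (P.tangency s(u, v.1)) (P.tangency s(u, v.1)) = 0 := by
  refine forall₂_congr fun u _ => ?_
  rw [sum_smul_weierstrass_eq_zero_iff]
  simp only [← two_mul, ← sq, mul_left_comm _ (2 : ℂ), ← Finset.mul_sum, mul_eq_zero,
    OfNat.ofNat_ne_zero, false_or]

theorem isKoebeRealization_iff {P : CirclePacking G} {l : G.IntEdge → ℝ}
    {F : G.Face → Fin 3 → ℂ} : IsKoebeRealization P l F ↔ ∀ (u v : V) (h : G.IsIntEdge u v),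
      F h.left - F h.right = ((l h.edge : ℂ) / P.omega h) •
        weierstrass (P.tangency s(u, v)) (P.tangency s(u, v)) := by
  simp only [weierstrass_self]
  rfl

theorem isGeneralHQD_iff [Finite V] (T : TriMesh V) (z : V → ℂ)
    (hz : ∀ i j, T.graph.Adj i j → z i ≠ z j) (q : T.IntEdge → ℝ) : IsGeneralHQD T z q ↔
    ∀ i, T.IsIntVertex i → ∑ j : T.IntNbr i, ((q j.2.edge : ℂ) / (z j.1 - z i)) •
      weierstrass (z i) (z j.1) = 0 := by
  refine forall₂_congr fun i _ => ?_
  rw [sum_div_smul_weierstrass_eq_zero_iff _ fun j _ _ => (hz _ _ j.2.1.adj).symm]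

/-- A map on the faces which satisfies the Weierstrass formula for `q` exists only for holomorphic
quadratic differentials `q`. -/
theorem IsGeneralRealization.isGeneralHQD [Finite V] {T : TriMesh V} {z : V → ℂ}
    (hz : ∀ i j, T.graph.Adj i j → z i ≠ z j) {q : T.IntEdge → ℝ} {F : T.Face → Fin 3 → ℂ}
    (hF : IsGeneralRealization T z q F) : IsGeneralHQD T z q := by
  rw [isGeneralHQD_iff T z hz]
  intro i hi
  rw [← sum_left_sub_right hi F]
  exact Finset.sum_congr rfl fun j _ => (hF _ _ j.2).symm

end Closing

/-! ### From Koebe type to general type. -/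

section Extension

variable {V : Type*} {G : TriMesh V} {T : TriMesh (Sym2 V)}

/-- `i` is an edge of the face `f`. -/
def TriMesh.EdgeOf (f : G.Face) (i : Sym2 V) : Prop := ∃ u v w, f.1 = tri u v w ∧ i = s(u, v)

open Classical in
/-- The values at the points `z i` of the quadratic polynomials on the faces at the edges `i`. -/
noncomputable def TriMesh.edgeValue (G : TriMesh V) (z : Sym2 V → ℂ) :
    (G.Face → Fin 3 → ℂ) →ₗ[ℂ] (Sym2 V → ℂ) where
  toFun F i := if h : ∃ f : G.Face, EdgeOf f i then quadEval (z i) (F h.choose) else 0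
  map_add' F F' := by
    ext i
    by_cases h : ∃ f : G.Face, EdgeOf f i <;> simp [h]
  map_smul' r F := by
    ext i
    by_cases h : ∃ f : G.Face, EdgeOf f i <;> simp [h]

/-- The two faces at an edge i differ by a multiple of (X - z_i)², which vanishes at z_i. So the
arbitrary choice of a face in `edgeValue` does not matter. -/
theorem edgeValue_eq {P : CirclePacking G} {l : G.IntEdge → ℝ} {F : G.Face → Fin 3 → ℂ}
    (hF : IsKoebeRealization P l F) {f : G.Face} {i : Sym2 V} (hi : EdgeOf f i) :
    G.edgeValue P.tangency F i = quadEval (P.tangency i) (F f) := by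
  have h : ∃ f : G.Face, EdgeOf f i := ⟨f, hi⟩
  have e : G.edgeValue P.tangency F i = quadEval (P.tangency i) (F h.choose) := dif_pos h
  rw [e]
  have hi' := h.choose_spec
  generalize h.choose = f' at *
  obtain ⟨u, v, w, h1, rfl⟩ := hi
  obtain ⟨u', v', w', h2, hi⟩ := hi'
  obtain ⟨f, hf⟩ := f
  obtain ⟨f', hf'⟩ := f'
  dsimp only at h1 h2
  subst h1 h2
  rcases Sym2.eq_iff.1 hi with ⟨rfl, rfl⟩ | ⟨rfl, rfl⟩
  · obtain rfl := G.unique_left _ _ _ _ hf hf'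
    rfl
  · have hint : G.IsIntEdge u v := ⟨⟨w, hf⟩, ⟨w', hf'⟩⟩
    have := isKoebeRealization_iff.1 hF _ _ hint
    rw [hint.left_eq hf, hint.right_eq hf'] at this
    rw [eq_comm, ← sub_eq_zero, ← map_sub, this, map_smul, quadEval_weierstrass, sub_self,
      zero_mul, smul_zero]

/-- The polygon of another vertex cannot contain this edge, by `Sym2.eq_of_common`. A medial
triangle that contains it comes from a face with a corner at u. -/
theorem TriMesh.MedialData.face_at {w : V → List V} {cyc : V → Prop}
    {S : V → Set (Cycle (Sym2 V))} (M : MedialData G T w cyc S) (hT : G.IsMedialTriangulation T)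
    {u a b : V} (hab : a ≠ b) {k : Sym2 V} (h : tri s(u, a) s(u, b) k ∈ T.faces) :
    tri s(u, a) s(u, b) k ∈ S u ∨ ∃ f : G.Face, u ∈ f.1 ∧ medialFace hT f = ⟨_, h⟩ := by
  rcases (M.mem_faces _).1 h with ⟨x, y, z, hf, e⟩ | ⟨u', hu'⟩
  · right
    refine ⟨⟨_, hf⟩, ?_, by rw [medialFace_eq]; exact Subtype.ext e.symm⟩
    refine mem_tri.2 ?_
    rcases tri_eq_iff.1 e with ⟨h1, h2, -⟩ | ⟨h1, h2, -⟩ | ⟨h1, h2, -⟩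
    · exact Or.inr (Or.inl (Sym2.eq_of_common hab (h1.trans Sym2.eq_swap) h2).1)
    · exact Or.inr (Or.inr (Sym2.eq_of_common hab (h1.trans Sym2.eq_swap) h2).1)
    · exact Or.inl (Sym2.eq_of_common hab (h1.trans Sym2.eq_swap) h2).1
  · left
    obtain ⟨a', -, ha⟩ := M.exists_of_mem hu' (mem_tri.2 (Or.inl rfl))
    obtain ⟨b', -, hb⟩ := M.exists_of_mem hu' (mem_tri.2 (Or.inr (Or.inl rfl)))
    obtain ⟨rfl, -, -⟩ := Sym2.eq_of_common hab ha hb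
    exact hu'

/-- A Weierstrass realization of Koebe type extends to one of general type. -/
theorem IsKoebeRealization.extend (hT : G.IsMedialTriangulation T) {P : CirclePacking G}
    (hz : ∀ i j, T.graph.Adj i j → P.tangency i ≠ P.tangency j) {l : G.IntEdge → ℝ}
    {F : G.Face → Fin 3 → ℂ} (hF : IsKoebeRealization P l F) :
    (∀ f, T.faceInterp P.tangency (G.edgeValue P.tangency F) (medialFace hT f) = F f) ∧
    IsGeneralRealization T P.tangency
      (T.quadDiff P.tangency (T.faceInterp P.tangency (G.edgeValue P.tangency F)))
      (T.faceInterp P.tangency (G.edgeValue P.tangency F)) := by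
  obtain ⟨w, cyc, S, M⟩ := hT.exists_data
  set h := G.edgeValue P.tangency F with hh
  set F' := T.faceInterp P.tangency h with hF'
  have hev : ∀ (t : T.Face) (x : Sym2 V), x ∈ t.1 → quadEval (P.tangency x) (F' t) = h x :=
    fun t x hx => quadEval_faceInterp hz h t hx
  have hmed : ∀ f, F' (medialFace hT f) = F f := by
    rintro ⟨f, hf⟩
    refine face_ext_of_quadEval hz (medialFace hT ⟨f, hf⟩) fun x hx => ?_
    rw [hev _ _ hx]
    apply edgeValue_eq hF
    obtain ⟨a, b, c, -, -, -, rfl⟩ := G.eq_tri _ hf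
    rw [medialFace_eq] at hx
    rcases mem_tri.1 hx with rfl | rfl | rfl
    · exact ⟨a, b, c, rfl, rfl⟩
    · exact ⟨b, c, a, tri_rotate _ _ _, rfl⟩
    · exact ⟨c, a, b, (tri_rotate _ _ _).trans (tri_rotate _ _ _), rfl⟩
  refine ⟨hmed, fun i j hij => ?_⟩
  obtain ⟨u, a, b, hab, ha, hb, rfl, rfl⟩ := M.exists_of_dEdge hij.1
  -- Work modulo the fields tangent to C_u: crossing an edge at u changes F by such a field, so F is
  -- constant around u in the quotient.
  have hmod : ∀ f f' : G.Face, u ∈ f.1 → u ∈ f'.1 → F f - F f' ∈ P.fields u := by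
    intro f f' hf hf'
    have := (M.link u).const_at_vertex (g := fun f => (P.fields u).mkQ (F f))
      (fun x y hxy hx => by
        subst hx
        rw [← sub_eq_zero, ← map_sub, isKoebeRealization_iff.1 hF _ _ hxy]
        exact (Submodule.Quotient.mk_eq_zero _).2 (P.div_omega_smul_mem hxy _)) hf hf'
    exact (Submodule.Quotient.eq _).1 this
  obtain ⟨f₀, hf₀⟩ : ∃ f₀ : G.Face, u ∈ f₀.1 := by
    obtain ⟨-, h | h⟩ := (M.link u).mem_iff_adj.1 ha <;> obtain ⟨y, hy⟩ := h
    · exact ⟨⟨_, hy⟩, mem_tri.2 (by simp)⟩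
    · exact ⟨⟨_, hy⟩, mem_tri.2 (by simp)⟩
  -- At each of its corners, which lie on C_u, a polygon triangle takes the value of F on some face
  -- around u. It therefore differs from F f₀ tangentially at three points, hence everywhere.
  have hnear : ∀ t : T.Face, (t.1 ∈ S u ∨ ∃ f : G.Face, u ∈ f.1 ∧ medialFace hT f = t) →
      F' t - F f₀ ∈ P.fields u := by
    rintro t (ht | ⟨f, hf, rfl⟩)
    · have hval : ∀ x ∈ t.1, ‖P.tangency x - P.c u‖ = P.R u ∧
          (quadEval (P.tangency x) (F' t - F f₀) * conj (P.tangency x - P.c u)).re = 0 := by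
        intro x hx
        obtain ⟨y, hy, rfl⟩ := M.exists_of_mem ht hx
        have hadj := (M.link u).mem_iff_adj.1 hy
        have hnorm := P.norm_tangency_sub hadj
        refine ⟨hnorm, ?_⟩
        obtain ⟨f, hf, hfy⟩ : ∃ f : G.Face, u ∈ f.1 ∧ EdgeOf f s(u, y) := by
          obtain ⟨-, ⟨k, hk⟩ | ⟨k, hk⟩⟩ := hadj
          · exact ⟨⟨_, hk⟩, mem_tri.2 (by simp), u, y, k, rfl, rfl⟩
          · exact ⟨⟨_, hk⟩, mem_tri.2 (by simp), y, u, k, rfl, Sym2.eq_swap⟩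
        rw [map_sub, hev _ _ hx, hh, edgeValue_eq hF hfy, ← map_sub]
        exact hmod f f₀ hf hf₀ _ hnorm
      obtain ⟨t, ht'⟩ := t
      obtain ⟨x, y, k, -, -, -, rfl⟩ := T.eq_tri _ ht'
      obtain ⟨h1, h2, h3⟩ := ne_of_mem_face hz ht'
      have hx := hval x (mem_tri.2 (by simp))
      have hy := hval y (mem_tri.2 (by simp))
      have hk := hval k (mem_tri.2 (by simp))
      exact mem_tangentFields_of_three (P.R_pos u) h1 h2 h3 hx.1 hy.1 hk.1 hx.2 hy.2 hk.2
    · rw [hmed]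
      exact hmod _ _ hf hf₀
  have hleft : F' hij.left - F f₀ ∈ P.fields u :=
    hnear _ (M.face_at hT hab hij.leftApex_mem)
  have hright : F' hij.right - F f₀ ∈ P.fields u :=
    hnear _ (M.face_at hT hab.symm hij.rightApex_mem)
  have hdiff : F' hij.left - F' hij.right ∈ P.fields u := by
    have := sub_mem hleft hright
    rwa [sub_sub_sub_cancel_right] at this
  have hne := hz _ _ hij.1.adj
  -- Both sides interpolate the same values at the two end points, so the jump vanishes there.
  have heq : F' hij.left - F' hij.right = quadLead (F' hij.left - F' hij.right) •
      weierstrass (P.tangency s(u, a)) (P.tangency s(u, b)) := by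
    refine eq_smul_weierstrass hne ?_ ?_
    · rw [map_sub, hev _ _ hij.mem_left.1, hev _ _ hij.mem_right.1, sub_self]
    · rw [map_sub, hev _ _ hij.mem_left.2, hev _ _ hij.mem_right.2, sub_self]
  have him := im_eq_zero_of_smul_weierstrass_mem (P.R_pos u) hne
    (P.norm_tangency_sub ((M.link u).mem_iff_adj.1 ha))
    (P.norm_tangency_sub ((M.link u).mem_iff_adj.1 hb)) (heq ▸ hdiff)
  have hreal : ((T.quadDiff P.tangency F' hij.edge : ℝ) : ℂ) =
      (P.tangency s(u, b) - P.tangency s(u, a)) * quadLead (F' hij.left - F' hij.right) := by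
    rw [quadDiff_apply]
    rw [mul_comm] at him
    exact Complex.ext rfl (by rw [Complex.ofReal_im, him])
  change _ = _ • weierstrass _ _
  rw [hreal, mul_div_cancel_left₀ _ (sub_ne_zero.2 hne.symm)]
  exact heq

open Classical in
/-- The components of the Weierstrass data of Koebe type, as functions on oriented edges. -/
noncomputable def CirclePacking.koebeForm (P : CirclePacking G) (k : Fin 3) :
    (G.IntEdge → ℝ) →ₗ[ℝ] (V → V → ℂ) where
  toFun l u v := if h : G.IsIntEdge u v then
    (l h.edge : ℂ) / P.omega h * weierstrass (P.tangency s(u, v)) (P.tangency s(u, v)) k else 0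
  map_add' l l' := by
    ext u v
    by_cases h : G.IsIntEdge u v
    · simp only [h, dif_pos, Pi.add_apply, Complex.ofReal_add]
      ring
    · simp [h]
  map_smul' r l := by
    ext u v
    by_cases h : G.IsIntEdge u v
    · simp only [h, dif_pos, Pi.smul_apply, smul_eq_mul, RingHom.id_apply, Complex.ofReal_mul,
        Complex.real_smul]
      ring
    · simp [h]

theorem CirclePacking.koebeForm_apply (P : CirclePacking G) (k : Fin 3) (l : G.IntEdge → ℝ)
    {u v : V} (h : G.IsIntEdge u v) : P.koebeForm k l u v = (l h.edge : ℂ) / P.omega h *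
      weierstrass (P.tangency s(u, v)) (P.tangency s(u, v)) k := dif_pos h

/-- On a triangulated disk a differential of Koebe type has a Weierstrass realization which depends
linearly on it. -/
theorem exists_koebeRealization [Finite V] (hG : G.IsDisk) (P : CirclePacking G) :
    ∃ Λ : (G.IntEdge → ℝ) →ₗ[ℝ] (G.Face → Fin 3 → ℂ),
      ∀ l, IsKoebeHQD P l → IsKoebeRealization P l (Λ l) := by
  obtain ⟨s, hs⟩ := hG.exists_primitive
  let Λ : (G.IntEdge → ℝ) →ₗ[ℝ] (G.Face → Fin 3 → ℂ) :=
    { toFun := fun l f k => s (P.koebeForm k l) f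
      map_add' := fun l l' => by
        ext f k
        simp only [map_add, Pi.add_apply]
      map_smul' := fun r l => by
        ext f k
        simp only [map_smul, Pi.smul_apply, RingHom.id_apply]
        rw [← Complex.coe_smul r, map_smul, Pi.smul_apply, Complex.coe_smul] }
  refine ⟨Λ, fun l hl => isKoebeRealization_iff.2 fun u v h => ?_⟩
  rw [isKoebeHQD_iff] at hl
  ext k
  refine (hs (P.koebeForm k l) ?_ ?_ u v h).trans (P.koebeForm_apply k l h)
  · intro u v h
    rw [P.koebeForm_apply k l h, P.koebeForm_apply k l h.symm, h.symm_edge, P.omega_symm h,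
      Sym2.eq_swap (a := v), div_neg, neg_mul]
  · intro u hu
    have := congrFun (hl u hu) k
    rw [Finset.sum_apply] at this
    rw [← Pi.zero_apply (M := fun _ : Fin 3 => ℂ) k, ← this]
    exact Finset.sum_congr rfl fun v _ => P.koebeForm_apply k l v.2

/-- The linear map from the differentials of Koebe type to those of general type, together with the
extension of Weierstrass realizations. -/
theorem exists_extension [Finite V] (hG : G.IsDisk) (hT : G.IsMedialTriangulation T) (P : CirclePacking G)
    (hz : ∀ i j, T.graph.Adj i j → P.tangency i ≠ P.tangency j) :
    ∃ Λ : (G.IntEdge → ℝ) →ₗ[ℝ] (T.IntEdge → ℝ), ∀ l, IsKoebeHQD P l →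
      ∃ F F', IsKoebeRealization P l F ∧ IsGeneralRealization T P.tangency (Λ l) F' ∧
        ∀ f, F' (medialFace hT f) = F f := by
  obtain ⟨Λ, hΛ⟩ := exists_koebeRealization hG P
  refine ⟨T.quadDiff P.tangency ∘ₗ (T.faceInterp P.tangency).restrictScalars ℝ ∘ₗ
    (G.edgeValue P.tangency).restrictScalars ℝ ∘ₗ Λ, fun l hl => ?_⟩
  obtain ⟨h1, h2⟩ := (hΛ l hl).extend hT hz
  exact ⟨_, _, hΛ l hl, h2, h1⟩

/-- Realizations of the same differential of general type agree on the medial triangles up to a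
translation. -/
theorem IsGeneralRealization.sub_const (hG : G.graph.Connected) (hT : G.IsMedialTriangulation T)
    {z : Sym2 V → ℂ} {q : T.IntEdge → ℝ} {F F' : T.Face → Fin 3 → ℂ}
    (hF : IsGeneralRealization T z q F) (hF' : IsGeneralRealization T z q F') (f f' : G.Face) :
    F (medialFace hT f) - F' (medialFace hT f) = F (medialFace hT f') - F' (medialFace hT f') :=
  const_on_medialFaces hT hG (fun t => F t - F' t) (fun i j h => by
    rw [sub_eq_sub_iff_sub_eq_sub, hF i j h, hF' i j h]) f f'

theorem IsKoebeRealization.sub_const (hG : G.IsDisk) {P : CirclePacking G} {l : G.IntEdge → ℝ}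
    {F F' : G.Face → Fin 3 → ℂ} (hF : IsKoebeRealization P l F) (hF' : IsKoebeRealization P l F')
    (f f' : G.Face) : F f - F' f = F f' - F' f' :=
  hG.const_of_left_eq_right (fun t => F t - F' t) (fun i j h => by
    rw [sub_eq_sub_iff_sub_eq_sub, hF i j h, hF' i j h]) f f'

/-- A differential of Koebe type whose realization extends to a realization of zero is zero. -/
theorem IsKoebeRealization.eq_zero (hG : G.IsDisk) (hT : G.IsMedialTriangulation T)
    {P : CirclePacking G} {l : G.IntEdge → ℝ} {z : Sym2 V → ℂ} {F : G.Face → Fin 3 → ℂ}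
    {F' : T.Face → Fin 3 → ℂ} (hF : IsKoebeRealization P l F)
    (hF' : IsGeneralRealization T z 0 F') (h : ∀ f, F' (medialFace hT f) = F f) : l = 0 := by
  -- The zero map also realizes the zero differential, so F' is constant on the medial triangles and
  -- F has no jumps.
  have hF0 : IsGeneralRealization T z 0 0 := fun i j h => by simp
  have hconst : ∀ f f', F f = F f' := fun f f' => by
    have := hF'.sub_const hG.connected hT hF0 f f'
    simpa [h] using this
  ext e
  have := isKoebeRealization_iff.1 hF _ _ e.isIntEdge
  rw [hconst _ e.isIntEdge.right, sub_self] at this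
  have h1 := congrArg quadLead this
  rw [map_zero, map_smul, quadLead_weierstrass, smul_eq_mul, mul_one, e.edge_isIntEdge] at h1
  have h2 := (div_eq_zero_iff.1 h1.symm).resolve_right (P.omega_ne_zero _)
  exact_mod_cast h2

end Extension

/-! ### From general type to Koebe type. -/

namespace TriMesh

variable {V : Type*} {G : TriMesh V} {T : TriMesh (Sym2 V)}

section Weight

variable {W : Type*} {T : TriMesh W}

theorem adj_of_mem_face {t : Cycle W} (ht : t ∈ T.faces) {x y : W} (hx : x ∈ t) (hy : y ∈ t)
    (hxy : x ≠ y) : T.graph.Adj x y := by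
  obtain ⟨a, b, c, -, -, -, rfl⟩ := T.eq_tri _ ht
  have h1 : T.graph.Adj a b := DEdge.adj ⟨c, ht⟩
  have h2 : T.graph.Adj b c := DEdge.adj ⟨a, tri_mem_rotate ht⟩
  have h3 : T.graph.Adj c a := DEdge.adj ⟨b, tri_mem_rotate (tri_mem_rotate ht)⟩
  rcases mem_tri.1 hx with rfl | rfl | rfl <;> rcases mem_tri.1 hy with rfl | rfl | rfl <;>
    first
    | exact absurd rfl hxy
    | assumption
    | exact SimpleGraph.Adj.symm (by assumption)

open Classical in
/-- The weight of the edge between two vertices, which is zero if there is no such interior edge. -/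
noncomputable def weight (q : T.IntEdge → ℝ) (i j : W) : ℝ :=
  if h : T.IsIntEdge i j then q h.edge else 0

theorem weight_eq (q : T.IntEdge → ℝ) {i j : W} (h : T.IsIntEdge i j) :
    weight q i j = q h.edge := dif_pos h

theorem isIntEdge_of_weight {q : T.IntEdge → ℝ} {i j : W} (h : weight q i j ≠ 0) :
    T.IsIntEdge i j := by
  by_contra h'
  exact h (dif_neg h')

theorem weight_symm (q : T.IntEdge → ℝ) (i j : W) : weight q i j = weight q j i := by
  by_cases h : T.IsIntEdge i j
  · rw [weight_eq q h, weight_eq q h.symm, h.symm_edge]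
  · have h' : ¬ T.IsIntEdge j i := fun e => h e.symm
    rw [weight, weight, dif_neg h, dif_neg h']

theorem weight_self (q : T.IntEdge → ℝ) (i : W) : weight q i i = 0 := by
  by_contra h
  exact (isIntEdge_of_weight h).1.ne rfl

theorem weight_add (q q' : T.IntEdge → ℝ) (i j : W) :
    weight (q + q') i j = weight q i j + weight q' i j := by
  by_cases h : T.IsIntEdge i j
  · simp only [weight_eq _ h, Pi.add_apply]
  · simp [weight, h]

theorem weight_smul (r : ℝ) (q : T.IntEdge → ℝ) (i j : W) :
    weight (r • q) i j = r * weight q i j := by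
  by_cases h : T.IsIntEdge i j
  · simp only [weight_eq _ h, Pi.smul_apply, smul_eq_mul]
  · simp [weight, h]

/-- The term of the Weierstrass formula of general type at an oriented edge. -/
noncomputable def edgeTerm (z : W → ℂ) (i j : W) : (T.IntEdge → ℝ) →ₗ[ℝ] (Fin 3 → ℂ) where
  toFun q := ((weight q i j : ℂ) / (z j - z i)) • weierstrass (z i) (z j)
  map_add' q q' := by
    rw [weight_add, Complex.ofReal_add, add_div, add_smul]
  map_smul' r q := by
    rw [weight_smul, Complex.ofReal_mul, mul_div_assoc, mul_smul]
    rfl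

theorem edgeTerm_apply (z : W → ℂ) (i j : W) (q : T.IntEdge → ℝ) :
    edgeTerm z i j q = ((weight q i j : ℂ) / (z j - z i)) • weierstrass (z i) (z j) := rfl

theorem edgeTerm_swap (z : W → ℂ) (i j : W) (q : T.IntEdge → ℝ) :
    edgeTerm z j i q = -edgeTerm z i j q := by
  rw [edgeTerm_apply, edgeTerm_apply, weight_symm, weierstrass_comm, ← neg_smul, ← div_neg,
    neg_sub]

theorem quadEval_edgeTerm (z : W → ℂ) (i j : W) (q : T.IntEdge → ℝ) :
    quadEval (z i) (edgeTerm z i j q) = 0 := by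
  rw [edgeTerm_apply, map_smul, quadEval_weierstrass, sub_self, zero_mul, smul_zero]

theorem edgeTerm_eq_zero (z : W → ℂ) {i j : W} {q : T.IntEdge → ℝ} (h : weight q i j = 0) :
    edgeTerm z i j q = 0 := by
  rw [edgeTerm_apply, h, Complex.ofReal_zero, zero_div, zero_smul]

theorem sum_edgeTerm_eq_zero [Fintype W] {z : W → ℂ} (hz : ∀ i j, T.graph.Adj i j → z i ≠ z j)
    {q : T.IntEdge → ℝ} (hq : IsGeneralHQD T z q) {i : W} (hi : T.IsIntVertex i) :
    ∑ j, edgeTerm z i j q = 0 := by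
  rw [isGeneralHQD_iff T z hz] at hq
  rw [← hq i hi]
  symm
  refine Fintype.sum_of_injective (fun j : T.IntNbr i => j.1) Subtype.val_injective _ _ ?_ ?_
  · intro j hj
    apply edgeTerm_eq_zero
    by_contra h
    exact hj ⟨⟨j, isIntEdge_of_weight h⟩, rfl⟩
  · intro j
    rw [edgeTerm_apply, weight_eq q j.2]

end Weight

variable [Fintype V]

noncomputable instance : Fintype (Sym2 V) := Fintype.ofFinite _

open Classical in
/-- The sum of the terms of the Weierstrass formula of general type over those edges at the vertex `i`
which belong to the polygon at `u`. -/
noncomputable def polygonSum (z : Sym2 V → ℂ) (u : V) (i : Sym2 V) :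
    (T.IntEdge → ℝ) →ₗ[ℝ] (Fin 3 → ℂ) :=
  ∑ j with u ∈ j, edgeTerm z i j

theorem polygonSum_apply [DecidableEq V] (z : Sym2 V → ℂ) (u : V) (i : Sym2 V)
    (q : T.IntEdge → ℝ) : polygonSum z u i q = ∑ j with u ∈ j, edgeTerm z i j q := by
  classical
  rw [polygonSum, LinearMap.sum_apply]
  congr!

/-- The differential of Koebe type which corresponds to one of general type. -/
noncomputable def toKoebe (P : CirclePacking G) (T : TriMesh (Sym2 V)) :
    (T.IntEdge → ℝ) →ₗ[ℝ] (G.IntEdge → ℝ) where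
  toFun q e := (P.omega e.isIntEdge *
    quadLead (polygonSum P.tangency e.src s(e.src, e.tgt) q)).re
  map_add' q q' := by
    ext e
    rw [map_add, map_add, mul_add, Complex.add_re]
    rfl
  map_smul' r q := by
    ext e
    rw [map_smul, ← Complex.coe_smul r, map_smul, smul_eq_mul, mul_left_comm,
      Complex.re_ofReal_mul]
    rfl

theorem quadEval_polygonSum (z : Sym2 V → ℂ) (u : V) (i : Sym2 V) (q : T.IntEdge → ℝ) :
    quadEval (z i) (polygonSum z u i q) = 0 := by
  classical
  rw [polygonSum_apply, map_sum]
  exact Finset.sum_eq_zero fun j _ => quadEval_edgeTerm z i j q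

namespace MedialData

variable {w : V → List V} {cyc : V → Prop} {S : V → Set (Cycle (Sym2 V))}
  {P : CirclePacking G}

omit [Fintype V] in
theorem exists_eq_of_mem (M : MedialData G T w cyc S) {u : V} {i j : Sym2 V} (h : T.DEdge i j)
    (hi : u ∈ i) (hj : u ∈ j) :
    ∃ a b, a ≠ b ∧ a ∈ w u ∧ b ∈ w u ∧ i = s(u, a) ∧ j = s(u, b) := by
  obtain ⟨x, a, b, hab, ha, hb, rfl, rfl⟩ := M.exists_of_dEdge h
  obtain rfl : u = x := by
    rcases Sym2.mem_iff.1 hi with h | rfl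
    · exact h
    · exact (Sym2.mem_iff.1 hj).resolve_right hab
  exact ⟨a, b, hab, ha, hb, rfl, rfl⟩

/-- Both end points of every edge in the polygon at u lie on C_u, so each summand is tangent to C_u.
-/
theorem polygonSum_mem (M : MedialData G T w cyc S)
    (hz : ∀ i j, T.graph.Adj i j → P.tangency i ≠ P.tangency j) {u : V} {i : Sym2 V} (hi : u ∈ i)
    (q : T.IntEdge → ℝ) : polygonSum P.tangency u i q ∈ P.fields u := by
  classical
  rw [polygonSum_apply]
  refine sum_mem fun j hj => ?_
  by_cases h : weight q i j = 0
  · rw [edgeTerm_eq_zero _ h]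
    exact zero_mem _
  · have hij := isIntEdge_of_weight h
    obtain ⟨a, b, -, ha, hb, rfl, rfl⟩ := M.exists_eq_of_mem hij.1 hi (Finset.mem_filter.1 hj).2
    exact smul_weierstrass_mem_tangentFields (hz _ _ hij.1.adj)
      (P.norm_tangency_sub ((M.link u).mem_iff_adj.1 ha))
      (P.norm_tangency_sub ((M.link u).mem_iff_adj.1 hb)) _

/-- Every edge of T at the vertex {uv} lies in exactly one of the polygons at u and v, so the two
partial sums make up the closing condition at {uv}. -/
theorem polygonSum_add_polygonSum (M : MedialData G T w cyc S) {z : Sym2 V → ℂ}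
    (hz : ∀ i j, T.graph.Adj i j → z i ≠ z j) {q : T.IntEdge → ℝ} (hq : IsGeneralHQD T z q)
    {u v : V} (h : G.IsIntEdge u v) :
    polygonSum z u s(u, v) q + polygonSum z v s(u, v) q = 0 := by
  classical
  have huv := h.1.ne
  rw [← sum_edgeTerm_eq_zero hz hq (M.isIntVertex h), polygonSum_apply, polygonSum_apply,
    Finset.sum_filter, Finset.sum_filter, ← Finset.sum_add_distrib]
  refine Finset.sum_congr rfl fun j _ => ?_
  by_cases hw : weight q s(u, v) j = 0
  · simp [edgeTerm_eq_zero _ hw]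
  · obtain ⟨x, a, b, hab, -, -, hi, rfl⟩ := M.exists_of_dEdge (isIntEdge_of_weight hw).1
    rcases Sym2.eq_iff.1 hi with ⟨rfl, rfl⟩ | ⟨rfl, rfl⟩
    · have : v ∉ s(u, b) := by
        rw [Sym2.mem_iff]
        rintro (h | h)
        · exact huv h.symm
        · exact hab h
      simp [this]
    · have : u ∉ s(v, b) := by
        rw [Sym2.mem_iff]
        rintro (h | h)
        · exact huv h
        · exact hab h
      simp [this]

/-- The partial sums at u and v are opposite, so each of them is tangent to both circles and
vanishes at their contact point. That leaves only real multiples of (X - z)²/ω. -/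
theorem polygonSum_eq (M : MedialData G T w cyc S)
    (hz : ∀ i j, T.graph.Adj i j → P.tangency i ≠ P.tangency j) {q : T.IntEdge → ℝ}
    (hq : IsGeneralHQD T P.tangency q) {u v : V} (h : G.IsIntEdge u v) :
    polygonSum P.tangency u s(u, v) q = ((toKoebe P T q h.edge : ℂ) / P.omega h) •
      weierstrass (P.tangency s(u, v)) (P.tangency s(u, v)) := by
  have key : ∀ (e : G.IntEdge) (a b : V) (h : G.IsIntEdge a b), e.src = a → e.tgt = b →
      polygonSum P.tangency a s(a, b) q = ((toKoebe P T q e : ℂ) / P.omega h) •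
        weierstrass (P.tangency s(a, b)) (P.tangency s(a, b)) := by
    rintro e a b h rfl rfl
    have hsum := M.polygonSum_add_polygonSum hz hq h
    have hv : polygonSum P.tangency e.src s(e.src, e.tgt) q ∈ P.fields e.tgt := by
      rw [eq_neg_of_add_eq_zero_left hsum]
      exact neg_mem (M.polygonSum_mem hz (Sym2.mem_mk_right _ _) q)
    obtain ⟨l, hl⟩ := P.exists_eq_div_omega_smul h
      (M.polygonSum_mem hz (Sym2.mem_mk_left _ _) q) hv (quadEval_polygonSum _ _ _ _)
    have : toKoebe P T q e = l := by
      change (P.omega h * quadLead (polygonSum P.tangency e.src s(e.src, e.tgt) q)).re = l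
      rw [hl, map_smul, quadLead_weierstrass, smul_eq_mul, mul_one,
        mul_div_cancel₀ _ (P.omega_ne_zero h), Complex.ofReal_re]
    rw [this]
    exact hl
  obtain ⟨h1, h2⟩ | ⟨h1, h2⟩ := IntEdge.src_tgt_edge h
  · exact key _ _ _ h h1 h2
  · have := key _ _ _ h.symm h1 h2
    have hsum := M.polygonSum_add_polygonSum hz hq h
    rw [eq_neg_of_add_eq_zero_left hsum, Sym2.eq_swap (a := u), this, P.omega_symm, div_neg,
      neg_smul, neg_neg]

/-- The sum around u becomes a double sum over all pairs of vertices of its polygon. Each edge term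
occurs once in each direction with opposite signs, so the double sum is its own negative. -/
theorem toKoebe_isKoebeHQD (M : MedialData G T w cyc S)
    (hz : ∀ i j, T.graph.Adj i j → P.tangency i ≠ P.tangency j) {q : T.IntEdge → ℝ}
    (hq : IsGeneralHQD T P.tangency q) : IsKoebeHQD P (toKoebe P T q) := by
  classical
  rw [isKoebeHQD_iff]
  intro u hu
  have e1 : ∑ v : G.IntNbr u, ((toKoebe P T q v.2.edge : ℂ) / P.omega v.2) •
      weierstrass (P.tangency s(u, v.1)) (P.tangency s(u, v.1)) =
      ∑ i : Sym2 V, if u ∈ i then polygonSum P.tangency u i q else 0 := by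
    refine Fintype.sum_of_injective (fun v : G.IntNbr u => s(u, v.1)) ?_ _ _ ?_ ?_
    · exact fun v v' e => Subtype.ext (Sym2.mk_injective u e)
    · intro i hi
      refine ite_eq_right_iff.2 fun hui => ?_
      rw [polygonSum_apply]
      refine Finset.sum_eq_zero fun j hj => edgeTerm_eq_zero _ ?_
      by_contra h
      obtain ⟨a, b, -, ha, -, rfl, -⟩ := M.exists_eq_of_mem (isIntEdge_of_weight h).1 hui
        (Finset.mem_filter.1 hj).2
      obtain ⟨-, h | h⟩ := (M.link u).mem_iff_adj.1 ha
      · exact hi ⟨⟨a, h, (hu.2 a).1 h⟩, rfl⟩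
      · exact hi ⟨⟨a, (hu.2 a).2 h, h⟩, rfl⟩
    · intro v
      rw [if_pos (Sym2.mem_mk_left _ _), M.polygonSum_eq hz hq v.2]
  rw [e1, ← Finset.sum_filter]
  simp only [polygonSum_apply]
  have h2 : ∑ i with u ∈ i, ∑ j with u ∈ j, edgeTerm P.tangency i j q =
      -∑ i with u ∈ i, ∑ j with u ∈ j, edgeTerm P.tangency i j q := by
    conv_lhs => rw [Finset.sum_comm]
    simp only [← Finset.sum_neg_distrib]
    exact Finset.sum_congr rfl fun i _ => Finset.sum_congr rfl fun j _ => edgeTerm_swap _ _ _ _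
  exact self_eq_neg.1 h2

/-- Vanishing of the Koebe differential means that each polygon is in equilibrium by itself at its
interior edges of G. The polygon lemma then kills all weights except possibly those on closing
edges. -/
theorem eq_zero_of_toKoebe_eq_zero (M : MedialData G T w cyc S)
    (hz : ∀ i j, T.graph.Adj i j → P.tangency i ≠ P.tangency j) {q : T.IntEdge → ℝ}
    (hq : IsGeneralHQD T P.tangency q) (h0 : toKoebe P T q = 0) : q = 0 := by
  classical
  let Q : V → Sym2 V → Sym2 V → ℝ := fun u i j => if u ∈ i ∧ u ∈ j then weight q i j else 0
  have hQw : ∀ u i j, u ∈ i → u ∈ j → Q u i j = weight q i j := fun u i j hi hj =>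
    if_pos ⟨hi, hj⟩
  have hQne : ∀ u i j, Q u i j ≠ 0 → u ∈ i ∧ u ∈ j ∧ T.IsIntEdge i j := by
    intro u i j h
    by_cases hu : u ∈ i ∧ u ∈ j
    · rw [hQw u i j hu.1 hu.2] at h
      exact ⟨hu.1, hu.2, isIntEdge_of_weight h⟩
    · exact absurd (if_neg hu) h
  have hQs : ∀ u i j, Q u i j = Q u j i := by
    intro u i j
    simp only [Q, weight_symm q i j, and_comm]
  have hQ0 : ∀ u i, Q u i i = 0 := by
    intro u i
    simp only [Q, weight_self, ite_self]
  have hsum : ∀ u a, G.IsIntEdge u a → ∑ j, Q u s(u, a) j = 0 ∧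
      ∑ j, (Q u s(u, a) j : ℂ) / (P.tangency j - P.tangency s(u, a)) = 0 := by
    intro u a h
    have e := M.polygonSum_eq hz hq h
    rw [h0, Pi.zero_apply, Complex.ofReal_zero, zero_div, zero_smul, polygonSum_apply,
      Finset.sum_filter] at e
    rw [← sum_div_smul_weierstrass_eq_zero_iff, ← e]
    · refine Finset.sum_congr rfl fun j _ => ?_
      by_cases hj : u ∈ j
      · rw [hQw _ _ _ (Sym2.mem_mk_left _ _) hj, if_pos hj, edgeTerm_apply]
      · rw [if_neg hj]
        have : Q u s(u, a) j = 0 := if_neg fun h => hj h.2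
        rw [this, Complex.ofReal_zero, zero_div, zero_smul]
    · intro j _ hj
      exact (hz _ _ (hQne _ _ _ hj).2.2.1.adj).symm
  have hinner : ∀ u a, a ∈ w u → (w u).head? ≠ some a → (w u).getLast? ≠ some a →
      ∀ j, Q u s(u, a) j = 0 := by
    intro u a ha hh hl j
    refine (M.poly u).eq_zero_of_equilibrium (M.nodup u) (hQs u) (hQ0 u) (z := P.tangency)
      ?_ ?_ ?_ s(u, a) (List.mem_map.2 ⟨a, ha, rfl⟩) (by rwa [ne_eq, head?_map_iff])
      (by rwa [ne_eq, getLast?_map_iff]) j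
    · intro t ht x hx y hy hxy
      exact hz _ _ (adj_of_mem_face ((M.mem_faces t).2 (Or.inr ⟨u, ht⟩)) hx hy hxy)
    · intro x hx hh hl
      obtain ⟨b, hb, rfl⟩ := List.mem_map.1 hx
      rw [ne_eq, head?_map_iff] at hh
      rw [ne_eq, getLast?_map_iff] at hl
      exact hsum u b ⟨(M.link u).dEdge_iff.2 ⟨hb, fun h => absurd h hl⟩,
        (M.link u).dEdge_iff'.2 ⟨hb, fun h => absurd h hh⟩⟩
    · intro x hx hh hl y hy
      obtain ⟨b, hb, rfl⟩ := List.mem_map.1 hx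
      rw [ne_eq, head?_map_iff] at hh
      obtain ⟨hx, hy, hint⟩ := hQne _ _ _ hy
      obtain ⟨b', c, hbc, -, hc, e, rfl⟩ := M.exists_eq_of_mem hint.1 hx hy
      obtain rfl := Sym2.mk_injective u e
      rcases M.edge_at_cases hbc hint.1 with h | h | h
      · exact Or.inr (Or.inl ((List.map_pair_infix_iff (Sym2.mk_injective u)).2 h))
      · exact absurd h.2 hh
      · exact Or.inr (Or.inr h)
  -- At a boundary vertex the closing edge is not an interior edge of T. At an interior vertex it is
  -- the only edge of the polygon still in question at its end point, where the weights add up to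
  -- zero.
  have hend : ∀ u a b, (w u).head? = some a → (w u).getLast? = some b →
      Q u s(u, a) s(u, b) = 0 := by
    intro u a b ha hb
    by_contra hne
    have hint := (hQne _ _ _ hne).2.2
    by_cases hc : cyc u
    · have haw := List.mem_of_head? ha
      have hs := (hsum u a ⟨(M.link u).dEdge_iff.2 ⟨haw, fun _ => hc⟩,
        (M.link u).dEdge_iff'.2 ⟨haw, fun _ => hc⟩⟩).1
      rw [Fintype.sum_eq_single s(u, b)] at hs
      · exact hne hs
      · intro j hj
        by_contra h
        obtain ⟨h1, h2, h3⟩ := hQne _ _ _ h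
        obtain ⟨a', c, hac, -, hcw, e, rfl⟩ := M.exists_eq_of_mem h3.1 h1 h2
        obtain rfl := Sym2.mk_injective u e
        rw [hQs] at h
        refine h (hinner u c hcw (fun h' => hac ?_) (fun h' => hj ?_) _)
        · rw [ha] at h'
          exact Option.some.inj h'
        · rw [hb] at h'
          rw [Option.some.inj h']
    · exact M.not_isIntEdge_closing hc ha hb hint.1
  ext e
  have he := e.isIntEdge
  obtain ⟨u, a, b, hab, ha, hb, h1, h2⟩ := M.exists_of_dEdge he.1
  rw [← e.edge_isIntEdge, ← weight_eq q he, Pi.zero_apply,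
    ← hQw u _ _ (h1 ▸ Sym2.mem_mk_left _ _) (h2 ▸ Sym2.mem_mk_left _ _), h1, h2]
  by_cases hah : (w u).head? = some a
  · by_cases hbl : (w u).getLast? = some b
    · exact hend u a b hah hbl
    · rw [hQs]
      refine hinner u b hb (fun h => hab ?_) hbl _
      rw [hah] at h
      exact Option.some.inj h
  · by_cases hal : (w u).getLast? = some a
    · by_cases hbh : (w u).head? = some b
      · rw [hQs]
        exact hend u b a hbh hal
      · rw [hQs]
        refine hinner u b hb hbh (fun h => hab ?_) _
        rw [hal] at h
        exact Option.some.inj h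
    · exact hinner u a ha hah hal _

end MedialData

end TriMesh

/-! ### Stereographic projection and minimal surfaces of Koebe type. -/

theorem stereo_apply (z : ℂ) : stereo z 0 = 2 * z.re / (1 + (z.re ^ 2 + z.im ^ 2)) ∧
    stereo z 1 = 2 * z.im / (1 + (z.re ^ 2 + z.im ^ 2)) ∧
    stereo z 2 = (z.re ^ 2 + z.im ^ 2 - 1) / (1 + (z.re ^ 2 + z.im ^ 2)) := by
  have h : ‖z‖ ^ 2 = z.re ^ 2 + z.im ^ 2 := by
    rw [Complex.sq_norm, Complex.normSq_apply]
    ring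
  refine ⟨?_, ?_, ?_⟩ <;>
    simp only [stereo, h, Pi.smul_apply, smul_eq_mul, Matrix.cons_val_zero, Matrix.cons_val_one,
      Matrix.cons_val] <;> ring

theorem dot_three (x y : Fin 3 → ℝ) : x ⬝ᵥ y = x 0 * y 0 + x 1 * y 1 + x 2 * y 2 := by
  simp only [dotProduct, Fin.sum_univ_three]

theorem stereo_dot_self (z : ℂ) : stereo z ⬝ᵥ stereo z = 1 := by
  obtain ⟨h0, h1, h2⟩ := stereo_apply z
  have : 1 + (z.re ^ 2 + z.im ^ 2) ≠ 0 := by positivity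
  rw [dot_three, h0, h1, h2]
  field_simp
  ring

/-- The equation of the plane of a circle on the sphere. -/
theorem plane_eq {c : ℂ} {R : ℝ} {x : Fin 3 → ℝ}
    (hx : x ∈ affineSpan ℝ (stereo '' Metric.sphere c R)) :
    (1 + x 2) - 2 * (c.re * x 0 + c.im * x 1) + (c.re ^ 2 + c.im ^ 2 - R ^ 2) * (1 - x 2) = 0 := by
  refine affineSpan_induction hx (fun x hx => ?_) fun t u v w hu hv hw => ?_
  · obtain ⟨z, hz, rfl⟩ := hx
    obtain ⟨h0, h1, h2⟩ := stereo_apply z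
    have hR : (z.re - c.re) ^ 2 + (z.im - c.im) ^ 2 = R ^ 2 := by
      rw [← Metric.mem_sphere.1 hz, dist_eq_norm, Complex.sq_norm, Complex.normSq_apply, Complex.sub_re,
        Complex.sub_im]
      ring
    have : 1 + (z.re ^ 2 + z.im ^ 2) ≠ 0 := by positivity
    rw [h0, h1, h2]
    field_simp
    linear_combination 2 * hR
  · simp only [vsub_eq_sub, vadd_eq_add, Pi.add_apply, Pi.smul_apply, Pi.sub_apply, smul_eq_mul]
    linear_combination t * hu - t * hv + hw

/-- In coordinates, this is the direction at σ(z) of the image of the line through z perpendicular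
to e, that is, of the common tangent of the two circles. -/
theorem conj_mul_weierstrass_im (e z : ℂ) :
    (conj e * weierstrass z z 0).im =
      -2 * e.re * z.re * z.im - e.im * (1 - z.re ^ 2 + z.im ^ 2) ∧
    (conj e * weierstrass z z 1).im =
      e.re * (1 + z.re ^ 2 - z.im ^ 2) + 2 * e.im * z.re * z.im ∧
    (conj e * weierstrass z z 2).im = 2 * (e.re * z.im - e.im * z.re) := by
  refine ⟨?_, ?_, ?_⟩ <;>
  · simp [weierstrass, Complex.mul_im, Complex.mul_re]
    ring

/-- A vector parallel to the planes of two circles on the sphere which touch at `σ(z)` is parallel to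
their common tangent. -/
theorem exists_eq_tangent {e z : ℂ} (he : e.re ^ 2 + e.im ^ 2 = 1) {d : Fin 3 → ℝ}
    (h1 : 2 * (z.re * d 0 + z.im * d 1) + (z.re ^ 2 + z.im ^ 2 - 1) * d 2 = 0)
    (h2 : e.re * d 0 + e.im * d 1 + (e.re * z.re + e.im * z.im) * d 2 = 0) :
    ∃ r : ℝ, ∀ k, d k = r * (conj e * weierstrass z z k).im := by
  obtain ⟨b0, b1, b2⟩ := conj_mul_weierstrass_im e z
  have hn : (1 + (z.re ^ 2 + z.im ^ 2)) ^ 2 ≠ 0 := by positivity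
  generalize z.re = x at *
  generalize z.im = y at *
  generalize e.re = p at *
  generalize e.im = q at *
  -- The real and imaginary parts of ē · `weierstrass z z` and σ(z) form an orthogonal frame in
  -- which the first two have length 1 + |z|². The witness is the coefficient of d along the
  -- imaginary part.
  refine ⟨(d 0 * (-2 * p * x * y - q * (1 - x ^ 2 + y ^ 2)) +
    d 1 * (p * (1 + x ^ 2 - y ^ 2) + 2 * q * x * y) + d 2 * (2 * (p * y - q * x))) /
      (1 + (x ^ 2 + y ^ 2)) ^ 2, ?_⟩
  -- d is orthogonal to the real part of ē · `weierstrass z z`, and the next equation makes it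
  -- orthogonal to σ(z).
  have hA : d 0 * (p * (1 - x ^ 2 + y ^ 2) - 2 * q * x * y) +
      d 1 * (-2 * p * x * y + q * (1 + x ^ 2 - y ^ 2)) + d 2 * (2 * (p * x + q * y)) = 0 := by
    linear_combination (1 + x ^ 2 + y ^ 2) * h2 - (p * x + q * y) * h1
  have hs : d 0 * (2 * x) + d 1 * (2 * y) + d 2 * (x ^ 2 + y ^ 2 - 1) = 0 := by
    linear_combination h1
  intro k
  rw [div_mul_eq_mul_div, eq_div_iff hn]
  fin_cases k
  · change _ = _ * (conj e * weierstrass z z 0).im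
    rw [b0]
    dsimp only [Fin.zero_eta]
    linear_combination (2 * x) * (p ^ 2 + q ^ 2) * hs + (p * (1 - x ^ 2 + y ^ 2) - 2 * q * x * y) * hA -
      (1 + (x ^ 2 + y ^ 2)) ^ 2 * d 0 * he
  · change _ = _ * (conj e * weierstrass z z 1).im
    rw [b1]
    dsimp only [Fin.mk_one]
    linear_combination (2 * y) * (p ^ 2 + q ^ 2) * hs + (-2 * p * x * y + q * (1 + x ^ 2 - y ^ 2)) * hA -
      (1 + (x ^ 2 + y ^ 2)) ^ 2 * d 1 * he
  · change _ = _ * (conj e * weierstrass z z 2).im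
    rw [b2]
    change d 2 * _ = _
    linear_combination (x ^ 2 + y ^ 2 - 1) * (p ^ 2 + q ^ 2) * hs + (2 * (p * x + q * y)) * hA -
      (1 + (x ^ 2 + y ^ 2)) ^ 2 * d 2 * he

/-- Multiplication of the isotropic vector `(1 - z², i (1 + z²), 2 z)` by `-i` is the vector product
with `σ(z)`. -/
theorem re_cross_stereo (c z : ℂ) :
    (fun k => (c * weierstrass z z k).re) ⨯₃ stereo z = fun k => (c * weierstrass z z k).im := by
  obtain ⟨h0, h1, h2⟩ := stereo_apply z
  have : 1 + (z.re ^ 2 + z.im ^ 2) ≠ 0 := by positivity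
  rw [cross_apply]
  ext k
  fin_cases k <;>
  · simp [h0, h1, h2, weierstrass, Complex.mul_im, Complex.mul_re]
    field_simp
    ring

theorem cross_eq_zero_of_parallel {b x y : Fin 3 → ℝ} {r s : ℝ} (hx : ∀ k, x k = r * b k)
    (hy : ∀ k, y k = s * b k) : x ⨯₃ y = 0 := by
  rw [cross_apply]
  ext k
  fin_cases k <;> simp [hx, hy] <;> ring

section KoebeMinimal

variable {V : Type*} {G : TriMesh V} {P : CirclePacking G}

/-- The vertex lies on the planes of two circles that touch at σ(z), and these planes meet in the
common tangent line at σ(z). -/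
theorem IsKoebePolyhedron.sub_stereo {N : G.Face → Fin 3 → ℝ} (hN : IsKoebePolyhedron P N)
    {u v : V} (h : G.graph.Adj u v) (f : G.Face) (hu : u ∈ f.1) (hv : v ∈ f.1) :
    ∃ t : ℝ, ∀ k, N f k - stereo (P.tangency s(u, v)) k =
      t * (conj (P.dir u v) * weierstrass (P.tangency s(u, v)) (P.tangency s(u, v)) k).im := by
  have he : (P.dir u v).re ^ 2 + (P.dir u v).im ^ 2 = 1 := by
    have := Complex.sq_norm (P.dir u v)
    rw [P.norm_dir h, Complex.normSq_apply] at this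
    linarith
  have e1 := plane_eq (hN f u hu)
  have e2 := plane_eq (hN f v hv)
  have hRu := P.R_pos u
  have hRv := P.R_pos v
  rw [P.center_eq u v] at e1
  rw [P.center_eq' u v] at e2
  obtain ⟨h0, h1, h2⟩ := stereo_apply (P.tangency s(u, v))
  generalize P.tangency s(u, v) = z at *
  generalize P.dir u v = e at *
  generalize P.R u = R at *
  generalize P.R v = R' at *
  generalize N f = x at *
  simp only [Complex.sub_re, Complex.sub_im, Complex.add_re, Complex.add_im, Complex.re_ofReal_mul,
    Complex.im_ofReal_mul] at e1 e2
  -- In the difference of the two plane equations the radii factor out, which leaves the plane of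
  -- the image of the common tangent line in ℂ. The equation `hL` below is the tangent plane of the
  -- sphere at σ(z).
  have hM : e.re * x 0 + e.im * x 1 - (e.re * z.re + e.im * z.im) * (1 - x 2) = 0 := by
    have : (R + R') * (e.re * x 0 + e.im * x 1 - (e.re * z.re + e.im * z.im) * (1 - x 2)) = 0 := by
      linear_combination (e1 - e2) / 2 - (1 - x 2) * (R ^ 2 - R' ^ 2) / 2 * he
    exact (mul_eq_zero.1 this).resolve_left (by positivity)
  have hL : 1 + x 2 - 2 * (z.re * x 0 + z.im * x 1) + (z.re ^ 2 + z.im ^ 2) * (1 - x 2) = 0 := by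
    linear_combination e1 - 2 * R * hM - (1 - x 2) * R ^ 2 * he
  have hn : 1 + (z.re ^ 2 + z.im ^ 2) ≠ 0 := by positivity
  refine exists_eq_tangent he (d := fun k => x k - stereo z k) ?_ ?_
  · rw [h0, h1, h2]
    field_simp
    linear_combination -(1 + (z.re ^ 2 + z.im ^ 2)) * hL
  · rw [h0, h1, h2]
    field_simp
    linear_combination (1 + (z.re ^ 2 + z.im ^ 2)) * hM

variable [Finite V] {N f : G.Face → Fin 3 → ℝ}

/-- The edges of a discrete minimal surface of Koebe type are real parts of the terms of a Weierstrass
formula. -/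
theorem IsKoebeMinimal.exists_differential (hN : IsKoebePolyhedron P N) (hf : IsKoebeMinimal G N f) :
    ∃ l : G.IntEdge → ℝ, ∀ u v (h : G.IsIntEdge u v) k, f h.left k - f h.right k =
      ((l h.edge : ℂ) / P.omega h *
        weierstrass (P.tangency s(u, v)) (P.tangency s(u, v)) k).re := by
  have key : ∀ u v (h : G.IsIntEdge u v), ∃ l : ℝ, ∀ k, f h.left k - f h.right k =
      ((l : ℂ) / P.omega h * weierstrass (P.tangency s(u, v)) (P.tangency s(u, v)) k).re := by
    intro u v h
    obtain ⟨r, hr⟩ := hf.1 u v h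
    obtain ⟨t, ht⟩ := hN.sub_stereo h.1.adj h.left h.mem_left.1 h.mem_left.2
    obtain ⟨t', ht'⟩ := hN.sub_stereo h.1.adj h.right h.mem_right.1 h.mem_right.2
    -- As 1/ω = iκē, the real part of the term is -λκ Im(ē · `weierstrass z z`). The witness solves
    -- -λκ = r (t - t').
    refine ⟨-(r * (t - t')) / P.kappa h, fun k => ?_⟩
    have e := congrFun hr k
    simp only [Pi.sub_apply, Pi.smul_apply, smul_eq_mul] at e
    rw [P.div_omega, div_mul_cancel₀ _ (P.kappa_ne_zero h), e]
    have e2 : N h.left k - N h.right k = (t - t') *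
        (conj (P.dir u v) * weierstrass (P.tangency s(u, v)) (P.tangency s(u, v)) k).im := by
      linear_combination ht k - ht' k
    rw [e2, mul_assoc Complex.I, mul_assoc Complex.I, Complex.I_mul_re, mul_assoc,
      Complex.im_ofReal_mul]
    ring
  choose l hl using key
  refine ⟨fun e => l _ _ e.isIntEdge, ?_⟩
  have key2 : ∀ (e : G.IntEdge) (a b : V) (h : G.IsIntEdge a b), e.src = a → e.tgt = b → ∀ k,
      f h.left k - f h.right k = ((l _ _ e.isIntEdge : ℂ) / P.omega h *
        weierstrass (P.tangency s(a, b)) (P.tangency s(a, b)) k).re := by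
    rintro e a b h rfl rfl k
    exact hl _ _ h k
  intro u v h k
  obtain ⟨h1, h2⟩ | ⟨h1, h2⟩ := IntEdge.src_tgt_edge h
  · exact key2 _ _ _ h h1 h2 k
  · have := key2 _ _ _ h.symm h1 h2 k
    rw [h.symm_left, h.symm_right, P.omega_symm h, Sym2.eq_swap (a := v), div_neg, neg_mul,
      Complex.neg_re] at this
    linarith

/-- The edges of a discrete minimal surface of Koebe type define a holomorphic quadratic
differential. -/
theorem IsKoebeMinimal.isKoebeHQD (hN : IsKoebePolyhedron P N) (hf : IsKoebeMinimal G N f)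
    {l : G.IntEdge → ℝ} (hl : ∀ u v (h : G.IsIntEdge u v) k, f h.left k - f h.right k =
      ((l h.edge : ℂ) / P.omega h *
        weierstrass (P.tangency s(u, v)) (P.tangency s(u, v)) k).re) : IsKoebeHQD P l := by
  rw [isKoebeHQD_iff]
  intro u hu
  have hre := sum_left_sub_right hu f
  have him : ∑ v : G.IntNbr u,
      (f v.2.left - f v.2.right) ⨯₃ stereo (P.tangency s(u, v.1)) = 0 := by
    have h1 := hf.2 u hu
    have h2 := sum_left_sub_right hu fun x => f x ⨯₃ N x
    -- The edge of f is parallel to N - σ(z) on both of its faces, so N may be replaced by σ(z) in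
    -- products with it. Up to the difference of f × N, which telescopes around u, the mixed area
    -- term is -2 times the edge of f times σ(z).
    have h3 : ∀ v : G.IntNbr u, f v.2.right ⨯₃ N v.2.left + N v.2.right ⨯₃ f v.2.left =
        (f v.2.left ⨯₃ N v.2.left - f v.2.right ⨯₃ N v.2.right) -
          (2 : ℝ) • ((f v.2.left - f v.2.right) ⨯₃ stereo (P.tangency s(u, v.1))) := by
      intro v
      have hadj := v.2.1.adj
      obtain ⟨r, hr⟩ := hf.1 _ _ v.2
      obtain ⟨t, ht⟩ := hN.sub_stereo hadj v.2.left v.2.mem_left.1 v.2.mem_left.2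
      obtain ⟨t', ht'⟩ := hN.sub_stereo hadj v.2.right v.2.mem_right.1 v.2.mem_right.2
      have hd : ∀ k, (f v.2.left - f v.2.right) k = (r * (t - t')) * (conj (P.dir u v.1) *
          weierstrass (P.tangency s(u, v.1)) (P.tangency s(u, v.1)) k).im := by
        intro k
        rw [hr]
        simp only [Pi.sub_apply, Pi.smul_apply, smul_eq_mul]
        linear_combination r * ht k - r * ht' k
      have p1 := cross_eq_zero_of_parallel (y := N v.2.left - stereo (P.tangency s(u, v.1))) hd ht
      have p2 := cross_eq_zero_of_parallel (y := N v.2.right - stereo (P.tangency s(u, v.1))) hd ht'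
      rw [map_sub, sub_eq_zero] at p1 p2
      rw [← cross_anticomm (f v.2.left) (N v.2.right), two_smul]
      nth_rewrite 1 [← p1]
      rw [← p2]
      simp only [map_sub, LinearMap.sub_apply]
      abel
    rw [Finset.sum_congr rfl fun v _ => h3 v, Finset.sum_sub_distrib, h2, zero_sub, neg_eq_zero,
      ← Finset.smul_sum] at h1
    exact (smul_eq_zero.1 h1).resolve_left two_ne_zero
  have hterm : ∀ v : G.IntNbr u, f v.2.left - f v.2.right = fun k =>
      ((l v.2.edge : ℂ) / P.omega v.2 *
        weierstrass (P.tangency s(u, v.1)) (P.tangency s(u, v.1)) k).re :=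
    fun v => funext fun k => hl _ _ v.2 k
  -- The real part of the closing condition says that f closes up, and the imaginary part is the
  -- curvature equation.
  ext k
  rw [Finset.sum_apply]
  apply Complex.ext
  · rw [Complex.re_sum]
    have := congrFun hre k
    rw [Finset.sum_apply] at this
    refine Eq.trans (Finset.sum_congr rfl fun v _ => ?_) this
    exact (congrFun (hterm v) k).symm
  · rw [Complex.im_sum]
    have := congrFun him k
    rw [Finset.sum_apply] at this
    refine Eq.trans (Finset.sum_congr rfl fun v _ => ?_) this
    rw [hterm v, re_cross_stereo]
    rfl

end KoebeMinimal

/-! ### Minimal surfaces of general type. -/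

section GeneralMinimal

theorem tan_half_arccos {c : ℝ} (h1 : -1 < c) (h2 : c ≤ 1) :
    Real.tan (Real.arccos c / 2) = Real.sqrt (1 - c ^ 2) / (1 + c) := by
  set θ := Real.arccos c with hθ
  have hc : Real.cos θ = c := Real.cos_arccos h1.le h2
  have hs : Real.sin θ = Real.sqrt (1 - c ^ 2) := Real.sin_arccos c
  have e1 : Real.sin θ = 2 * Real.sin (θ / 2) * Real.cos (θ / 2) := by
    rw [← Real.sin_two_mul]
    ring_nf
  have e2 : Real.cos θ = 2 * Real.cos (θ / 2) ^ 2 - 1 := by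
    rw [← Real.cos_two_mul]
    ring_nf
  have h3 : 1 + c = 2 * Real.cos (θ / 2) ^ 2 := by linarith
  have h4 : Real.cos (θ / 2) ≠ 0 := by
    intro h
    rw [h] at h3
    linarith
  rw [← hs, h3, e1, Real.tan_eq_sin_div_cos]
  field_simp

/-- The square of a triple product is the Gram determinant of the three vectors, which here has only
two non-zero off-diagonal entries. -/
theorem triple_sq (n n' e : Fin 3 → ℝ) (hn : n ⬝ᵥ n = 1) (hn' : n' ⬝ᵥ n' = 1) (h : n ⬝ᵥ e = 0)
    (h' : n' ⬝ᵥ e = 0) : ((n ⨯₃ n') ⬝ᵥ e) ^ 2 = (e ⬝ᵥ e) * (1 - (n ⬝ᵥ n') ^ 2) := by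
  have gram : ((n ⨯₃ n') ⬝ᵥ e) ^ 2 = (n ⬝ᵥ n) * (n' ⬝ᵥ n') * (e ⬝ᵥ e) +
      2 * (n ⬝ᵥ n') * (n' ⬝ᵥ e) * (n ⬝ᵥ e) - (n ⬝ᵥ n) * (n' ⬝ᵥ e) ^ 2 -
      (n' ⬝ᵥ n') * (n ⬝ᵥ e) ^ 2 - (e ⬝ᵥ e) * (n ⬝ᵥ n') ^ 2 := by
    simp only [dot_three, cross_apply, Matrix.cons_val_zero, Matrix.cons_val_one, Matrix.cons_val]
    ring
  rw [gram, hn, hn', h, h']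
  ring

theorem dot_self_nonneg (x : Fin 3 → ℝ) : 0 ≤ x ⬝ᵥ x := by
  rw [dot_three]
  nlinarith [mul_self_nonneg (x 0), mul_self_nonneg (x 1), mul_self_nonneg (x 2)]

theorem one_add_dot_pos {n n' : Fin 3 → ℝ} (hn : n ⬝ᵥ n = 1) (hn' : n' ⬝ᵥ n' = 1)
    (h : n ≠ -n') : 0 < 1 + n ⬝ᵥ n' := by
  have e : (n + n') ⬝ᵥ (n + n') = 2 * (1 + n ⬝ᵥ n') := by
    rw [add_dotProduct, dotProduct_add, dotProduct_add, hn, hn', dotProduct_comm n' n]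
    ring
  have h0 : (n + n') ⬝ᵥ (n + n') ≠ 0 := by
    intro h0
    exact h (eq_neg_of_add_eq_zero_left (dotProduct_self_eq_zero.1 h0))
  have := (dot_self_nonneg (n + n')).lt_of_ne' h0
  linarith

/-- For an edge orthogonal to both normals the quantity `ℓ tan (α / 2)` is algebraic. -/
theorem edgeCurvature_eq {n n' e : Fin 3 → ℝ} (hn : n ⬝ᵥ n = 1) (hn' : n' ⬝ᵥ n' = 1)
    (h : n ⬝ᵥ e = 0) (h' : n' ⬝ᵥ e = 0) (hne : n ≠ -n') :
    edgeCurvature n n' e = ((n ⨯₃ n') ⬝ᵥ e) / (1 + n ⬝ᵥ n') := by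
  have hpos := one_add_dot_pos hn hn' hne
  have hle : n ⬝ᵥ n' ≤ 1 := by
    have e : (n - n') ⬝ᵥ (n - n') = 2 * (1 - n ⬝ᵥ n') := by
      rw [sub_dotProduct, dotProduct_sub, dotProduct_sub, hn, hn', dotProduct_comm n' n]
      ring
    have := dot_self_nonneg (n - n')
    linarith
  have hsq := triple_sq n n' e hn hn' h h'
  have htan := tan_half_arccos (by linarith : -1 < n ⬝ᵥ n') hle
  have habs : Real.sqrt (e ⬝ᵥ e) * Real.sqrt (1 - (n ⬝ᵥ n') ^ 2) = |(n ⨯₃ n') ⬝ᵥ e| := by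
    rw [← Real.sqrt_mul (dot_self_nonneg e), ← hsq, Real.sqrt_sq_eq_abs]
  rw [edgeCurvature]
  rcases lt_trichotomy ((n ⨯₃ n') ⬝ᵥ e) 0 with hlt | h0 | hgt
  · rw [sign_neg hlt, SignType.coe_neg_one, neg_one_mul, neg_div, Real.tan_neg, htan, mul_neg,
      ← mul_div_assoc, habs, abs_of_neg hlt, neg_div, neg_neg]
  · rw [h0, sign_zero, SignType.coe_zero, zero_mul, zero_div, Real.tan_zero, mul_zero, zero_div]
  · rw [sign_pos hgt, SignType.coe_one, one_mul, htan, ← mul_div_assoc, habs, abs_of_pos hgt]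

/-- The imaginary part of the term `(1 - a b, i (1 + a b), a + b) / (b - a)`. -/
theorem weierstrass_div_im {a b : ℂ} (hab : a ≠ b) (q : ℝ) :
    let Y : Fin 3 → ℝ := fun k => ((q : ℂ) / (b - a) * weierstrass a b k).im
    stereo a ⬝ᵥ Y = 0 ∧ stereo b ⬝ᵥ Y = 0 ∧
      (stereo a ⨯₃ stereo b) ⬝ᵥ Y = -q * (1 + stereo a ⬝ᵥ stereo b) := by
  intro Y
  obtain ⟨a0, a1, a2⟩ := stereo_apply a
  obtain ⟨b0, b1, b2⟩ := stereo_apply b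
  have hna : 1 + (a.re ^ 2 + a.im ^ 2) ≠ 0 := by positivity
  have hnb : 1 + (b.re ^ 2 + b.im ^ 2) ≠ 0 := by positivity
  have hD : (b.re - a.re) ^ 2 + (b.im - a.im) ^ 2 ≠ 0 := by
    intro h
    refine hab (Complex.ext ?_ ?_) <;> nlinarith [sq_nonneg (b.re - a.re), sq_nonneg (b.im - a.im)]
  -- Multiplying by the conjugate of b - a makes the denominator real, so the imaginary part can be
  -- taken in the numerator.
  have hY : ∀ k, Y k = q * (conj (b - a) * weierstrass a b k).im /
      ((b.re - a.re) ^ 2 + (b.im - a.im) ^ 2) := by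
    intro k
    have hne : b - a ≠ 0 := sub_ne_zero.2 hab.symm
    have e1 : (((b.re - a.re) ^ 2 + (b.im - a.im) ^ 2 : ℝ) : ℂ) = (b - a) * conj (b - a) := by
      rw [Complex.mul_conj, Complex.normSq_apply, Complex.sub_re, Complex.sub_im]
      congr 1
      ring
    have hc : conj (b - a) ≠ 0 := (map_ne_zero _).2 hne
    have e2 : (q : ℂ) / (b - a) * weierstrass a b k =
        ((q / ((b.re - a.re) ^ 2 + (b.im - a.im) ^ 2) : ℝ) : ℂ) *
          (conj (b - a) * weierstrass a b k) := by
      rw [Complex.ofReal_div, e1]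
      field_simp
    change ((q : ℂ) / (b - a) * weierstrass a b k).im = _
    rw [e2, Complex.im_ofReal_mul]
    ring
  have w0 : (conj (b - a) * weierstrass a b 0).im =
      -(b.re - a.re) * (a.re * b.im + a.im * b.re) -
        (b.im - a.im) * (1 - (a.re * b.re - a.im * b.im)) := by
    simp [weierstrass, Complex.mul_im, Complex.mul_re]
    ring
  have w1 : (conj (b - a) * weierstrass a b 1).im =
      (b.re - a.re) * (1 + (a.re * b.re - a.im * b.im)) +
        (b.im - a.im) * (a.re * b.im + a.im * b.re) := by
    simp [weierstrass, Complex.mul_im, Complex.mul_re]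
    ring
  have w2 : (conj (b - a) * weierstrass a b 2).im =
      (b.re - a.re) * (a.im + b.im) - (b.im - a.im) * (a.re + b.re) := by
    simp [weierstrass, Complex.mul_im]
    ring
  have y0 := hY 0
  have y1 := hY 1
  have y2 := hY 2
  rw [w0] at y0
  rw [w1] at y1
  rw [w2] at y2
  simp only [dot_three, cross_apply, Matrix.cons_val_zero, Matrix.cons_val_one, Matrix.cons_val,
    a0, a1, a2, b0, b1, b2, y0, y1, y2]
  clear y0 y1 y2 w0 w1 w2 hY a0 a1 a2 b0 b1 b2
  generalize a.re = x at *
  generalize a.im = y at *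
  generalize b.re = u at *
  generalize b.im = v at *
  refine ⟨?_, ?_, ?_⟩
  · field_simp
    ring
  · field_simp
    ring
  · field_simp
    ring

/-- The conjugate surface of a Weierstrass realization of general type is a discrete minimal
surface. -/
theorem IsGeneralRealization.isGeneralMinimal {V : Type*} [Finite V] {T : TriMesh V} {z : V → ℂ}
    (hz : ∀ i j, T.graph.Adj i j → z i ≠ z j)
    (ha : ∀ i j, T.graph.Adj i j → stereo (z i) ≠ -stereo (z j)) {q : T.IntEdge → ℝ}
    {F : T.Face → Fin 3 → ℂ} (hF : IsGeneralRealization T z q F) :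
    IsGeneralMinimal T (fun i => stereo (z i)) fun x k => (F x k).im := by
  have hq := hF.isGeneralHQD hz
  have hdiff : ∀ i j (h : T.IsIntEdge i j),
      ((fun k => (F h.left k).im) - fun k => (F h.right k).im) =
        fun k => ((q h.edge : ℂ) / (z j - z i) * weierstrass (z i) (z j) k).im := by
    intro i j h
    ext k
    rw [Pi.sub_apply, ← Complex.sub_im, ← Pi.sub_apply, hF i j h]
    rfl
  refine ⟨fun i j h => ?_, fun i hi => ?_⟩
  · obtain ⟨h1, h2, -⟩ := weierstrass_div_im (hz i j h.1.adj) (q h.edge)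
    dsimp only
    rw [hdiff i j h]
    exact ⟨h1, h2⟩
  -- The triple product is -q times 1 + ⟨σ(z_i), σ(z_j)⟩, which is exactly the denominator of the
  -- half-angle tangent.
  · have : ∀ j : T.IntNbr i, edgeCurvature (stereo (z i)) (stereo (z j.1))
        ((fun k => (F j.2.left k).im) - fun k => (F j.2.right k).im) = -q j.2.edge := by
      intro j
      have hadj := j.2.1.adj
      obtain ⟨h1, h2, h3⟩ := weierstrass_div_im (hz _ _ hadj) (q j.2.edge)
      have hpos := one_add_dot_pos (stereo_dot_self (z i)) (stereo_dot_self (z j.1)) (ha _ _ hadj)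
      rw [hdiff, edgeCurvature_eq (stereo_dot_self _) (stereo_dot_self _) h1 h2 (ha _ _ hadj), h3,
        mul_div_cancel_right₀ _ hpos.ne']
    dsimp only
    rw [Finset.sum_congr rfl fun j _ => this j, Finset.sum_neg_distrib, (hq i hi).1, neg_zero]

end GeneralMinimal

/-! ### The bijection by comparison of dimensions, and the theorem. -/

section Correspondence

variable {V : Type*} [Finite V] {G : TriMesh V} {T : TriMesh (Sym2 V)}

/-- The space of differentials of Koebe type. -/
noncomputable def koebeSpace (P : CirclePacking G) : Submodule ℝ (G.IntEdge → ℝ) where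
  carrier := {l | IsKoebeHQD P l}
  add_mem' := by
    intro l l' h h'
    rw [Set.mem_ofPred_eq, isKoebeHQD_iff] at *
    intro u hu
    simp only [Pi.add_apply, Complex.ofReal_add, add_div, add_smul, Finset.sum_add_distrib, h u hu,
      h' u hu, add_zero]
  zero_mem' := by
    rw [Set.mem_ofPred_eq, isKoebeHQD_iff]
    intro u hu
    simp
  smul_mem' := by
    intro r l h
    rw [Set.mem_ofPred_eq, isKoebeHQD_iff] at *
    intro u hu
    simp only [Pi.smul_apply, smul_eq_mul, Complex.ofReal_mul, mul_div_assoc, mul_smul,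
      ← Finset.smul_sum, h u hu, smul_zero]

/-- The space of differentials of general type. -/
noncomputable def generalSpace {W : Type*} [Finite W] (T : TriMesh W) (z : W → ℂ) :
    Submodule ℝ (T.IntEdge → ℝ) where
  carrier := {q | IsGeneralHQD T z q}
  add_mem' := by
    intro q q' h h' i hi
    have h1 := h i hi
    have h2 := h' i hi
    simp only [Pi.add_apply, Complex.ofReal_add, add_div, Finset.sum_add_distrib, h1.1, h1.2, h2.1,
      h2.2, add_zero, and_self]
  zero_mem' := by
    intro i hi
    simp
  smul_mem' := by
    intro r q h i hi
    have h1 := h i hi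
    simp only [Pi.smul_apply, smul_eq_mul, Complex.ofReal_mul, mul_div_assoc, ← Finset.mul_sum,
      h1.1, h1.2, mul_zero, and_self]

/-- The one-to-one correspondence between differentials of Koebe type and of general type, with the
extension of Weierstrass realizations. -/
theorem exists_correspondence (hG : G.IsDisk) (hT : G.IsMedialTriangulation T)
    (P : CirclePacking G) (hz : ∀ i j, T.graph.Adj i j → P.tangency i ≠ P.tangency j) :
    ∃ Ψ : {l : G.IntEdge → ℝ // IsKoebeHQD P l} ≃
      {q : T.IntEdge → ℝ // IsGeneralHQD T P.tangency q}, ∀ l, ∃ F F',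
        IsKoebeRealization P l.1 F ∧ IsGeneralRealization T P.tangency (Ψ l).1 F' ∧
          ∀ f, F' (medialFace hT f) = F f := by
  have := Fintype.ofFinite V
  obtain ⟨w, cyc, S, M⟩ := hT.exists_data
  obtain ⟨Λ, hΛ⟩ := exists_extension hG hT P hz
  let A : koebeSpace P →ₗ[ℝ] generalSpace T P.tangency := Λ.restrict fun l hl => by
    obtain ⟨F, F', -, h, -⟩ := hΛ l hl
    exact h.isGeneralHQD hz
  let B : generalSpace T P.tangency →ₗ[ℝ] koebeSpace P :=
    (toKoebe P T).restrict fun q hq => M.toKoebe_isKoebeHQD hz hq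
  have hA : Function.Injective A := by
    rw [injective_iff_map_eq_zero]
    intro l hl
    obtain ⟨F, F', h1, h2, h3⟩ := hΛ l.1 l.2
    have : Λ l.1 = 0 := congrArg Subtype.val hl
    rw [this] at h2
    exact Subtype.ext (h1.eq_zero hG hT h2 h3)
  have hB : Function.Injective B := by
    rw [injective_iff_map_eq_zero]
    intro q hq
    exact Subtype.ext (M.eq_zero_of_toKoebe_eq_zero hz q.2 (congrArg Subtype.val hq))
  -- Injections in both directions between finite-dimensional spaces give equal dimensions. Whether
  -- A and B are inverse to each other is not needed.
  have hdim := le_antisymm (LinearMap.finrank_le_finrank_of_injective hA)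
    (LinearMap.finrank_le_finrank_of_injective hB)
  have hbij : Function.Bijective A :=
    ⟨hA, (LinearMap.injective_iff_surjective_of_finrank_eq_finrank hdim).1 hA⟩
  exact ⟨Equiv.ofBijective A hbij, fun l => hΛ l.1 l.2⟩

end Correspondence

theorem theorem6p1 {V : Type*} [Finite V] (G : TriMesh V) (hG : G.IsDisk) (P : CirclePacking G)
    (T : TriMesh (Sym2 V)) (hT : G.IsMedialTriangulation T)
    (hz : ∀ i j, T.graph.Adj i j → P.tangency i ≠ P.tangency j) :
    ∃ Ψ : {l : G.IntEdge → ℝ // IsKoebeHQD P l} ≃ {q : T.IntEdge → ℝ // IsGeneralHQD T P.tangency q},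
      -- both differentials have Weierstrass realizations, and these agree on `F(G)` up to translation
      (∀ l : {l : G.IntEdge → ℝ // IsKoebeHQD P l},
        (∃ F, IsKoebeRealization P l.1 F) ∧
        (∃ F', IsGeneralRealization T P.tangency (Ψ l).1 F') ∧
        ∀ F F', IsKoebeRealization P l.1 F → IsGeneralRealization T P.tangency (Ψ l).1 F' →
          ∃ a : Fin 3 → ℂ, ∀ (u v w : V) (h : tri u v w ∈ G.faces),
            F' ⟨tri s(u, v) s(v, w) s(w, u), hT.mem h⟩ = F ⟨tri u v w, h⟩ + a) ∧
      -- every minimal surface of Koebe type extends to one of general type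
      (∀ N f : G.Face → Fin 3 → ℝ, IsKoebePolyhedron P N → IsKoebeMinimal G N f →
        ∃ (l : {l : G.IntEdge → ℝ // IsKoebeHQD P l}) (F : G.Face → Fin 3 → ℂ)
          (F' : T.Face → Fin 3 → ℂ),
          IsKoebeRealization P l.1 F ∧ IsGeneralRealization T P.tangency (Ψ l).1 F' ∧
          (∀ x k, (F x k).re = f x k) ∧
          (∀ (u v w : V) (h : tri u v w ∈ G.faces),
            F' ⟨tri s(u, v) s(v, w) s(w, u), hT.mem h⟩ = F ⟨tri u v w, h⟩) ∧
          ((∀ i j, T.graph.Adj i j → stereo (P.tangency i) ≠ -stereo (P.tangency j)) →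
            IsGeneralMinimal T (fun i => stereo (P.tangency i)) (fun x k => (F' x k).im))) := by
  obtain ⟨Ψ, hΨ⟩ := exists_correspondence hG hT P hz
  obtain ⟨f₀⟩ : Nonempty G.Face := by
    obtain ⟨a, b, ⟨c, hc⟩, -⟩ := hG.boundary
    exact ⟨⟨_, hc⟩⟩
  refine ⟨Ψ, fun l => ?_, fun N f hN hf => ?_⟩
  · obtain ⟨F₀, F₀', h1, h2, h3⟩ := hΨ l
    refine ⟨⟨F₀, h1⟩, ⟨F₀', h2⟩, fun F F' hF hF' => ?_⟩
    -- Compare with the matching pair F₀, F₀': two realizations of the same differential differ by a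
    -- constant, for F' at least on the medial triangles.
    have key : ∀ x, F' (medialFace hT x) = F x + (F' (medialFace hT f₀) - F f₀) := by
      intro x
      have e1 := hF.sub_const hG h1 x f₀
      have e2 := hF'.sub_const hG.connected hT h2 x f₀
      rw [h3, h3] at e2
      have e3 := congrArg₂ (· - ·) e2 e1
      simp only [sub_sub_sub_cancel_right] at e3
      rw [← sub_eq_iff_eq_add', e3]
    exact ⟨_, fun u v w h => (congrArg F' (medialFace_eq hT h)).symm.trans (key _)⟩
  · obtain ⟨l, hl⟩ := hf.exists_differential hN
    have hl' := hf.isKoebeHQD hN hl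
    obtain ⟨F, F', h1, h2, h3⟩ := hΨ ⟨l, hl'⟩
    -- f and Re F have the same jumps, so they differ by a constant vector on the disk.
    have hre : ∀ x y k, (F x k).re - f x k = (F y k).re - f y k := by
      intro x y k
      refine hG.const_of_left_eq_right (fun t => (F t k).re - f t k) (fun u v h => ?_) x y
      have e1 := hl u v h k
      have e2 := congrArg Complex.re (congrFun (isKoebeRealization_iff.1 h1 u v h) k)
      simp only [Pi.sub_apply, Complex.sub_re, Pi.smul_apply, smul_eq_mul] at e2
      linarith
    -- Subtracting this real vector from both F and F' makes Re F equal to f and preserves all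
    -- jumps.
    let a : Fin 3 → ℂ := fun k => (((F f₀ k).re - f f₀ k : ℝ) : ℂ)
    have h2' : IsGeneralRealization T P.tangency (Ψ ⟨l, hl'⟩).1 fun t => F' t - a := by
      intro i j h
      rw [sub_sub_sub_cancel_right]
      exact h2 i j h
    refine ⟨⟨l, hl'⟩, fun x => F x - a, fun x => F' x - a, fun u v h => ?_, h2', fun x k => ?_,
      fun u v w h => ?_, fun ha => h2'.isGeneralMinimal hz ha⟩
    · rw [sub_sub_sub_cancel_right]
      exact h1 u v h
    · have := hre x f₀ k
      simp only [a, Pi.sub_apply, Complex.sub_re, Complex.ofReal_re]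
      linarith
    · exact congrArg (· - a) ((congrArg F' (medialFace_eq hT h)).symm.trans (h3 _))
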